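/- Let $(Z,g_Z)$ be a connected smooth Riemannian manifold of dimension $n\ge 2$ which is Zoll, that is, every unit speed geodesic of $Z$ is closed with minimal period $2\pi$. Let $c\ge 1$ be an integer, and equip $M=Z\times S^1$ with the Lorentzian metric $g_c=g_Z-\frac1{c^2}dt^2$, where $t$ is the angle coordinate (of period $2\pi$) on $S^1$, time-oriented by $\partial_t$. Let $C^+\subset TM$ be the bundle of future null vectors, and let $$\mathcal N_c=\{\gamma(I)\mid \gamma:I\to M\text{ a maximal geodesic of }g_c\text{ with }\dot\gamma\subset C^+\}$$ be the space of null geodesics, with its projection $q:C^+\to\mathcal N_c$ that sends $v$ to the null geodesic with initial velocity $v$. For $x\in M$ let the sky of $x$ be $\mathfrak S_x=\{\gamma\in\mathcal N_c\mid x\in\gamma\}$. Let $STZ=\{u\in TZ\mid g_Z(u,u)=1\}$, a submanifold of $TZ$, with projection $\pi:STZ\to Z$ and canonical contact structure $\chi_u=(T_u\pi)^{-1}(\langle u\rangle^\perp)$. Then the following hold. 1. There is an action of $\mathbb Z_c$ on $STZ$ whose generator sends $u$ to $\dot\mu_u(2\pi/c)$, where $\mu_u$ is the geodesic with $\dot\mu_u(0)=u$.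 The orbit space $STZ/\mathbb Z_c$, with the quotient topology, is a smooth manifold of dimension $2n-1$ for which the projection $r:STZ\to STZ/\mathbb Z_c$ is a local diffeomorphism. 2. $\mathcal N_c$ is a smooth manifold of dimension $2n-1$ (Hausdorff and second countable), with the smooth structure for which $q$ is a surjective submersion. 3. The canonical contact structure $\mathcal H$ of $\mathcal N_c$ is well defined: it is the codimension-one distribution such that $\mathcal H_\gamma=T_\gamma\mathfrak S_x\oplus T_\gamma\mathfrak S_y$ for every $\gamma\in\mathcal N_c$ and all $x,y\in\gamma$ that are not conjugate along $\gamma$ (i.e. $T_\gamma\mathfrak S_x\cap T_\gamma\mathfrak S_y=0$), and every $\gamma$ has such a pair $x,y$. Here $T_\gamma\mathfrak S_x$ is the span of the velocities at $\gamma$ of the smooth curves in $\mathcal N_c$ that stay in $\mathfrak S_x$. 4. The pushforward $r_*\chi$ is a well-defined distribution on $STZ/\mathbb Z_c$, and there is a diffeomorphism $\Psi:\mathcal N_c\to STZ/\mathbb Z_c$ with $\Psi_*\mathcal H=r_*\chi$. -/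

import Mathlib

open Set Manifold Bundle
open scoped ContDiff Manifold Topology

noncomputable section

namespace NullGeodesics

/-! ### Metrics and geodesics on a manifold (without boundary) -/

section Geodesics

variable {E : Type*} [NormedAddCommGroup E] [NormedSpace ℝ E]
  {H : Type*} [TopologicalSpace H] (I : ModelWithCorners ℝ E H)
  {M : Type*} [TopologicalSpace M] [ChartedSpace H M]

/-- A field of bilinear forms on the tangent spaces. It is applied below to the Riemannian metric
of `Z` and to the Lorentzian metric of `Z × S¹`. -/
abbrev BilinField (M : Type*) [TopologicalSpace M] [ChartedSpace H M] : Type _ :=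
  ∀ x : M, LinearMap.BilinForm ℝ (TangentSpace I x)

/-- The velocity of a curve, as a point of the tangent bundle. -/
def velocity (γ : ℝ → M) (t : ℝ) : TangentBundle I M :=
  ⟨γ t, (mfderiv 𝓘(ℝ, ℝ) I γ t (1 : ℝ) : TangentSpace I (γ t))⟩

variable {I}

/-- The metric `g` in the coordinates of the preferred chart at `x₀`: the Gram form
`G_y(v, w) = g(dφ⁻¹_y v, dφ⁻¹_y w)`. -/
def localMetric (g : BilinField I M) (x₀ : M) (y : E) : E → E → ℝ :=
  let D : E →L[ℝ] TangentSpace I ((extChartAt I x₀).symm y) :=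
    mfderiv 𝓘(ℝ, E) I (extChartAt I x₀).symm y
  fun v w => g ((extChartAt I x₀).symm y) (D v) (D w)

/-- Christoffel symbols of the first kind of the coordinate metric `G`, i.e.
`G(∇_u v, w)` for constant vector fields `u, v, w`. -/
def christoffel (G : E → E → E → ℝ) (y u v w : E) : ℝ :=
  (fderiv ℝ (fun z => G z v w) y u + fderiv ℝ (fun z => G z u w) y v
    - fderiv ℝ (fun z => G z u v) y w) / 2

/-- `γ` is a geodesic of `g` on the nonempty open interval `J`: it is smooth there, and in local
coordinates `x(t)` it satisfies the geodesic equation `ẍᵏ + Γᵏᵢⱼ ẋⁱ ẋʲ = 0`, written with the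
index `k` lowered: `G_x(ẍ, w) + Γ_x(ẋ, ẋ, w) = 0` for all `w`. The values of `γ` outside `J` play
no role. -/
structure IsGeodesicOn (g : BilinField I M) (γ : ℝ → M) (J : Set ℝ) : Prop where
  isOpen : IsOpen J
  ordConnected : J.OrdConnected
  nonempty : J.Nonempty
  contMDiffOn : ContMDiffOn 𝓘(ℝ, ℝ) I ∞ γ J
  equation : ∀ t ∈ J, ∀ x₀ : M, γ t ∈ (extChartAt I x₀).source → ∀ w : E,
    let x : ℝ → E := fun s => extChartAt I x₀ (γ s)
    localMetric g x₀ (x t) (deriv (deriv x) t) w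
      + christoffel (localMetric g x₀) (x t) (deriv x t) (deriv x t) w = 0

/-- A geodesic that does not extend to a geodesic on a larger interval. -/
def IsMaximalGeodesic (g : BilinField I M) (γ : ℝ → M) (J : Set ℝ) : Prop :=
  IsGeodesicOn g γ J ∧
    ∀ (γ' : ℝ → M) (J' : Set ℝ), IsGeodesicOn g γ' J' → J ⊆ J' → EqOn γ' γ J → J' = J

end Geodesics

/-! ### The space of null geodesics -/

section NullGeodesics

variable {E : Type*} [NormedAddCommGroup E] [NormedSpace ℝ E]
  {H : Type*} [TopologicalSpace H] {I : ModelWithCorners ℝ E H}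
  {M : Type*} [TopologicalSpace M] [ChartedSpace H M]

/-- The bundle `C⁺` of future null vectors of a Lorentzian metric `g`. The time orientation is
given by a one-form `τ`: the future hemicones are those on which `τ` is positive. -/
def futureCone (g : BilinField I M) (τ : ∀ x : M, TangentSpace I x →L[ℝ] ℝ) :
    Set (TangentBundle I M) :=
  {v | v.2 ≠ 0 ∧ g v.1 v.2 v.2 = 0 ∧ 0 < τ v.1 v.2}

/-- The set `𝒩` of null geodesics: images of maximal geodesics whose velocity lies in `C⁺`. -/
def NullGeodesic (g : BilinField I M) (τ : ∀ x : M, TangentSpace I x →L[ℝ] ℝ) : Type _ :=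
  {A : Set M // ∃ (γ : ℝ → M) (J : Set ℝ), IsMaximalGeodesic g γ J ∧
    (∀ t ∈ J, velocity I γ t ∈ futureCone g τ) ∧ A = γ '' J}

variable {g : BilinField I M} {τ : ∀ x : M, TangentSpace I x →L[ℝ] ℝ}

/-- `q : C⁺ → 𝒩` sends a future null vector to the null geodesic that it generates. -/
def IsGeodesicProjection (q : futureCone g τ → NullGeodesic g τ) : Prop :=
  ∀ v : futureCone g τ, ∃ (γ : ℝ → M) (J : Set ℝ), IsMaximalGeodesic g γ J ∧ 0 ∈ J ∧
    velocity I γ 0 = v ∧ (q v).1 = γ '' J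

/-- The sky of a point `x`: all null geodesics through `x`. -/
def sky (g : BilinField I M) (τ : ∀ x : M, TangentSpace I x →L[ℝ] ℝ) (x : M) :
    Set (NullGeodesic g τ) :=
  {γ | x ∈ γ.1}

variable {E' : Type*} [NormedAddCommGroup E'] [NormedSpace ℝ E']
  {H' : Type*} [TopologicalSpace H'] (I' : ModelWithCorners ℝ E' H')
  [TopologicalSpace (NullGeodesic g τ)]
  [ChartedSpace H' (NullGeodesic g τ)]

/-- The tangent space `T_γ 𝔖_x` of the sky of `x` at `γ`: the span of the velocities at `γ` of
smooth curves in `𝒩` that stay in the sky. -/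
def skyTangent (x : M) (γ : NullGeodesic g τ) : Submodule ℝ (TangentSpace I' γ) :=
  Submodule.span ℝ {ξ | ∃ σ : ℝ → NullGeodesic g τ, ContMDiff 𝓘(ℝ, ℝ) I' ∞ σ ∧
    (∀ s, σ s ∈ sky g τ x) ∧ velocity I' σ 0 = ⟨γ, ξ⟩}

/-- Two points `x, y` of `γ` are not joined, to first order, by a one-parameter family of null
geodesics around `γ` (they are not conjugate along `γ`): a vector tangent to both skies at `γ`
is zero. -/
def NotConjugate (x y : M) (γ : NullGeodesic g τ) : Prop :=
  Disjoint (skyTangent I' x γ) (skyTangent I' y γ)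

/-- `ℋ` is the canonical (contact) distribution on the manifold `𝒩`: it has codimension one,
and `ℋ_γ = T_γ 𝔖_x ⊕ T_γ 𝔖_y` for all nonconjugate points `x, y` of `γ`, of which every `γ`
has at least one pair. (The sum is direct by `NotConjugate`.) -/
structure IsCanonicalContactStructure
    (ℋ : ∀ γ : NullGeodesic g τ, Submodule ℝ (TangentSpace I' γ)) : Prop where
  codim_one : ∀ γ : NullGeodesic g τ, Module.finrank ℝ (ℋ γ) + 1 = Module.finrank ℝ (TangentSpace I' γ)
  exists_notConjugate : ∀ γ : NullGeodesic g τ, ∃ x ∈ γ.1, ∃ y ∈ γ.1, NotConjugate I' x y γ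
  eq_sup : ∀ γ : NullGeodesic g τ, ∀ x ∈ γ.1, ∀ y ∈ γ.1, NotConjugate I' x y γ →
    ℋ γ = skyTangent I' x γ ⊔ skyTangent I' y γ

end NullGeodesics

/-- The distribution `η` on `N` is the pushforward `f_* ξ` of the distribution `ξ` on `M`, for a
map `f : M → N`: `η_{f(x)} = df_x(ξ_x)` for all `x`. -/
def IsPushforward {E : Type*} [NormedAddCommGroup E] [NormedSpace ℝ E]
    {H : Type*} [TopologicalSpace H] (I : ModelWithCorners ℝ E H)
    {E' : Type*} [NormedAddCommGroup E'] [NormedSpace ℝ E']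
    {H' : Type*} [TopologicalSpace H'] (I' : ModelWithCorners ℝ E' H')
    {M : Type*} [TopologicalSpace M] [ChartedSpace H M]
    {N : Type*} [TopologicalSpace N] [ChartedSpace H' N] (f : M → N)
    (ξ : ∀ x : M, Submodule ℝ (TangentSpace I x))
    (η : ∀ y : N, Submodule ℝ (TangentSpace I' y)) : Prop :=
  ∀ x : M, η (f x) = (ξ x).map (mfderiv I I' f x).toLinearMap

/-! ### Zoll manifolds -/

section Zoll

variable {n : ℕ} {Z : Type*} [TopologicalSpace Z] [ChartedSpace (EuclideanSpace ℝ (Fin n)) Z]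
  [IsManifold (𝓡 n) ∞ Z]

/-- Smooth Riemannian metrics on `Z`. -/
abbrev RiemannianMetric (n : ℕ) (Z : Type*) [TopologicalSpace Z]
    [ChartedSpace (EuclideanSpace ℝ (Fin n)) Z] [IsManifold (𝓡 n) ∞ Z] : Type _ :=
  ContMDiffRiemannianMetric (𝓡 n) ∞ (EuclideanSpace ℝ (Fin n))
    (fun x : Z => TangentSpace (𝓡 n) x)

/-- The unit tangent bundle `STZ`, with the subspace topology of `TZ`. -/
def unitTangentBundle (g : RiemannianMetric n Z) : Set (TangentBundle (𝓡 n) Z) :=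
  {u | g.inner u.1 u.2 u.2 = 1}

/-- The Riemannian metric as a field of bilinear forms. -/
def RiemannianMetric.form (g : RiemannianMetric n Z) : BilinField (𝓡 n) Z := fun x =>
  (g.inner x).toBilinForm

/-- All unit speed geodesics are closed, with minimal period `2π`. -/
def IsZoll (g : RiemannianMetric n Z) : Prop :=
  ∀ u ∈ unitTangentBundle g, ∃ μ : ℝ → Z, IsGeodesicOn g.form μ univ ∧
    velocity (𝓡 n) μ 0 = u ∧ Function.Periodic μ (2 * Real.pi) ∧
    ∀ T, 0 < T → Function.Periodic μ T → 2 * Real.pi ≤ T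

/-- The canonical contact structure `χ` on `STZ`: `χ_u = (T_u π)⁻¹(⟨u⟩^⊥)`, for the projection
`π : STZ → Z`. -/
def canonicalContact (g : RiemannianMetric n Z) {d : ℕ}
    [ChartedSpace (EuclideanSpace ℝ (Fin d)) (unitTangentBundle g)]
    (u : unitTangentBundle g) : Submodule ℝ (TangentSpace (𝓡 d) u) :=
  (LinearMap.ker (g.inner u.1.1 u.1.2).toLinearMap).comap
    (mfderiv (𝓡 d) (𝓡 n) (fun v : unitTangentBundle g => v.1.1) u).toLinearMap

/-- The generator `1` of `ℤ_c` acts on `STZ` by moving a unit vector `1/c` of a turn along the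
closed geodesic (of length `2π`) that it generates. -/
def ActsByTurns (g : RiemannianMetric n Z) (c : ℕ)
    [AddAction (ZMod c) (unitTangentBundle g)] : Prop :=
  ∀ u : unitTangentBundle g, ∃ μ : ℝ → Z, IsGeodesicOn g.form μ univ ∧
    velocity (𝓡 n) μ 0 = u ∧
    velocity (𝓡 n) μ (2 * Real.pi / c) = (((1 : ZMod c) +ᵥ u : unitTangentBundle g) : _)

/-- The one-form `dt` on the circle, for the angle coordinate `t` with `z = e^{it}`:
`dt(v) = Im(z̄ dz(v))`. -/
def dtCircle (z : Circle) : TangentSpace (𝓡 1) z →L[ℝ] ℝ :=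
  let dz : TangentSpace (𝓡 1) z →L[ℝ] ℂ :=
    mfderiv (𝓡 1) 𝓘(ℝ, ℂ) (fun w : Circle => (w : ℂ)) z
  Complex.imCLM ∘L (ContinuousLinearMap.mul ℝ ℂ (star (z : ℂ))) ∘L dz

/-- The one-form `dt` on `Z × S¹`. It gives the time orientation: a null vector is in the same
hemicone as `∂_t` if and only if `dt` is positive on it. -/
def dt (p : Z × Circle) : TangentSpace ((𝓡 n).prod (𝓡 1)) p →L[ℝ] ℝ :=
  (dtCircle p.2).comp (mfderiv ((𝓡 n).prod (𝓡 1)) (𝓡 1) Prod.snd p)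

/-- The Lorentzian metric `g_Z - (1/c²) dt²` on `Z × S¹`. -/
def lorentzMetric (g : RiemannianMetric n Z) (c : ℕ) :
    BilinField ((𝓡 n).prod (𝓡 1)) (Z × Circle) := fun p =>
  let D : TangentSpace ((𝓡 n).prod (𝓡 1)) p →L[ℝ] TangentSpace (𝓡 n) p.1 :=
    mfderiv ((𝓡 n).prod (𝓡 1)) (𝓡 n) Prod.fst p
  (g.form p.1).compl₁₂ D.toLinearMap D.toLinearMap
    - (1 / (c : ℝ) ^ 2) • (LinearMap.mul ℝ ℝ).compl₁₂ (dt p).toLinearMap (dt p).toLinearMap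

end Zoll

end NullGeodesics

end

/-! A geodesic of the product is a geodesic of `Z` paired with a curve of constant angular velocity
in the circle (`isGeodesicOn_lorentzMetric_iff`). Nullity couples the two factors: unit speed in `Z`
forces angular velocity `c`. Up to parametrization, the future null geodesics are therefore the
curves s ↦ (μ_u(s), e^{ics}) with u a unit vector, and `toNullGeodesic` maps STZ onto 𝒩_c. Such a
curve is at time zero exactly at the multiples of 2π/c, so u is determined up to flowing through a
multiple of 2π/c. The geodesic flow has period 2π, so these flow maps form an action of ℤ_c; it is
free because 2π is the minimal period, and its orbits are the fibres of `toNullGeodesic`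
(`mk_eq_mk_iff`). Hence STZ/ℤ_c and 𝒩_c are quotients of one manifold by one finite free group of
diffeomorphisms, which gives their smooth structures and the diffeomorphism Ψ. The projection q is a
submersion because through every v in C⁺ passes a smooth map STZ → C⁺ whose composition with q is
the local diffeomorphism `toNullGeodesic`.

For the contact structures, pull the sky of (z, e^{ics}) back to STZ: it consists of the unit
vectors whose geodesic is at z at one of the c times s + 2πi/c. Flowing a variation inside the sky
to such a time makes it vertical, so the contact form g(u, dπ ·) vanishes on it, and the first
variation formula says that the flow preserves this form (`contactForm_tangentMap_flow`). Tangent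
spaces of skies therefore lie in the pushforward of χ (`skyTangent_le`). Each has dimension at least
n - 1, that of a fibre of STZ, while χ has dimension 2n - 2; so two of them with zero intersection
span the pushforward (`isCanonicalContactStructure`).

Nonconjugate pairs need care, because several branches of a sky cross at a null geodesic that visits
z at several of the c times. A Baire argument together with minimality of the period yields an open
nonempty set of times without such coincidences. Two close times in this set give nonconjugate
events: in coordinates the flow moves the base point by τΨ, and the derivative of Ψ in the fibre
direction tends to the identity as τ → 0 (`exists_pos_forall_tangentMap_flow`).

The analytic input is smoothness of the geodesic flow. It rests on smooth dependence of solutions of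
differential equations on time and initial value, obtained from the inverse function theorem in a
space of continuous curves (`exists_smooth_local_flow`). -/

noncomputable section

namespace NullGeodesics

/-! ### Calculus on spaces of continuous maps. -/

section Postcomposition

universe u

set_option synthInstance.maxHeartbeats 200000

variable {K : Type*} [TopologicalSpace K] [CompactSpace K]
  {E F : Type u} [NormedAddCommGroup E] [NormedSpace ℝ E] [NormedAddCommGroup F] [NormedSpace ℝ F]

/-- Pointwise application of a continuous family of operators to a continuous family of vectors. -/
def pointwiseApply : C(K, E →L[ℝ] F) →L[ℝ] C(K, E) →L[ℝ] C(K, F) :=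
  LinearMap.mkContinuous₂
    (LinearMap.mk₂ ℝ (fun (A : C(K, E →L[ℝ] F)) (h : C(K, E)) =>
        (⟨fun k => A k (h k), A.continuous.clm_apply h.continuous⟩ : C(K, F)))
      (by intros; ext; simp) (by intros; ext; simp) (by intros; ext; simp) (by intros; ext; simp))
    1 (by
      intro A h
      rw [one_mul, ContinuousMap.norm_le _ (by positivity)]
      intro k
      exact (A k).le_of_opNorm_le_of_le (A.norm_coe_le_norm k) (h.norm_coe_le_norm k))

@[simp] lemma pointwiseApply_apply (A : C(K, E →L[ℝ] F)) (h : C(K, E)) (k : K) :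
    pointwiseApply A h k = A k (h k) := rfl

/-- Postcomposition with a `C¹` map is differentiable on the space of continuous maps. -/
lemma hasFDerivAt_postcomp (f : C(E, F)) (f' : C(E, E →L[ℝ] F))
    (hf : ∀ x, HasFDerivAt f (f' x) x) (α : C(K, E)) :
    HasFDerivAt (fun β : C(K, E) => f.comp β) (pointwiseApply (f'.comp α)) α := by
  rw [hasFDerivAt_iff_isLittleO_nhds_zero, Asymptotics.isLittleO_iff]
  intro ε hε
  -- Sup-norm continuity of postcomposition with `f'` makes the mean value estimate below uniform in
  -- `k`.
  have hc : ContinuousAt (fun β : C(K, E) => f'.comp β) α :=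
    (ContinuousMap.continuous_postcomp f').continuousAt
  obtain ⟨δ, hδ, hd⟩ := (@Metric.continuousAt_iff C(K, E) C(K, E →L[ℝ] F) _ _
    (fun β => f'.comp β) α).1 hc ε hε
  filter_upwards [Metric.ball_mem_nhds (0 : C(K, E)) hδ] with h hh
  rw [ContinuousMap.norm_le _ (by positivity)]
  intro k
  have hseg : ∀ z ∈ segment ℝ (α k) (α k + h k), ‖f' z - f' (α k)‖ ≤ ε := by
    intro z hz
    rw [segment_eq_image'] at hz
    obtain ⟨s, hs, rfl⟩ := hz
    have h1 : dist (α + s • h) α < δ := by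
      rw [dist_eq_norm, add_sub_cancel_left, norm_smul, Real.norm_eq_abs, abs_of_nonneg hs.1]
      have := mem_ball_zero_iff.1 hh
      nlinarith [hs.2, norm_nonneg h]
    have h2 := (ContinuousMap.dist_lt_iff hε).1 (hd h1) k
    rw [dist_eq_norm] at h2
    simpa using h2.le
  have := (convex_segment (𝕜 := ℝ) (α k) (α k + h k)).norm_image_sub_le_of_norm_hasFDerivWithin_le'
    (f := f) (f' := f') (φ := f' (α k)) (C := ε)
    (fun z _ => (hf z).hasFDerivWithinAt) hseg (left_mem_segment _ _ _) (right_mem_segment _ _ _)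
  simp only [add_sub_cancel_left] at this
  refine this.trans ?_
  gcongr
  exact h.norm_coe_le_norm k

/-- Postcomposition with a smooth map is smooth on the space of continuous maps. -/
lemma contDiff_postcomp_nat (n : ℕ) : ∀ {E F : Type u} [NormedAddCommGroup E] [NormedSpace ℝ E]
    [NormedAddCommGroup F] [NormedSpace ℝ F] (f : C(E, F)), ContDiff ℝ n f →
    ContDiff ℝ n (fun β : C(K, E) => f.comp β) := by
  -- The derivative is again a postcomposition, with values in operators from `E` to `F`, so the
  -- induction has to range over all target spaces.
  induction n with
  | zero =>
    intro E F _ _ _ _ f hf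
    exact contDiff_zero.2 (ContinuousMap.continuous_postcomp f)
  | succ n ih =>
    intro E F _ _ _ _ f hf
    have hf1 : ContDiff ℝ (n + 1) f := by exact_mod_cast hf
    have hfd := (contDiff_succ_iff_fderiv.1 hf1).2.2
    let f' : C(E, E →L[ℝ] F) := ⟨fderiv ℝ f, hfd.continuous⟩
    have hd : ∀ α : C(K, E), HasFDerivAt (fun β : C(K, E) => f.comp β)
        (pointwiseApply (f'.comp α)) α := hasFDerivAt_postcomp f f' fun x =>
      (hf1.differentiable (by simp) x).hasFDerivAt
    have : ContDiff ℝ (n + 1) (fun β : C(K, E) => f.comp β) := by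
      refine contDiff_succ_iff_fderiv.2 ⟨fun α => (hd α).differentiableAt, by simp, ?_⟩
      have he : fderiv ℝ (fun β : C(K, E) => f.comp β)
          = fun α => pointwiseApply (f'.comp α) := funext fun α => (hd α).fderiv
      rw [he]
      exact (pointwiseApply (K := K) (E := E) (F := F)).contDiff.comp (ih f' hfd)
    exact_mod_cast this

lemma contDiff_postcomp (f : C(E, F)) (hf : ContDiff ℝ ∞ f) :
    ContDiff ℝ ∞ (fun β : C(K, E) => f.comp β) :=
  contDiff_infty.2 fun n => contDiff_postcomp_nat n f (hf.of_le (by exact_mod_cast le_top))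

end Postcomposition

/-! ### The inverse function theorem on open sets. -/

section InverseFunction

variable {E F : Type*} [NormedAddCommGroup E] [NormedSpace ℝ E] [CompleteSpace E]
  [NormedAddCommGroup F] [NormedSpace ℝ F]

/-- Inverse function theorem, with an inverse that is smooth on an open set. -/
theorem exists_smooth_local_inverse {G : E → F} {W : Set E} (hW : IsOpen W) {p : E} (hp : p ∈ W)
    (hG : ContDiffOn ℝ ∞ G W) {A : E ≃L[ℝ] F} (hA : HasFDerivAt G (A : E →L[ℝ] F) p) :
    ∃ e : OpenPartialHomeomorph E F, p ∈ e.source ∧ e.source ⊆ W ∧ (∀ x, e x = G x) ∧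
      ContDiffOn ℝ ∞ e.symm e.target := by
  have hGp : ContDiffAt ℝ ∞ G p := hG.contDiffAt (hW.mem_nhds hp)
  let e₀ := hGp.toOpenPartialHomeomorph G hA (by simp)
  have he₀ : p ∈ e₀.source := hGp.mem_toOpenPartialHomeomorph_source hA (by simp)
  -- Invertibility of the derivative is an open condition. Restricting to it makes the inverse
  -- smooth on the whole target and not only at the image of `p`.
  let U : Set E := W ∩ fderiv ℝ G ⁻¹' range ((↑) : (E ≃L[ℝ] F) → E →L[ℝ] F)
  have hU : IsOpen U := (hG.continuousOn_fderiv_of_isOpen hW (by simp)).isOpen_inter_preimage hW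
    ContinuousLinearEquiv.isOpen
  let e := e₀.restrOpen U hU
  have hes : e.source = e₀.source ∩ U := OpenPartialHomeomorph.restrOpen_source _ _ _
  refine ⟨e, ?_, ?_, fun x => rfl, ?_⟩
  · rw [hes]
    exact ⟨he₀, hp, A, hA.fderiv.symm⟩
  · rw [hes]
    exact fun x hx => hx.2.1
  · intro y hy
    have hx : e.symm y ∈ e.source := e.map_target hy
    rw [hes] at hx
    obtain ⟨B, hB⟩ := hx.2.2
    have hGx : ContDiffAt ℝ ∞ G (e.symm y) := hG.contDiffAt (hW.mem_nhds hx.2.1)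
    refine (e.contDiffAt_symm (f₀' := B) hy ?_ hGx).contDiffWithinAt
    rw [hB]
    exact (hGx.differentiableAt (by simp)).hasFDerivAt

end InverseFunction

/-! ### Smooth dependence of solutions of differential equations. -/

section LocalFlow

variable {E : Type*} [NormedAddCommGroup E] [NormedSpace ℝ E] [CompleteSpace E]

/-- The primitive of `β`, extended to the real line by constants, that vanishes at `0`. -/
def primitive (β : C(Icc (-2 : ℝ) 2, E)) (s : ℝ) : E :=
  ∫ u in (0 : ℝ)..s, β (projIcc (-2) 2 (by norm_num) u)

omit [NormedSpace ℝ E] [CompleteSpace E] in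
lemma continuous_extend (β : C(Icc (-2 : ℝ) 2, E)) :
    Continuous fun u => β (projIcc (-2) 2 (by norm_num) u) :=
  β.continuous.comp continuous_projIcc

lemma hasDerivAt_primitive (β : C(Icc (-2 : ℝ) 2, E)) (s : ℝ) :
    HasDerivAt (primitive β) (β (projIcc (-2) 2 (by norm_num) s)) s :=
  (continuous_extend β).integral_hasStrictDerivAt 0 s |>.hasDerivAt

/-- Integration from `0`, as a bounded operator on `C([-2, 2], E)`. -/
def primitiveCLM : C(Icc (-2 : ℝ) 2, E) →L[ℝ] C(Icc (-2 : ℝ) 2, E) :=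
  LinearMap.mkContinuous
    { toFun := fun β => ⟨fun s => primitive β s, by
        have : Continuous (primitive β) :=
          continuous_iff_continuousAt.2 fun s => (hasDerivAt_primitive β s).continuousAt
        exact this.comp continuous_subtype_val⟩
      map_add' := fun β γ => by
        ext s
        exact intervalIntegral.integral_add ((continuous_extend β).intervalIntegrable _ _)
          ((continuous_extend γ).intervalIntegrable _ _)
      map_smul' := fun c β => by
        ext s
        exact intervalIntegral.integral_smul c _ }
    2 (by
      intro β
      rw [ContinuousMap.norm_le _ (by positivity)]
      intro s
      have := intervalIntegral.norm_integral_le_of_norm_le_const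
        (a := (0 : ℝ)) (b := s) (f := fun u => β (projIcc (-2) 2 (by norm_num) u)) (C := ‖β‖)
        (fun u _ => β.norm_coe_le_norm _)
      refine this.trans ?_
      rw [mul_comm]
      gcongr
      rw [sub_zero, abs_le]
      exact s.2)

/-- Smooth local flow of a smooth vector field `X`: for `(τ, y)` close to `(0, p)` there is a
solution `β` of `β' = τ X(β)` on `(-2, 2)` starting at `y`, close to `p`, and
`β 1 = y + τ Ψ(τ, y)` where `Ψ` is smooth and `Ψ(0, y) = X y`. -/
theorem exists_smooth_local_flow {X : E → E} (hX : ContDiff ℝ ∞ X) (p : E) {V : Set E}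
    (hV : V ∈ 𝓝 p) :
    ∃ (Ψ : ℝ × E → E) (W : Set (ℝ × E)), IsOpen W ∧ (0, p) ∈ W ∧ ContDiffOn ℝ ∞ Ψ W ∧
      (∀ y, (0, y) ∈ W → Ψ (0, y) = X y) ∧
      ∀ τ y, (τ, y) ∈ W → ∃ β : ℝ → E, β 0 = y ∧ β 1 = y + τ • Ψ (τ, y) ∧
        ∀ s ∈ Ioo (-2 : ℝ) 2, HasDerivAt β (τ • X (β s)) s ∧ β s ∈ V := by
  let K := Icc (-2 : ℝ) 2
  let C := C(K, E)
  let Xc : C(E, E) := ⟨X, hX.continuous⟩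
  let cst : E →L[ℝ] C := LinearMap.mkContinuous
    { toFun := fun y => ContinuousMap.const K y
      map_add' := fun _ _ => rfl
      map_smul' := fun _ _ => rfl } 1 (by
        intro y
        rw [one_mul, ContinuousMap.norm_le _ (norm_nonneg _)]
        exact fun _ => le_rfl)
  have hcst : ∀ y k, cst y k = y := fun y k => rfl
  let T : C → C := fun α => primitiveCLM (Xc.comp α)
  have hT : ContDiff ℝ ∞ T := (primitiveCLM (E := E)).contDiff.comp (contDiff_postcomp Xc hX)
  -- The last component is the integrated equation β = y + τ∫X(β). The factor τ comes from rescaling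
  -- time, which fixes the interval of definition. At τ = 0 the nonlinear term drops out, so the
  -- derivative in β is the identity and the full derivative is triangular.
  let F : (ℝ × E) × C → (ℝ × E) × C := fun q => (q.1, q.2 - cst q.1.2 - q.1.1 • T q.2)
  have hF : ContDiff ℝ ∞ F := by
    refine contDiff_fst.prodMk ((contDiff_snd.sub (cst.contDiff.comp
      (contDiff_snd.comp contDiff_fst))).sub ?_)
    exact (contDiff_fst.comp contDiff_fst).smul (hT.comp contDiff_snd)
  let q₀ : (ℝ × E) × C := ((0, p), cst p)
  let B : (ℝ × E) →L[ℝ] C :=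
    cst.comp (ContinuousLinearMap.snd ℝ ℝ E)
      + (ContinuousLinearMap.fst ℝ ℝ E).smulRight (T (cst p))
  let A : ((ℝ × E) × C) ≃L[ℝ] ((ℝ × E) × C) :=
    ContinuousLinearEquiv.equivOfInverse
      ((ContinuousLinearMap.fst ℝ (ℝ × E) C).prod
        (ContinuousLinearMap.snd ℝ (ℝ × E) C - B.comp (ContinuousLinearMap.fst ℝ (ℝ × E) C)))
      ((ContinuousLinearMap.fst ℝ (ℝ × E) C).prod
        (ContinuousLinearMap.snd ℝ (ℝ × E) C + B.comp (ContinuousLinearMap.fst ℝ (ℝ × E) C)))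
      (fun q => by ext <;> simp) (fun q => by ext <;> simp)
  have hA : HasFDerivAt F (A : ((ℝ × E) × C) →L[ℝ] ((ℝ × E) × C)) q₀ := by
    have h1 : HasFDerivAt (fun q : (ℝ × E) × C => q.1.1 • T q.2) _ q₀ :=
      ((ContinuousLinearMap.fst ℝ ℝ E).comp
        (ContinuousLinearMap.fst ℝ (ℝ × E) C)).hasFDerivAt.smul
        (HasFDerivAt.comp (g := T) (f := fun q : (ℝ × E) × C => q.2) q₀
          ((hT.differentiable (by simp)) (cst p)).hasFDerivAt hasFDerivAt_snd)
    have h2 : HasFDerivAt (fun q : (ℝ × E) × C => q.2 - cst q.1.2) _ q₀ :=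
      (ContinuousLinearMap.snd ℝ (ℝ × E) C - (cst.comp (ContinuousLinearMap.snd ℝ ℝ E)).comp
        (ContinuousLinearMap.fst ℝ (ℝ × E) C)).hasFDerivAt
    refine (hasFDerivAt_fst.prodMk (h2.sub h1)).congr_fderiv ?_
    ext q <;> simp [A, B, q₀]
  obtain ⟨e, heq, -, heF, hesm⟩ :=
    exists_smooth_local_inverse isOpen_univ (mem_univ q₀) hF.contDiffOn hA
  have hFq : F q₀ = ((0, p), 0) := by simp [F, q₀]
  let j : ℝ × E → (ℝ × E) × C := fun z => (z, 0)
  have hj : ContDiff ℝ ∞ j := contDiff_id.prodMk contDiff_const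
  have hjc : Continuous j := hj.continuous
  let α : ℝ × E → C := fun z => (e.symm (j z)).2
  have hes0 : e.symm (j (0, p)) = q₀ := by
    have := e.left_inv heq
    rwa [heF, hFq] at this
  have htar : ((0, p), (0 : C)) ∈ e.target := by
    have := e.map_source heq
    rwa [heF, hFq] at this
  let W₀ : Set (ℝ × E) := j ⁻¹' e.target
  have hW₀ : IsOpen W₀ := e.open_target.preimage hjc
  have hα : ContDiffOn ℝ ∞ α W₀ :=
    contDiff_snd.comp_contDiffOn (hesm.comp hj.contDiffOn (fun z hz => hz))
  have hαeq : ∀ z ∈ W₀, α z = cst z.2 + z.1 • T (α z) := by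
    intro z hz
    have h1 : F (e.symm (j z)) = j z := by rw [← heF]; exact e.right_inv hz
    have h2 : (e.symm (j z)).1 = z := congrArg Prod.fst h1
    have h3 : (e.symm (j z)).2 - cst (e.symm (j z)).1.2 - (e.symm (j z)).1.1 • T (e.symm (j z)).2
        = 0 := congrArg Prod.snd h1
    rw [h2, sub_sub, sub_eq_zero] at h3
    exact h3
  obtain ⟨r, hr, hrV⟩ := Metric.mem_nhds_iff.1 hV
  have hopen : IsOpen (W₀ ∩ α ⁻¹' Metric.ball (cst p) r) :=
    hα.continuousOn.isOpen_inter_preimage hW₀ Metric.isOpen_ball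
  have hα0 : α (0, p) = cst p := by simp [α, hes0, q₀]
  let one : K := ⟨1, by norm_num, by norm_num⟩
  let ev : C →L[ℝ] E := ContinuousMap.evalCLM ℝ one
  -- Ψ is the integral of `X` along the solution over [0, 1], so the factor τ in the displacement is
  -- explicit and no division by τ occurs.
  refine ⟨fun z => ev (T (α z)), W₀ ∩ α ⁻¹' Metric.ball (cst p) r, hopen,
    ⟨htar, by rw [mem_preimage, hα0]; exact Metric.mem_ball_self hr⟩,
    ev.contDiff.comp_contDiffOn ((hT.comp_contDiffOn hα).mono inter_subset_left), ?_, ?_⟩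
  · intro y hy
    have h1 : α (0, y) = cst y := by simpa using hαeq _ hy.1
    have h2 : (Xc.comp (cst y) : C) = cst (X y) := by ext; rfl
    have h3 : ∀ v : E, ev (primitiveCLM (cst v)) = v := by
      intro v
      change primitive (cst v) 1 = v
      simp [primitive, hcst]
    change ev (primitiveCLM (Xc.comp (α (0, y)))) = X y
    rw [h1, h2, h3]
  · rintro τ y ⟨hz, hb⟩
    let β : ℝ → E := fun s => y + τ • primitive (Xc.comp (α (τ, y))) s
    have hβ : ∀ s : K, β s = α (τ, y) s := fun s =>
      (congrArg (fun γ : C => γ s) (hαeq _ hz)).symm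
    refine ⟨β, by simp [β, primitive], rfl, ?_⟩
    intro s hs
    have hsK : s ∈ K := Ioo_subset_Icc_self hs
    have h1 := (hasDerivAt_primitive (Xc.comp (α (τ, y))) s).const_smul τ |>.const_add y
    rw [projIcc_of_mem _ hsK] at h1
    have h2 : β s = α (τ, y) ⟨s, hsK⟩ := hβ ⟨s, hsK⟩
    refine ⟨?_, hrV ?_⟩
    · rw [h2]
      exact h1
    · rw [h2]
      exact (ContinuousMap.dist_lt_iff hr).1 hb ⟨s, hsK⟩

end LocalFlow

/-! ### Charts adapted to maps with surjective derivative. -/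

section Straightening

/-- A linear section of `f` splits `E` into a copy of `F` and the kernel, and the dimension count
identifies the kernel with ℝᵏ. This is the linear model of the straightened charts. -/
lemma exists_equiv_prod_of_surjective {E F : Type*} [NormedAddCommGroup E] [NormedSpace ℝ E]
    [FiniteDimensional ℝ E] [NormedAddCommGroup F] [NormedSpace ℝ F] [FiniteDimensional ℝ F]
    {k : ℕ} (f : E →L[ℝ] F) (hf : Function.Surjective f)
    (hk : Module.finrank ℝ E = Module.finrank ℝ F + k) :
    ∃ L : E ≃L[ℝ] (F × EuclideanSpace ℝ (Fin k)), ∀ x, (L x).1 = f x := by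
  obtain ⟨s, hs⟩ := f.toLinearMap.exists_rightInverse_of_surjective (LinearMap.range_eq_top.2 hf)
  have hs' : ∀ y, f (s y) = y := fun y => LinearMap.congr_fun hs y
  have hker : Module.finrank ℝ (LinearMap.ker f.toLinearMap)
      = Module.finrank ℝ (EuclideanSpace ℝ (Fin k)) := by
    have h1 := f.toLinearMap.finrank_range_add_finrank_ker
    rw [LinearMap.range_eq_top.2 hf, finrank_top, hk] at h1
    rw [finrank_euclideanSpace_fin]
    omega
  let j := LinearEquiv.ofFinrankEq _ _ hker
  let p : E →ₗ[ℝ] LinearMap.ker f.toLinearMap :=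
    (LinearMap.id - s ∘ₗ f.toLinearMap).codRestrict _ (fun x => by simp [hs'])
  have hp : ∀ x, (p x : E) = x - s (f x) := fun x => rfl
  let L : E ≃ₗ[ℝ] (F × EuclideanSpace ℝ (Fin k)) := LinearEquiv.ofBijective
    (f.toLinearMap.prod (j.toLinearMap ∘ₗ p)) (by
      constructor
      · intro x y hxy
        have h1 : f x = f y := congrArg Prod.fst hxy
        have h2 : p x = p y := j.injective (congrArg Prod.snd hxy)
        have h3 := congrArg Subtype.val h2
        rw [hp, hp, h1] at h3
        exact sub_left_injective h3
      · rintro ⟨y, z⟩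
        refine ⟨s y + (j.symm z : E), ?_⟩
        have hz : f (j.symm z : E) = 0 := (j.symm z).2
        have h1 : p (s y + (j.symm z : E)) = j.symm z := by
          ext
          rw [hp]
          simp [hs', hz]
        ext1
        · simp [hs', hz]
        · simp [h1])
  exact ⟨L.toContinuousLinearEquiv, fun x => rfl⟩

variable {E : Type*} [NormedAddCommGroup E] [NormedSpace ℝ E]
  {H : Type*} [TopologicalSpace H] {I : ModelWithCorners ℝ E H} [I.Boundaryless]
  {M : Type*} [TopologicalSpace M] [ChartedSpace H M] [IsManifold I ∞ M]

/-- A chart can be composed with a map of the model space with invertible derivative. -/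
lemma exists_chart_comp [CompleteSpace E] {p : M} {U : Set M} (hU : U ∈ 𝓝 p) {W : Set E}
    (hW : IsOpen W)
    (hpW : extChartAt I p p ∈ W) {G : E → E} (hG : ContDiffOn ℝ ∞ G W) {A : E ≃L[ℝ] E}
    (hA : HasFDerivAt G (A : E →L[ℝ] E) (extChartAt I p p)) :
    ∃ φ ∈ IsManifold.maximalAtlas I ∞ M, p ∈ φ.source ∧ φ.source ⊆ U ∧
      φ.source ⊆ (chartAt H p).source ∧ ∀ q ∈ φ.source, φ.extend I q = G (extChartAt I p q) := by
  obtain ⟨e, hpe, heW, heG, hes⟩ := exists_smooth_local_inverse hW hpW hG hA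
  let hI := I.toHomeomorph
  let φ₀ : OpenPartialHomeomorph M H :=
    (chartAt H p).trans ((hI.toOpenPartialHomeomorph.trans e).trans
      hI.symm.toOpenPartialHomeomorph)
  let φ := φ₀.restrOpen (interior U) isOpen_interior
  have hsrc : φ.source ⊆ (chartAt H p).source ∩ extChartAt I p ⁻¹' e.source ∩ interior U := by
    intro q hq
    rw [OpenPartialHomeomorph.restrOpen_source] at hq
    refine ⟨⟨?_, ?_⟩, hq.2⟩
    · have := hq.1
      simp only [φ₀, mfld_simps] at this
      exact this.1
    · have := hq.1
      simp only [φ₀, mfld_simps] at this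
      exact this.2
  have hval : ∀ q, φ q = I.symm (G (extChartAt I p q)) := by
    intro q
    rw [← heG]
    rfl
  have hsymm : ∀ y, φ.symm y = (extChartAt I p).symm (e.symm (I y)) := fun y => rfl
  have htar : φ.target ⊆ I ⁻¹' (e.target ∩ e.symm ⁻¹' (extChartAt I p).target) := by
    intro y hy
    have h1 : y ∈ φ₀.target := by
      have := φ.map_target hy
      rw [OpenPartialHomeomorph.restrOpen_source] at this
      have h2 := φ₀.map_source this.1
      have h3 : φ₀ (φ.symm y) = y := φ.right_inv hy
      rwa [h3] at h2
    simp only [φ₀, mfld_simps] at h1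
    refine ⟨h1.1, ?_⟩
    rw [mem_preimage, extChartAt_target]
    exact ⟨h1.2, by rw [I.range_eq_univ]; trivial⟩
  refine ⟨φ, ?_, ?_, fun q hq => interior_subset (hsrc hq).2, fun q hq => (hsrc hq).1.1, ?_⟩
  · refine φ.mem_maximalAtlas_of_contMDiffOn ?_ ?_
    · have h1 : ContMDiffOn I 𝓘(ℝ, E) ∞ (extChartAt I p) φ.source :=
        contMDiffOn_extChartAt.mono fun q hq => (hsrc hq).1.1
      have h2 : ContMDiffOn I 𝓘(ℝ, E) ∞ (fun q => G (extChartAt I p q)) φ.source :=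
        hG.contMDiffOn.comp h1 fun q hq => heW (hsrc hq).1.2
      have h3 : ContMDiffOn I I ∞ (fun q => I.symm (G (extChartAt I p q))) φ.source :=
        I.contMDiffOn_symm.comp h2 fun q _ => by rw [I.range_eq_univ]; trivial
      exact h3.congr fun q _ => hval q
    · have h1 : ContMDiffOn I 𝓘(ℝ, E) ∞ (fun y => e.symm (I y)) φ.target :=
        hes.contMDiffOn.comp I.contMDiff.contMDiffOn fun y hy => (htar hy).1
      exact (contMDiffOn_extChartAt_symm p).comp h1 fun y hy => (htar hy).2
  · rw [OpenPartialHomeomorph.restrOpen_source]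
    refine ⟨?_, mem_interior_iff_mem_nhds.2 hU⟩
    simp only [φ₀, mfld_simps]
    exact hpe
  · intro q _
    simp only [mfld_simps, hval]
    rw [I.right_inv (by rw [I.range_eq_univ]; trivial)]

/-- A map with surjective derivative is a projection in a suitable chart of the source. -/
lemma exists_chart_straightening [FiniteDimensional ℝ E] {F : Type*} [NormedAddCommGroup F]
    [NormedSpace ℝ F] [FiniteDimensional ℝ F] {k : ℕ}
    (hk : Module.finrank ℝ E = Module.finrank ℝ F + k) {p : M} {U : Set M} (hU : IsOpen U)
    (hp : p ∈ U) {f : M → F} (hf : ContMDiffOn I 𝓘(ℝ, F) ∞ f U)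
    (hs : Function.Surjective (mfderiv I 𝓘(ℝ, F) f p)) :
    ∃ φ ∈ IsManifold.maximalAtlas I ∞ M, p ∈ φ.source ∧ φ.source ⊆ U ∧
      ∃ L : E ≃L[ℝ] (F × EuclideanSpace ℝ (Fin k)),
        ∀ q ∈ φ.source, (L (φ.extend I q)).1 = f q := by
  have : CompleteSpace E := FiniteDimensional.complete ℝ E
  let F₀ : E → F := fun y => f ((extChartAt I p).symm y)
  let W : Set E := (extChartAt I p).target ∩ (extChartAt I p).symm ⁻¹' U
  have hW : IsOpen W :=
    (continuousOn_extChartAt_symm p).isOpen_inter_preimage (isOpen_extChartAt_target p) hU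
  have hpW : extChartAt I p p ∈ W :=
    ⟨mem_extChartAt_target p, by rw [mem_preimage, extChartAt_to_inv]; exact hp⟩
  have hF₀ : ContDiffOn ℝ ∞ F₀ W := contMDiffOn_iff_contDiffOn.1
    (hf.comp ((contMDiffOn_extChartAt_symm p).mono inter_subset_left) fun y hy => hy.2)
  have hd : HasFDerivAt F₀ (fderiv ℝ F₀ (extChartAt I p p)) (extChartAt I p p) :=
    ((hF₀.contDiffAt (hW.mem_nhds hpW)).differentiableAt (by simp)).hasFDerivAt
  have hm : mfderiv I 𝓘(ℝ, F) f p = fderiv ℝ F₀ (extChartAt I p p) := by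
    have h1 : MDifferentiableAt I 𝓘(ℝ, F) f p :=
      (hf.contMDiffAt (hU.mem_nhds hp)).mdifferentiableAt (by simp)
    rw [h1.mfderiv, I.range_eq_univ, fderivWithin_univ]
    rfl
  have hs' : Function.Surjective (fderiv ℝ F₀ (extChartAt I p p)) := by
    rw [← hm]
    exact hs
  obtain ⟨L, hL⟩ := exists_equiv_prod_of_surjective _ hs' hk
  -- The linear coordinates `L` with their `F`-component replaced by the nonlinear map. Since that
  -- component of `L` is the derivative of `F₀` at the base point, the derivative of `G` there is
  -- the identity.
  let G : E → E := fun y => L.symm (F₀ y, (L y).2)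
  have hG : ContDiffOn ℝ ∞ G W :=
    L.symm.contDiff.comp_contDiffOn (hF₀.prodMk (contDiff_snd.comp L.contDiff).contDiffOn)
  have hA : HasFDerivAt G ((ContinuousLinearEquiv.refl ℝ E : E ≃L[ℝ] E) : E →L[ℝ] E)
      (extChartAt I p p) := by
    have h2 : HasFDerivAt (fun y => (L y).2)
      ((ContinuousLinearMap.snd ℝ F (EuclideanSpace ℝ (Fin k))).comp (L : E →L[ℝ] _))
      (extChartAt I p p) := hasFDerivAt_snd.comp _ L.hasFDerivAt
    refine (L.symm.hasFDerivAt.comp _ (hd.prodMk h2)).congr_fderiv ?_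
    ext v
    have : ((fderiv ℝ F₀ (extChartAt I p p)) v, (L v).2) = L v := by rw [← hL]
    change L.symm ((fderiv ℝ F₀ (extChartAt I p p)) v, (L v).2) = v
    rw [this, L.symm_apply_apply]
  obtain ⟨φ, hφ, hpφ, hφU, hφs, hφG⟩ := exists_chart_comp (hU.mem_nhds hp) hW hpW hG hA
  refine ⟨φ, hφ, hpφ, hφU, L, fun q hq => ?_⟩
  rw [hφG q hq]
  simp only [G, F₀, ContinuousLinearEquiv.apply_symm_apply]
  rw [(extChartAt I p).left_inv (by rw [extChartAt_source]; exact hφs hq)]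

end Straightening

/-! ### Submersions from surjective differentials. -/

section Submersion

variable {E : Type*} [NormedAddCommGroup E] [NormedSpace ℝ E] [FiniteDimensional ℝ E]
  {H : Type*} [TopologicalSpace H] {I : ModelWithCorners ℝ E H} [I.Boundaryless]
  {M : Type*} [TopologicalSpace M] [ChartedSpace H M] [IsManifold I ∞ M]
  {E' : Type*} [NormedAddCommGroup E'] [NormedSpace ℝ E'] [FiniteDimensional ℝ E']
  {H' : Type*} [TopologicalSpace H'] {I' : ModelWithCorners ℝ E' H'}
  {N : Type*} [TopologicalSpace N] [ChartedSpace H' N] [IsManifold I' ∞ N]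

/-- A smooth map with surjective derivatives is a submersion. -/
theorem isSubmersion_of_surjective_mfderiv {k : ℕ}
    (hk : Module.finrank ℝ E = Module.finrank ℝ E' + k) {f : M → N} (hf : ContMDiff I I' ∞ f)
    (hs : ∀ p, Function.Surjective (mfderiv I I' f p)) : IsSubmersion I I' ∞ f := by
  refine IsSubmersionOfComplement.isSubmersion (F := EuclideanSpace ℝ (Fin k)) fun p => ?_
  let U : Set M := f ⁻¹' (chartAt H' (f p)).source
  have hU : IsOpen U := (chartAt H' (f p)).open_source.preimage hf.continuous
  have hpU : p ∈ U := mem_chart_source H' (f p)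
  have hF : ContMDiffOn I 𝓘(ℝ, E') ∞ (fun q => extChartAt I' (f p) (f q)) U :=
    contMDiffOn_extChartAt.comp hf.contMDiffOn fun q hq => hq
  have hsF : Function.Surjective (mfderiv I 𝓘(ℝ, E') (fun q => extChartAt I' (f p) (f q)) p) := by
    have h1 : mfderiv I 𝓘(ℝ, E') (extChartAt I' (f p) ∘ f) p = _ :=
      mfderiv_comp p (mdifferentiableAt_extChartAt (mem_chart_source H' (f p)))
        (hf.mdifferentiable (by simp) p)
    change Function.Surjective (mfderiv I 𝓘(ℝ, E') (extChartAt I' (f p) ∘ f) p)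
    rw [h1, ContinuousLinearMap.coe_comp]
    refine Function.Surjective.comp ?_ (hs p)
    exact (isInvertible_mfderiv_extChartAt (mem_extChartAt_source (I := I') (f p))).bijective.surjective
  obtain ⟨φ, hφ, hpφ, hφU, L, hL⟩ := exists_chart_straightening hk hU hpU hF hsF
  refine IsSubmersionAtOfComplement.mk_of_charts L φ (chartAt H' (f p)) hpφ hpU hφ
    (IsManifold.chart_mem_maximalAtlas _) (fun q hq => hφU hq) ?_
  intro y hy
  have hq : (φ.extend I).symm y ∈ φ.source := by
    have := (φ.extend I).map_target hy
    rwa [φ.extend_source] at this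
  have h1 := hL _ hq
  rw [(φ.extend I).right_inv hy] at h1
  exact h1.symm

end Submersion

/-! ### Injectivity of the differential of an immersion. -/

section Immersion

variable {E : Type*} [NormedAddCommGroup E] [NormedSpace ℝ E]
  {H : Type*} [TopologicalSpace H] {I : ModelWithCorners ℝ E H} [I.Boundaryless]
  {M : Type*} [TopologicalSpace M] [ChartedSpace H M]
  {E' : Type*} [NormedAddCommGroup E'] [NormedSpace ℝ E']
  {H' : Type*} [TopologicalSpace H'] {I' : ModelWithCorners ℝ E' H'}
  {N : Type*} [TopologicalSpace N] [ChartedSpace H' N]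

/-- In adapted charts an immersion is the inclusion of a factor, so projecting back to this factor
is a smooth local left inverse `ρ`; the chain rule then gives a left inverse of the differential. -/
lemma IsImmersion.mfderiv_injective {f : M → N} (hf : IsImmersion I I' ∞ f) (p : M) :
    Function.Injective (mfderiv I I' f p) := by
  have h := (hf.isImmersionAt p).isImmersionAtOfComplement_complement
  let φ := h.domChart
  let ψ := h.codChart
  let L := h.equiv
  let ρ : N → M := fun q => (φ.extend I).symm (L.symm (ψ.extend I' q)).1
  have hρf : ∀ q ∈ φ.source, ρ (f q) = q := by
    intro q hq
    have h1 := h.writtenInCharts ((φ.extend I).map_source (by rwa [φ.extend_source]))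
    simp only [Function.comp_apply] at h1
    rw [OpenPartialHomeomorph.extend_left_inv _ hq] at h1
    simp only [ρ]
    change (φ.extend I).symm (L.symm (ψ.extend I' (f q))).1 = q
    rw [show ψ.extend I' (f q) = L (φ.extend I q, 0) from h1]
    simp only [ContinuousLinearEquiv.symm_apply_apply]
    exact φ.extend_left_inv hq
  have hp : p ∈ φ.source := h.mem_domChart_source
  have hψp : f p ∈ ψ.source := h.mem_codChart_source
  have htar : (L.symm (ψ.extend I' (f p))).1 ∈ I '' φ.target := by
    have h1 := h.writtenInCharts ((φ.extend I).map_source (by rw [φ.extend_source]; exact hp))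
    simp only [Function.comp_apply] at h1
    rw [OpenPartialHomeomorph.extend_left_inv _ hp] at h1
    rw [show ψ.extend I' (f p) = L (φ.extend I p, 0) from h1]
    simp only [ContinuousLinearEquiv.symm_apply_apply]
    exact ⟨φ p, φ.map_source hp, rfl⟩
  have hρ : MDifferentiableAt I' I ρ (f p) := by
    have h1 : ContMDiffAt I' 𝓘(ℝ, E') ∞ (ψ.extend I') (f p) :=
      ψ.contMDiffAt_extend h.codChart_mem_maximalAtlas hψp
    have h2 : ContMDiffAt I' 𝓘(ℝ, E) ∞ (fun q => (L.symm (ψ.extend I' q)).1) (f p) :=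
      (contDiff_fst.comp L.symm.contDiff).contMDiff.contMDiffAt.comp (f p) h1
    have h3 : IsOpen (I '' φ.target) := by
      have := I.toHomeomorph.isOpenMap _ φ.open_target
      exact this
    have h4 : ContMDiffAt 𝓘(ℝ, E) I ∞ (φ.extend I).symm (L.symm (ψ.extend I' (f p))).1 :=
      (contMDiffOn_extend_symm h.domChart_mem_maximalAtlas).contMDiffAt (h3.mem_nhds htar)
    exact (h4.comp (f p) h2).mdifferentiableAt (by simp)
  have hcomp : mfderiv I I (ρ ∘ f) p = ContinuousLinearMap.id ℝ (TangentSpace I p) := by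
    have : ρ ∘ f =ᶠ[𝓝 p] id := by
      filter_upwards [φ.open_source.mem_nhds hp] with q hq using hρf q hq
    rw [this.mfderiv_eq, mfderiv_id]
  rw [mfderiv_comp p hρ (hf.contMDiff.mdifferentiable (by simp) p)] at hcomp
  intro v w hvw
  have hv : (mfderiv I' I ρ (f p)) (mfderiv I I' f p v) = v := congrArg (fun T => T v) hcomp
  have hw : (mfderiv I' I ρ (f p)) (mfderiv I I' f p w) = w := congrArg (fun T => T w) hcomp
  rw [← hv, ← hw, hvw]

end Immersion

/-! ### Regular level sets as embedded submanifolds. -/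

section LevelSet

variable {E : Type*} [NormedAddCommGroup E] [NormedSpace ℝ E]
  {H : Type*} [TopologicalSpace H] {I : ModelWithCorners ℝ E H}
  {M : Type*} [TopologicalSpace M] [ChartedSpace H M]

/-- A chart of `M` in which the subset `S` is a linear subspace of dimension `d`. -/
structure SliceChart (I : ModelWithCorners ℝ E H) (S : Set M) (d : ℕ) where
  chart : OpenPartialHomeomorph M H
  mem_maximalAtlas : chart ∈ IsManifold.maximalAtlas I ∞ M
  coord : E ≃L[ℝ] (ℝ × EuclideanSpace ℝ (Fin d))
  mem_iff : ∀ q ∈ chart.source, q ∈ S ↔ (coord (chart.extend I q)).1 = 0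

namespace SliceChart

variable {S : Set M} {d : ℕ} (c : SliceChart I S d)

/-- The parametrization of `S` by a slice chart. -/
def param (u : EuclideanSpace ℝ (Fin d)) : M := (c.chart.extend I).symm (c.coord.symm (0, u))

/-- The domain of `param`. -/
def dom : Set (EuclideanSpace ℝ (Fin d)) := {u | c.coord.symm (0, u) ∈ (c.chart.extend I).target}

lemma isOpen_dom [I.Boundaryless] : IsOpen c.dom := by
  have h : IsOpen (c.chart.extend I).target := by
    rw [OpenPartialHomeomorph.extend_target, I.range_eq_univ, inter_univ]
    exact c.chart.open_target.preimage I.continuous_symm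
  exact h.preimage (c.coord.symm.continuous.comp (by fun_prop))

lemma contMDiffOn_param : ContMDiffOn (𝓡 d) I ∞ c.param c.dom := by
  have h1 : ContMDiffOn 𝓘(ℝ, E) I ∞ (c.chart.extend I).symm (c.chart.extend I).target := by
    refine (contMDiffOn_extend_symm c.mem_maximalAtlas).mono fun y hy => ?_
    rw [OpenPartialHomeomorph.extend_target] at hy
    exact ⟨I.symm y, hy.1, I.right_inv hy.2⟩
  refine h1.comp (ContDiff.contMDiff ?_).contMDiffOn fun u hu => hu
  exact c.coord.symm.contDiff.comp (contDiff_const.prodMk contDiff_id)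

lemma param_mem_source {u : EuclideanSpace ℝ (Fin d)} (hu : u ∈ c.dom) :
    c.param u ∈ c.chart.source := by
  have := (c.chart.extend I).map_target hu
  rwa [c.chart.extend_source] at this

lemma extend_param {u : EuclideanSpace ℝ (Fin d)} (hu : u ∈ c.dom) :
    c.chart.extend I (c.param u) = c.coord.symm (0, u) :=
  (c.chart.extend I).right_inv hu

lemma param_mem {u : EuclideanSpace ℝ (Fin d)} (hu : u ∈ c.dom) : c.param u ∈ S := by
  rw [c.mem_iff _ (c.param_mem_source hu), c.extend_param hu]
  simp

/-- The coordinates of a slice chart along the slice. -/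
def along (q : M) : EuclideanSpace ℝ (Fin d) := (c.coord (c.chart.extend I q)).2

lemma contMDiffOn_along : ContMDiffOn I (𝓡 d) ∞ c.along c.chart.source :=
  (contDiff_snd.comp c.coord.contDiff).contMDiff.comp_contMDiffOn
    (c.chart.contMDiffOn_extend c.mem_maximalAtlas)

lemma along_param {u : EuclideanSpace ℝ (Fin d)} (hu : u ∈ c.dom) : c.along (c.param u) = u := by
  rw [along, c.extend_param hu, ContinuousLinearEquiv.apply_symm_apply]

lemma coord_eq {q : M} (hq : q ∈ c.chart.source) (hS : q ∈ S) :
    c.coord.symm (0, c.along q) = c.chart.extend I q := by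
  rw [ContinuousLinearEquiv.symm_apply_eq]
  ext1
  · exact ((c.mem_iff q hq).1 hS).symm
  · rfl

lemma along_mem_dom {q : M} (hq : q ∈ c.chart.source) (hS : q ∈ S) : c.along q ∈ c.dom := by
  change c.coord.symm (0, c.along q) ∈ (c.chart.extend I).target
  rw [c.coord_eq hq hS]
  exact (c.chart.extend I).map_source (by rwa [c.chart.extend_source])

lemma param_along {q : M} (hq : q ∈ c.chart.source) (hS : q ∈ S) : c.param (c.along q) = q := by
  rw [param, c.coord_eq hq hS]
  exact c.chart.extend_left_inv hq

open Classical in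
/-- The chart of `S` induced by a slice chart. -/
def subtypeChart [I.Boundaryless] (p : S) : OpenPartialHomeomorph S (EuclideanSpace ℝ (Fin d)) where
  toFun q := c.along q
  -- Off `dom` the point `c.param u` need not lie in `S`; there `p` is a default value.
  invFun u := if h : c.param u ∈ S then ⟨c.param u, h⟩ else p
  source := Subtype.val ⁻¹' c.chart.source
  target := c.dom
  map_source' q hq := c.along_mem_dom hq q.2
  map_target' u hu := by
    rw [dif_pos (c.param_mem hu)]
    exact c.param_mem_source hu
  left_inv' q hq := by
    have h := c.param_along hq q.2
    rw [dif_pos (by rw [h]; exact q.2)]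
    exact Subtype.ext h
  right_inv' u hu := by
    rw [dif_pos (c.param_mem hu)]
    exact c.along_param hu
  open_source := c.chart.open_source.preimage continuous_subtype_val
  open_target := c.isOpen_dom
  continuousOn_toFun := c.contMDiffOn_along.continuousOn.comp continuous_subtype_val.continuousOn
    fun q hq => hq
  continuousOn_invFun := by
    rw [Topology.IsInducing.subtypeVal.continuousOn_iff]
    refine c.contMDiffOn_param.continuousOn.congr fun u hu => ?_
    simp [c.param_mem hu]

lemma subtypeChart_apply [I.Boundaryless] (p q : S) : c.subtypeChart p q = c.along q := rfl

open Classical in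
lemma subtypeChart_symm [I.Boundaryless] (p : S) {u : EuclideanSpace ℝ (Fin d)} (hu : u ∈ c.dom) :
    ((c.subtypeChart p).symm u : M) = c.param u := by
  change ((if h : c.param u ∈ S then ⟨c.param u, h⟩ else p : S) : M) = _
  rw [dif_pos (c.param_mem hu)]

end SliceChart

/-- A subset with slice charts is an embedded submanifold. -/
theorem exists_submanifold [I.Boundaryless] {S : Set M} {d : ℕ}
    (h : ∀ p ∈ S, ∃ c : SliceChart I S d, p ∈ c.chart.source) :
    ∃ _ : ChartedSpace (EuclideanSpace ℝ (Fin d)) S, IsManifold (𝓡 d) ∞ S ∧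
      IsSmoothEmbedding (𝓡 d) I ∞ (Subtype.val : S → M) := by
  choose c hc using fun p : S => h p p.2
  let cs : ChartedSpace (EuclideanSpace ℝ (Fin d)) S :=
    { atlas := range fun p : S => (c p).subtypeChart p
      chartAt := fun p => (c p).subtypeChart p
      mem_chart_source := fun p => hc p
      chart_mem_atlas := fun p => ⟨p, rfl⟩ }
  have hman : IsManifold (𝓡 d) ∞ S := by
    refine isManifold_of_contDiffOn _ _ _ ?_
    rintro _ _ ⟨p, rfl⟩ ⟨p', rfl⟩
    rw [← contMDiffOn_iff_contDiffOn]
    simp only [mfld_simps]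
    -- Transition maps are `along ∘ param`, which factors smoothly through `M`.
    have h1 : ContMDiffOn (𝓡 d) I ∞ (c p).param ((c p).dom ∩ (c p).param ⁻¹' (c p').chart.source) :=
      (c p).contMDiffOn_param.mono inter_subset_left
    have h2 := (c p').contMDiffOn_along.comp h1 fun u hu => hu.2
    refine (h2.mono ?_).congr ?_
    · rintro u ⟨hu, hu'⟩
      refine ⟨hu, ?_⟩
      rw [mem_preimage, ← (c p).subtypeChart_symm p hu]
      exact hu'
    · rintro u ⟨hu, -⟩
      simp only [Function.comp_apply]
      rw [SliceChart.subtypeChart_apply, (c p).subtypeChart_symm p hu]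
  refine ⟨cs, hman, ?_, Topology.IsEmbedding.subtypeVal⟩
  refine IsImmersionOfComplement.isImmersion (F := ℝ) fun p => ?_
  refine IsImmersionAtOfComplement.mk_of_charts
    ((ContinuousLinearEquiv.prodComm ℝ _ _).trans (c p).coord.symm)
    ((c p).subtypeChart p) (c p).chart (hc p) (hc p) (IsManifold.chart_mem_maximalAtlas p)
    (c p).mem_maximalAtlas (fun q hq => hq) ?_
  intro u hu
  have hu' : u ∈ (c p).dom := by
    have := hu
    simp only [mfld_simps] at this
    exact this
  have : (((c p).subtypeChart p).extend (𝓡 d)).symm u = ((c p).subtypeChart p).symm u := rfl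
  simp only [Function.comp_apply, this, (c p).subtypeChart_symm p hu']
  rw [(c p).extend_param hu']
  rfl

/-- A regular level set is an embedded submanifold. -/
theorem exists_levelSet_submanifold [I.Boundaryless] [FiniteDimensional ℝ E] [IsManifold I ∞ M] {S : Set M} {d : ℕ}
    (hd : Module.finrank ℝ E = d + 1)
    (h : ∀ p ∈ S, ∃ (f : M → ℝ) (U : Set M), IsOpen U ∧ p ∈ U ∧ ContMDiffOn I 𝓘(ℝ, ℝ) ∞ f U ∧
      Function.Surjective (mfderiv I 𝓘(ℝ, ℝ) f p) ∧ ∀ q ∈ U, q ∈ S ↔ f q = 0) :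
    ∃ _ : ChartedSpace (EuclideanSpace ℝ (Fin d)) S, IsManifold (𝓡 d) ∞ S ∧
      IsSmoothEmbedding (𝓡 d) I ∞ (Subtype.val : S → M) := by
  refine exists_submanifold fun p hp => ?_
  obtain ⟨f, U, hU, hpU, hf, hs, hfS⟩ := h p hp
  obtain ⟨φ, hφ, hpφ, hφU, L, hL⟩ := exists_chart_straightening (k := d)
    (by rw [hd, Module.finrank_self, add_comm]) hU hpU hf hs
  refine ⟨⟨φ, hφ, L, fun q hq => ?_⟩, hpφ⟩
  rw [hfS q (hφU hq), hL q hq]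

end LevelSet

/-! ### Smooth structures on quotients. -/

section Quotient

variable {E : Type*} [NormedAddCommGroup E] [NormedSpace ℝ E]
  {X Y : Type*} [TopologicalSpace X] [ChartedSpace E X] [IsManifold 𝓘(ℝ, E) ∞ X]
  [TopologicalSpace Y]

/-- The target of a local homeomorphism `r` from a manifold is a manifold if `r` has enough smooth
deck transformations. -/
theorem exists_quotient_manifold {r : X → Y} (hr : IsLocalHomeomorph r)
    (hsurj : Function.Surjective r)
    (hdeck : ∀ x x', r x = r x' → ∃ φ : X → X, ContMDiffAt 𝓘(ℝ, E) 𝓘(ℝ, E) ∞ φ x ∧ φ x = x' ∧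
      ∀ z, r (φ z) = r z) :
    ∃ _ : ChartedSpace E Y, IsManifold 𝓘(ℝ, E) ∞ Y ∧
      IsLocalDiffeomorph 𝓘(ℝ, E) 𝓘(ℝ, E) ∞ r := by
  choose s hs using hsurj
  choose ψ hψs hψ using hr
  have hψ' : ∀ x z, ψ x z = r z := fun x z => congrFun (hψ x).symm z
  -- The map `(ψ x).symm ∘ r` changes the sheet of `r`. Near `w` it coincides with the deck
  -- transformation that sends `w` to the chosen sheet, hence it is smooth. Smoothness of the
  -- transition maps of `Y` and of `r` in both directions reduces to this.
  have hK : ∀ x w, r w ∈ (ψ x).target →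
      ContMDiffAt 𝓘(ℝ, E) 𝓘(ℝ, E) ∞ (fun z => (ψ x).symm (r z)) w := by
    intro x w hw
    obtain ⟨φ, hφ, hφw, hφr⟩ := hdeck w ((ψ x).symm (r w)) (by
      rw [← hψ' x ((ψ x).symm (r w)), (ψ x).right_inv hw])
    refine hφ.congr_of_eventuallyEq ?_
    have hsrc : φ w ∈ (ψ x).source := by rw [hφw]; exact (ψ x).map_target hw
    filter_upwards [hφ.continuousAt.preimage_mem_nhds ((ψ x).open_source.mem_nhds hsrc)] with z hz
    rw [← hφr z, ← hψ' x, (ψ x).left_inv hz]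
  let ch : Y → OpenPartialHomeomorph Y E := fun y => (ψ (s y)).symm.trans (chartAt E (s y))
  have hch : ∀ y, y ∈ (ch y).source := by
    intro y
    have h1 : y ∈ (ψ (s y)).target := by
      have := (ψ (s y)).map_source (hψs (s y))
      rwa [hψ', hs] at this
    have h2 : (ψ (s y)).symm y = s y := by
      have := (ψ (s y)).left_inv (hψs (s y))
      rwa [hψ', hs] at this
    simp only [ch, mfld_simps, h1, h2]
  let cs : ChartedSpace E Y :=
    { atlas := range ch
      chartAt := ch
      mem_chart_source := hch
      chart_mem_atlas := fun y => ⟨y, rfl⟩ }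
  have hman : IsManifold 𝓘(ℝ, E) ∞ Y := by
    refine isManifold_of_contDiffOn _ _ _ ?_
    rintro _ _ ⟨y, rfl⟩ ⟨y', rfl⟩
    rw [← contMDiffOn_iff_contDiffOn]
    intro u hu
    simp only [ch, mfld_simps, hψ'] at hu ⊢
    have h1 : ContMDiffAt 𝓘(ℝ, E) 𝓘(ℝ, E) ∞ (chartAt E (s y)).symm u :=
      (contMDiffOn_chart_symm (I := 𝓘(ℝ, E))).contMDiffAt
        ((chartAt E (s y)).open_target.mem_nhds hu.1.1)
    have h2 := hK (s y') ((chartAt E (s y)).symm u) hu.2.1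
    have h3 : ContMDiffAt 𝓘(ℝ, E) 𝓘(ℝ, E) ∞ (chartAt E (s y'))
        ((ψ (s y')).symm (r ((chartAt E (s y)).symm u))) :=
      (contMDiffOn_chart (I := 𝓘(ℝ, E))).contMDiffAt
        ((chartAt E (s y')).open_source.mem_nhds hu.2.2)
    have h4 := ContMDiffAt.comp (g := chartAt E (s y')) (f := fun z => (ψ (s y')).symm (r z))
      _ h3 h2
    exact (h4.comp u h1).contMDiffWithinAt.congr
      (fun z _ => by simp only [Function.comp_apply, hψ'])
      (by simp only [Function.comp_apply, hψ'])
  have hsymm : ∀ y, ContMDiffAt 𝓘(ℝ, E) 𝓘(ℝ, E) ∞ (ψ (s y)).symm y := by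
    intro y
    have h1 : ContMDiffAt 𝓘(ℝ, E) 𝓘(ℝ, E) ∞ (ch y) y :=
      (contMDiffOn_chart (I := 𝓘(ℝ, E)) (x := y)).contMDiffAt ((ch y).open_source.mem_nhds (hch y))
    have hy := hch y
    simp only [ch, mfld_simps] at hy
    have h2 : ContMDiffAt 𝓘(ℝ, E) 𝓘(ℝ, E) ∞ (chartAt E (s y)).symm (ch y y) :=
      (contMDiffOn_chart_symm (I := 𝓘(ℝ, E))).contMDiffAt
        ((chartAt E (s y)).open_target.mem_nhds ((chartAt E (s y)).map_source hy.2))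
    refine (h2.comp y h1).congr_of_eventuallyEq ?_
    filter_upwards [(ch y).open_source.mem_nhds (hch y)] with z hz
    simp only [ch, mfld_simps] at hz ⊢
    rw [(chartAt E (s y)).left_inv hz.2]
  refine ⟨cs, hman, fun x => ⟨⟨(ψ x).toPartialEquiv, (ψ x).open_source, (ψ x).open_target, ?_, ?_⟩,
    hψs x, fun z _ => (hψ' x z).symm⟩⟩
  · intro w hw
    refine ContMDiffAt.contMDiffWithinAt ?_
    change ContMDiffAt 𝓘(ℝ, E) 𝓘(ℝ, E) ∞ (ψ x) w
    rw [← hψ x, contMDiffAt_iff_target]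
    refine ⟨?_, ?_⟩
    · rw [hψ x]
      exact (ψ x).continuousAt hw
    · have hy := hch (r w)
      simp only [ch, mfld_simps] at hy
      have h3 : ContMDiffAt 𝓘(ℝ, E) 𝓘(ℝ, E) ∞ (chartAt E (s (r w)))
          ((ψ (s (r w))).symm (r w)) :=
        (contMDiffOn_chart (I := 𝓘(ℝ, E))).contMDiffAt
          ((chartAt E (s (r w))).open_source.mem_nhds hy.2)
      exact ContMDiffAt.comp (g := chartAt E (s (r w)))
        (f := fun z => (ψ (s (r w))).symm (r z)) w h3 (hK (s (r w)) w hy.1)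
  · intro v hv
    refine ContMDiffAt.contMDiffWithinAt ?_
    change ContMDiffAt 𝓘(ℝ, E) 𝓘(ℝ, E) ∞ (ψ x).symm v
    have h1 : v ∈ (ψ (s v)).target := by
      have := (ψ (s v)).map_source (hψs (s v))
      rwa [hψ', hs] at this
    have h2 : r ((ψ (s v)).symm v) = v := by rw [← hψ' (s v), (ψ (s v)).right_inv h1]
    have h3 := (hK x ((ψ (s v)).symm v) (by rw [h2]; exact hv)).comp v (hsymm v)
    refine h3.congr_of_eventuallyEq ?_
    filter_upwards [(ψ (s v)).open_target.mem_nhds h1] with z hz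
    simp only [Function.comp_apply]
    rw [← hψ' (s v), (ψ (s v)).right_inv hz]

end Quotient

/-! ### Coordinates and curves in the tangent bundle. -/

section TangentBundle

variable {E : Type*} [NormedAddCommGroup E] [NormedSpace ℝ E]
  {H : Type*} [TopologicalSpace H] {I : ModelWithCorners ℝ E H}
  {M : Type*} [TopologicalSpace M] [ChartedSpace H M] [IsManifold I ∞ M]

omit [IsManifold I ∞ M] in
lemma t2Space_tangentBundle [T2Space M] [IsManifold I 1 M] : T2Space (TangentBundle I M) := by
  refine ⟨fun p q hpq => ?_⟩
  by_cases h : p.1 = q.1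
  · let e := trivializationAt E (TangentSpace I : M → Type _) p.1
    have hp : p ∈ e.source := by
      rw [e.mem_source]; exact FiberBundle.mem_baseSet_trivializationAt' p.1
    have hq : q ∈ e.source := by
      rw [e.mem_source, ← show p.1 = q.1 from h]
      exact FiberBundle.mem_baseSet_trivializationAt' p.1
    have hne : e p ≠ e q := fun h => hpq (e.toOpenPartialHomeomorph.injOn hp hq h)
    obtain ⟨u, v, hu, hv, hpu, hqv, huv⟩ := t2_separation hne
    refine ⟨e.source ∩ e ⁻¹' u, e.source ∩ e ⁻¹' v,
      e.toOpenPartialHomeomorph.isOpen_inter_preimage hu,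
      e.toOpenPartialHomeomorph.isOpen_inter_preimage hv, ⟨hp, hpu⟩, ⟨hq, hqv⟩, ?_⟩
    exact (huv.preimage e).mono inter_subset_right inter_subset_right
  · obtain ⟨u, v, hu, hv, hpu, hqv, huv⟩ := t2_separation h
    have hc : Continuous (fun p : TangentBundle I M => p.1) := FiberBundle.continuous_proj E _
    exact ⟨_, _, hu.preimage hc, hv.preimage hc, hpu, hqv, huv.preimage _⟩

omit [IsManifold I ∞ M] in
lemma secondCountableTopology_tangentBundle [SecondCountableTopology H] [SecondCountableTopology E]
    [SecondCountableTopology M] [IsManifold I 1 M] :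
    SecondCountableTopology (TangentBundle I M) := by
  obtain ⟨s, hs, hsU⟩ := TopologicalSpace.countable_cover_nhds
    (fun x : M => (chartAt H x).open_source.mem_nhds (mem_chart_source H x))
  have : SecondCountableTopology (ModelProd H E) :=
    inferInstanceAs (SecondCountableTopology (H × E))
  refine ChartedSpace.secondCountable_of_countable_cover (ModelProd H E)
    (s := (fun x : M => (⟨x, 0⟩ : TangentBundle I M)) '' s) ?_ (hs.image _)
  refine eq_univ_of_forall fun v => ?_
  have hv : v.1 ∈ ⋃ x ∈ s, (chartAt H x).source := by rw [hsU]; trivial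
  simp only [mem_iUnion] at hv ⊢
  obtain ⟨x, hx, hvx⟩ := hv
  refine ⟨⟨x, 0⟩, ⟨x, hx, rfl⟩, ?_⟩
  rw [TangentBundle.mem_chart_source_iff]
  exact hvx

variable (I) in
/-- The coordinates `(x, ẋ)` of the tangent bundle induced by the chart at `x₀`. -/
def tangentCoord (x₀ : M) : PartialEquiv (TangentBundle I M) (E × E) :=
  extChartAt I.tangent (⟨x₀, 0⟩ : TangentBundle I M)

lemma tangentCoord_source (x₀ : M) :
    (tangentCoord I x₀).source = {v | v.1 ∈ (extChartAt I x₀).source} := by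
  ext v
  rw [tangentCoord, extChartAt_source, TangentBundle.mem_chart_source_iff, mem_ofPred_eq,
    extChartAt_source]

/-- This identifies the bundle chart, defined by a trivialization, with the pair (φ, dφ). With the
corresponding formula for the inverse it connects smoothness in the tangent bundle to `localMetric`,
which is written with the derivative of the inverse chart. -/
lemma tangentCoord_apply {x₀ : M} {v : TangentBundle I M}
    (hv : v.1 ∈ (extChartAt I x₀).source) :
    tangentCoord I x₀ v = (extChartAt I x₀ v.1, mfderiv I 𝓘(ℝ, E) (extChartAt I x₀) v.1 v.2) := by
  rw [extChartAt_source] at hv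
  rw [tangentCoord, FiberBundle.extChartAt]
  ext1
  · rfl
  · have h2 := Trivialization.continuousLinearMapAt_apply_of_mem (R := ℝ)
      (trivializationAt E (TangentSpace I : M → Type _) x₀) hv v.2
    have h3 : (mfderiv I 𝓘(ℝ, E) (extChartAt I x₀) v.1 v.2 : E) = _ :=
      congrArg (fun T : E →L[ℝ] E => T v.2)
        (TangentBundle.continuousLinearMapAt_trivializationAt hv).symm
    exact (h3.trans h2).symm

lemma tangentCoord_target [I.Boundaryless] (x₀ : M) :
    (tangentCoord I x₀).target = (extChartAt I x₀).target ×ˢ univ := by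
  rw [tangentCoord, FiberBundle.extChartAt_target]
  congr 1
  rw [inter_eq_left]
  intro y hy
  have := (extChartAt I x₀).map_target hy
  rwa [extChartAt_source] at this

lemma tangentCoord_symm_apply [I.Boundaryless] {x₀ : M} {y : E}
    (hy : y ∈ (extChartAt I x₀).target) (w : E) :
    (tangentCoord I x₀).symm (y, w)
      = ⟨(extChartAt I x₀).symm y, mfderiv 𝓘(ℝ, E) I (extChartAt I x₀).symm y w⟩ := by
  have hx : (extChartAt I x₀).symm y ∈ (chartAt H x₀).source := by
    have := (extChartAt I x₀).map_target hy
    rwa [extChartAt_source] at this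
  have h1 := TangentBundle.symmL_trivializationAt (I := I) hx
  rw [(extChartAt I x₀).right_inv hy, I.range_eq_univ, mfderivWithin_univ] at h1
  have h3 : (mfderiv 𝓘(ℝ, E) I (extChartAt I x₀).symm y w : E) = _ :=
    congrArg (fun T : E →L[ℝ] E => T w) h1.symm
  have h4 := h3.trans (Trivialization.symmL_apply (R := ℝ)
    (trivializationAt E (TangentSpace I : M → Type _) x₀) hx w)
  rw [tangentCoord, FiberBundle.extChartAt]
  refine Eq.trans ?_ (congrArg (fun u => (⟨(extChartAt I x₀).symm y, u⟩ : TangentBundle I M))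
    h4.symm)
  exact ((trivializationAt E (TangentSpace I : M → Type _) x₀).mk_symm hx w).symm

lemma contMDiffOn_tangentCoord (x₀ : M) :
    ContMDiffOn I.tangent 𝓘(ℝ, E × E) ∞ (tangentCoord I x₀) (tangentCoord I x₀).source := by
  have := contMDiffOn_extChartAt (I := I.tangent) (n := ∞) (x := (⟨x₀, 0⟩ : TangentBundle I M))
  rwa [← extChartAt_source I.tangent] at this

lemma contMDiffOn_tangentCoord_symm (x₀ : M) :
    ContMDiffOn 𝓘(ℝ, E × E) I.tangent ∞ (tangentCoord I x₀).symm (tangentCoord I x₀).target :=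
  contMDiffOn_extChartAt_symm (I := I.tangent) (n := ∞) (⟨x₀, 0⟩ : TangentBundle I M)

lemma isOpen_tangentCoord_source (x₀ : M) : IsOpen (tangentCoord I x₀).source :=
  isOpen_extChartAt_source _

lemma isOpen_tangentCoord_target [I.Boundaryless] (x₀ : M) :
    IsOpen (tangentCoord I x₀).target := by
  rw [tangentCoord_target]
  exact (isOpen_extChartAt_target x₀).prod isOpen_univ

/-- Smoothness of a map to the tangent bundle, read in a fixed trivialization. -/
lemma contMDiffAt_tangentBundle_iff {E' : Type*} [NormedAddCommGroup E'] [NormedSpace ℝ E']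
    {H' : Type*} [TopologicalSpace H'] {I' : ModelWithCorners ℝ E' H'}
    {N : Type*} [TopologicalSpace N] [ChartedSpace H' N] {f : N → TangentBundle I M} {p : N} :
    ContMDiffAt I' I.tangent ∞ f p ↔ ContMDiffAt I' I ∞ (fun q => (f q).1) p ∧
      ContMDiffAt I' 𝓘(ℝ, E) ∞
        (fun q => (trivializationAt E (TangentSpace I : M → Type _) (f p).1 (f q)).2) p :=
  contMDiffAt_totalSpace

/-- Fibrewise multiplication by a smooth function preserves smoothness. -/
lemma ContMDiffAt.tangent_smul {E' : Type*} [NormedAddCommGroup E'] [NormedSpace ℝ E']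
    {H' : Type*} [TopologicalSpace H'] {I' : ModelWithCorners ℝ E' H'}
    {N : Type*} [TopologicalSpace N] [ChartedSpace H' N] {f : N → TangentBundle I M} {p : N}
    (hf : ContMDiffAt I' I.tangent ∞ f p) {a : N → ℝ} (ha : ContMDiffAt I' 𝓘(ℝ, ℝ) ∞ a p) :
    ContMDiffAt I' I.tangent ∞
      (fun q => (⟨(f q).1, a q • (f q).2⟩ : TangentBundle I M)) p := by
  rw [contMDiffAt_tangentBundle_iff] at hf ⊢
  refine ⟨hf.1, (ha.smul hf.2).congr_of_eventuallyEq ?_⟩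
  have hopen := (trivializationAt E (TangentSpace I : M → Type _) (f p).1).open_baseSet.mem_nhds
    (FiberBundle.mem_baseSet_trivializationAt' (f p).1)
  filter_upwards [hf.1.continuousAt.preimage_mem_nhds hopen] with q hq
  change _ = a q • (trivializationAt E (TangentSpace I : M → Type _) (f p).1 (f q)).2
  rw [← Trivialization.continuousLinearMapAt_apply_of_mem (R := ℝ) _ hq,
    map_smul, Trivialization.continuousLinearMapAt_apply_of_mem (R := ℝ) _ hq]

/-- A smooth family of vectors in a fixed tangent space is smooth in the tangent bundle. -/
lemma contMDiff_tangentBundle_fiber {E' : Type*} [NormedAddCommGroup E'] [NormedSpace ℝ E']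
    (x : M) {v : E' → TangentSpace I x} (hv : ContDiff ℝ ∞ (show E' → E from v)) :
    ContMDiff 𝓘(ℝ, E') I.tangent ∞ (fun s => (⟨x, v s⟩ : TangentBundle I M)) := by
  intro s
  rw [contMDiffAt_tangentBundle_iff]
  refine ⟨contMDiffAt_const, ?_⟩
  have hx : x ∈ (trivializationAt E (TangentSpace I : M → Type _) x).baseSet :=
    FiberBundle.mem_baseSet_trivializationAt' x
  let A : E →L[ℝ] E :=
    (trivializationAt E (TangentSpace I : M → Type _) x).continuousLinearMapAt ℝ x
  have h1 : ContDiff ℝ ∞ fun s => A (v s) := A.contDiff.comp hv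
  refine h1.contMDiff.contMDiffAt.congr_of_eventuallyEq (.of_forall fun q => ?_)
  exact (Trivialization.continuousLinearMapAt_apply_of_mem (R := ℝ) _ hx (v q)).symm

omit [IsManifold I ∞ M] in
lemma velocity_comp {E' : Type*} [NormedAddCommGroup E'] [NormedSpace ℝ E']
    {H' : Type*} [TopologicalSpace H'] {I' : ModelWithCorners ℝ E' H'}
    {N : Type*} [TopologicalSpace N] [ChartedSpace H' N] {f : M → N} {γ : ℝ → M} {t : ℝ}
    (hf : MDifferentiableAt I I' f (γ t)) (hγ : MDifferentiableAt 𝓘(ℝ, ℝ) I γ t) :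
    velocity I' (f ∘ γ) t = ⟨f (γ t), mfderiv I I' f (γ t) (velocity I γ t).2⟩ := by
  rw [velocity, mfderiv_comp t hf hγ]
  rfl

omit [IsManifold I ∞ M] in
lemma velocity_congr {γ δ : ℝ → M} {t : ℝ} (h : γ =ᶠ[𝓝 t] δ) :
    velocity I γ t = velocity I δ t := by
  have h1 : mfderiv 𝓘(ℝ, ℝ) I γ t = mfderiv 𝓘(ℝ, ℝ) I δ t := h.mfderiv_eq
  have h2 := h.eq_of_nhds
  unfold velocity
  rw [h1]
  congr 1

lemma velocity_eq_deriv (x : ℝ → E) (t : ℝ) :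
    velocity 𝓘(ℝ, E) x t = ⟨x t, (deriv x t : E)⟩ := by
  rw [velocity, mfderiv_eq_fderiv]
  rfl

/-- The coordinates of the velocity of a curve are the derivatives of its coordinates. -/
lemma tangentCoord_velocity {x₀ : M} {γ : ℝ → M} {t : ℝ}
    (hγ : MDifferentiableAt 𝓘(ℝ, ℝ) I γ t) (ht : γ t ∈ (extChartAt I x₀).source) :
    tangentCoord I x₀ (velocity I γ t)
      = (extChartAt I x₀ (γ t), deriv (fun s => extChartAt I x₀ (γ s)) t) := by
  rw [tangentCoord_apply (by exact ht)]
  have h1 : MDifferentiableAt I 𝓘(ℝ, E) (extChartAt I x₀) (γ t) :=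
    mdifferentiableAt_extChartAt (by rwa [extChartAt_source] at ht)
  have h2 := velocity_comp h1 hγ
  rw [velocity_eq_deriv] at h2
  have h3 : deriv (extChartAt I x₀ ∘ γ) t
    = mfderiv I 𝓘(ℝ, E) (extChartAt I x₀) (γ t) (velocity I γ t).2 :=
    congrArg (fun v : TangentBundle 𝓘(ℝ, E) E => (show E from v.2)) h2
  exact Prod.ext rfl h3.symm

omit [IsManifold I ∞ M] in
lemma velocity_comp_mul (γ : ℝ → M) (a b t : ℝ)
    (hγ : MDifferentiableAt 𝓘(ℝ, ℝ) I γ (a * t + b)) :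
    velocity I (fun s => γ (a * s + b)) t
      = ⟨γ (a * t + b), a • (velocity I γ (a * t + b)).2⟩ := by
  have hd : HasDerivAt (fun s : ℝ => a * s + b) a t := by
    simpa using ((hasDerivAt_id t).const_mul a).add_const b
  have h1 := velocity_comp (γ := fun s : ℝ => a * s + b) (t := t) (f := γ) hγ
    hd.differentiableAt.mdifferentiableAt
  rw [velocity_eq_deriv, hd.deriv] at h1
  have h2 : ∀ A : ℝ →L[ℝ] E, A a = a • A 1 := fun A => by
    rw [← map_smul, smul_eq_mul, mul_one]
  exact h1.trans (congrArg (fun w => (⟨γ (a * t + b), w⟩ : TangentBundle I M)) (h2 _))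

/-- The velocity of a smooth curve is a smooth curve in the tangent bundle. -/
lemma ContMDiffOn.velocity {γ : ℝ → M} {J : Set ℝ} (hJ : IsOpen J)
    (hγ : ContMDiffOn 𝓘(ℝ, ℝ) I ∞ γ J) :
    ContMDiffOn 𝓘(ℝ, ℝ) I.tangent ∞ (velocity I γ) J := by
  have h1 : ContMDiffOn 𝓘(ℝ, ℝ).tangent I.tangent ∞ (tangentMapWithin 𝓘(ℝ, ℝ) I γ J)
      (π ℝ (TangentSpace 𝓘(ℝ, ℝ)) ⁻¹' J) :=
    hγ.contMDiffOn_tangentMapWithin (by simp) hJ.uniqueMDiffOn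
  have h2 : ContMDiff 𝓘(ℝ, ℝ) 𝓘(ℝ, ℝ).tangent ∞
      (fun t : ℝ => (⟨t, (1 : ℝ)⟩ : TangentBundle 𝓘(ℝ, ℝ) ℝ)) := by
    have := (contMDiff_vectorSpace_iff_contDiff (𝕜 := ℝ) (E := ℝ) (n := ∞)
      (V := fun _ => (1 : ℝ))).2 contDiff_const
    exact this
  refine (h1.comp h2.contMDiffOn fun t ht => ht).congr fun t ht => ?_
  change NullGeodesics.velocity I γ t = ⟨γ t, mfderivWithin 𝓘(ℝ, ℝ) I γ J t (1 : ℝ)⟩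
  rw [mfderivWithin_of_isOpen hJ ht]
  rfl

end TangentBundle

/-! ### Affine reparametrization of geodesics. -/

section Reparametrization

variable {E : Type*} [NormedAddCommGroup E] [NormedSpace ℝ E]
  {H : Type*} [TopologicalSpace H] {I : ModelWithCorners ℝ E H}
  {M : Type*} [TopologicalSpace M] [ChartedSpace H M]

lemma localMetric_smul_left (g : BilinField I M) (x₀ : M) (y : E) (a : ℝ) (v w : E) :
    localMetric g x₀ y (a • v) w = a * localMetric g x₀ y v w := by
  let D : E →L[ℝ] TangentSpace I ((extChartAt I x₀).symm y) :=
    mfderiv 𝓘(ℝ, E) I (extChartAt I x₀).symm y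
  change g _ (D (a • v)) (D w) = a * g _ (D v) (D w)
  rw [map_smul, map_smul, LinearMap.smul_apply, smul_eq_mul]

lemma localMetric_smul_right (g : BilinField I M) (x₀ : M) (y : E) (a : ℝ) (v w : E) :
    localMetric g x₀ y v (a • w) = a * localMetric g x₀ y v w := by
  let D : E →L[ℝ] TangentSpace I ((extChartAt I x₀).symm y) :=
    mfderiv 𝓘(ℝ, E) I (extChartAt I x₀).symm y
  change g _ (D v) (D (a • w)) = a * g _ (D v) (D w)
  rw [map_smul, map_smul, smul_eq_mul]

lemma christoffel_smul (g : BilinField I M) (x₀ : M) (y : E) (a : ℝ) (v w : E) :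
    christoffel (localMetric g x₀) y (a • v) (a • v) w
      = a ^ 2 * christoffel (localMetric g x₀) y v v w := by
  have h1 : ∀ f : E → ℝ, fderiv ℝ (fun z => a * f z) y = a • fderiv ℝ f y :=
    fun f => congrFun (fderiv_const_smul_field (f := f) a) y
  simp only [christoffel, localMetric_smul_left, localMetric_smul_right, h1, map_smul,
    smul_apply, smul_eq_mul]
  ring

lemma IsGeodesicOn.mono {g : BilinField I M} {γ : ℝ → M} {J J' : Set ℝ} (h : IsGeodesicOn g γ J)
    (hJ : J' ⊆ J) (ho : IsOpen J') (hc : J'.OrdConnected) (hn : J'.Nonempty) :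
    IsGeodesicOn g γ J' :=
  ⟨ho, hc, hn, h.contMDiffOn.mono hJ, fun t ht => h.equation t (hJ ht)⟩

lemma IsGeodesicOn.contMDiffAt {g : BilinField I M} {γ : ℝ → M} {J : Set ℝ}
    (h : IsGeodesicOn g γ J) {t : ℝ} (ht : t ∈ J) : ContMDiffAt 𝓘(ℝ, ℝ) I ∞ γ t :=
  h.contMDiffOn.contMDiffAt (h.isOpen.mem_nhds ht)

lemma IsGeodesicOn.mdifferentiableAt {g : BilinField I M} {γ : ℝ → M} {J : Set ℝ}
    (h : IsGeodesicOn g γ J) {t : ℝ} (ht : t ∈ J) : MDifferentiableAt 𝓘(ℝ, ℝ) I γ t :=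
  (h.contMDiffAt ht).mdifferentiableAt (by simp)

lemma IsGeodesicOn.contMDiff {g : BilinField I M} {γ : ℝ → M} (h : IsGeodesicOn g γ univ) :
    ContMDiff 𝓘(ℝ, ℝ) I ∞ γ :=
  contMDiffOn_univ.1 h.contMDiffOn

/-- An affine reparametrization of a geodesic is a geodesic. -/
lemma IsGeodesicOn.comp_affine {g : BilinField I M} {γ : ℝ → M} (h : IsGeodesicOn g γ univ)
    (a b : ℝ) : IsGeodesicOn g (fun s => γ (a * s + b)) univ := by
  refine ⟨isOpen_univ, ordConnected_univ, univ_nonempty, ?_, ?_⟩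
  · have h1 : ContDiff ℝ ∞ fun s : ℝ => a * s + b := by fun_prop
    exact (h.contMDiff.comp h1.contMDiff).contMDiffOn
  · intro t _ x₀ hx w x
    have h1 := h.equation (a * t + b) trivial x₀ hx w
    let y : ℝ → E := fun s => extChartAt I x₀ (γ s)
    have hd : ∀ f : ℝ → E, deriv (fun s => f (a * s + b)) = fun s => a • deriv f (a * s + b) := by
      intro f
      ext s
      have := deriv_comp_mul_left a (fun r => f (r + b)) s
      rw [this, deriv_comp_add_const]
    have hx1 : deriv x = fun s => a • deriv y (a * s + b) := hd y
    have hx2 : deriv (deriv x) t = a ^ 2 • deriv (deriv y) (a * t + b) := by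
      rw [hx1, deriv_fun_const_smul_field, hd (deriv y), smul_smul, sq]
    have hx0 : x t = y (a * t + b) := rfl
    change localMetric g x₀ (x t) (deriv (deriv x) t) w
      + christoffel (localMetric g x₀) (x t) (deriv x t) (deriv x t) w = 0
    -- Both terms scale by a², the Christoffel term because it is quadratic in the velocity.
    rw [hx2, hx1, hx0, localMetric_smul_left, christoffel_smul, ← mul_add]
    exact mul_eq_zero_of_right _ h1

end Reparametrization

/-! ### Local and global uniqueness for ordinary differential equations. -/

section Uniqueness

lemma eventuallyEq_of_ode {E : Type*} [NormedAddCommGroup E] [NormedSpace ℝ E] {X : E → E}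
    {c₁ c₂ : ℝ → E} {t : ℝ} (hX : ContDiffAt ℝ 1 X (c₁ t))
    (h₁ : ∀ᶠ s in 𝓝 t, HasDerivAt c₁ (X (c₁ s)) s) (h₂ : ∀ᶠ s in 𝓝 t, HasDerivAt c₂ (X (c₂ s)) s)
    (h : c₁ t = c₂ t) : c₁ =ᶠ[𝓝 t] c₂ := by
  obtain ⟨K, U, hU, hK⟩ := hX.exists_lipschitzOnWith
  refine ODE_solution_unique_of_eventually (v := fun _ => X) (s := fun _ => U) (K := K)
    (.of_forall fun _ => hK) ?_ ?_ h
  · exact h₁.and (h₁.self_of_nhds.continuousAt.preimage_mem_nhds hU)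
  · exact h₂.and (h₂.self_of_nhds.continuousAt.preimage_mem_nhds (by rwa [← h]))

/-- Continuous curves which agree near each point where they agree are equal. -/
lemma eqOn_of_eventuallyEq {Y : Type*} [TopologicalSpace Y] [T2Space Y] {J : Set ℝ}
    (hJ : IsOpen J) (hc : J.OrdConnected) {c₁ c₂ : ℝ → Y} (h₁ : ContinuousOn c₁ J)
    (h₂ : ContinuousOn c₂ J) (hloc : ∀ t ∈ J, c₁ t = c₂ t → c₁ =ᶠ[𝓝 t] c₂) {t₀ : ℝ} (ht₀ : t₀ ∈ J)
    (h₀ : c₁ t₀ = c₂ t₀) : EqOn c₁ c₂ J := by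
  let u : Set ℝ := {t | t ∈ J ∧ c₁ =ᶠ[𝓝 t] c₂}
  let v : Set ℝ := {t | t ∈ J ∧ c₁ t ≠ c₂ t}
  have hu : IsOpen u := hJ.inter isOpen_setOfPred_eventually_nhds
  have hv : IsOpen v := by
    have := (h₁.prodMk h₂).isOpen_inter_preimage hJ (isClosed_diagonal (X := Y)).isOpen_compl
    exact this
  have hp : IsPreconnected J := hc.isPreconnected
  by_contra hne
  simp only [EqOn, not_forall] at hne
  obtain ⟨t, ht, htne⟩ := hne
  obtain ⟨s, -, hsu, hsv⟩ := hp u v hu hv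
    (fun s hs => by
      by_cases h : c₁ s = c₂ s
      · exact Or.inl ⟨hs, hloc s hs h⟩
      · exact Or.inr ⟨hs, h⟩)
    ⟨t₀, ht₀, ht₀, hloc t₀ ht₀ h₀⟩ ⟨t, ht, ht, htne⟩
  exact hsv.2 hsu.2.eq_of_nhds

end Uniqueness

/-! ### The Riemannian geodesic equation as a first-order system. -/

section Riemannian

variable {n : ℕ} {Z : Type*} [TopologicalSpace Z] [ChartedSpace (EuclideanSpace ℝ (Fin n)) Z]
  [IsManifold (𝓡 n) ∞ Z] (g : RiemannianMetric n Z)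

local notation "E" => EuclideanSpace ℝ (Fin n)

instance normedAddCommGroupDual : NormedAddCommGroup (E →L[ℝ] ℝ) :=
  ContinuousLinearMap.toNormedAddCommGroup

instance normedSpaceDual : NormedSpace ℝ (E →L[ℝ] ℝ) := ContinuousLinearMap.toNormedSpace

instance normedAddCommGroupBilin : NormedAddCommGroup (E →L[ℝ] E →L[ℝ] ℝ) :=
  ContinuousLinearMap.toNormedAddCommGroup

instance normedSpaceBilin : NormedSpace ℝ (E →L[ℝ] E →L[ℝ] ℝ) := ContinuousLinearMap.toNormedSpace

/-- The squared norm of tangent vectors. -/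
def normSq (v : TangentBundle (𝓡 n) Z) : ℝ := g.inner v.1 v.2 v.2

lemma contMDiff_normSq : ContMDiff (𝓡 n).tangent 𝓘(ℝ, ℝ) ∞ (normSq g) := by
  have h1 : ContMDiff (𝓡 n).tangent ((𝓡 n).prod 𝓘(ℝ, ℝ)) ∞
      (fun v : TangentBundle (𝓡 n) Z =>
        (TotalSpace.mk' ℝ v.1 (g.inner v.1 v.2 v.2) : TotalSpace ℝ (Bundle.Trivial Z ℝ))) := by
    refine ContMDiff.clm_bundle_apply₂ (F₁ := E) (F₂ := E) (F₃ := ℝ)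
      (E₃ := Bundle.Trivial Z ℝ) (b := fun v : TangentBundle (𝓡 n) Z => v.1)
      (ψ := fun v : TangentBundle (𝓡 n) Z => g.inner v.1)
      (v := fun v : TangentBundle (𝓡 n) Z => v.2) (w := fun v : TangentBundle (𝓡 n) Z => v.2) ?_ ?_ ?_
    · exact g.contMDiff.comp (contMDiff_proj (TangentSpace (𝓡 n) : Z → Type _))
    · exact contMDiff_id
    · exact contMDiff_id
  intro v
  have := (contMDiffAt_totalSpace.1 (h1 v)).2
  exact this

/-- The Gram form of the metric in the chart at `x₀`. -/
def gram (x₀ : Z) (y : E) : E →L[ℝ] E →L[ℝ] ℝ :=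
  let B : E →L[ℝ] E →L[ℝ] ℝ := g.inner ((extChartAt (𝓡 n) x₀).symm y)
  let D : E →L[ℝ] E := mfderiv 𝓘(ℝ, E) (𝓡 n) (extChartAt (𝓡 n) x₀).symm y
  B.bilinearComp D D

lemma localMetric_eq_gram (x₀ : Z) (y v w : E) : localMetric g.form x₀ y v w = gram g x₀ y v w :=
  rfl

lemma gram_symm (x₀ : Z) (y v w : E) : gram g x₀ y v w = gram g x₀ y w v :=
  let D : E →L[ℝ] E := mfderiv 𝓘(ℝ, E) (𝓡 n) (extChartAt (𝓡 n) x₀).symm y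
  g.symm ((extChartAt (𝓡 n) x₀).symm y) (D v) (D w)

lemma gram_self {x₀ : Z} {y : E} (hy : y ∈ (extChartAt (𝓡 n) x₀).target) (v : E) :
    gram g x₀ y v v = normSq g ((tangentCoord (𝓡 n) x₀).symm (y, v)) := by
  rw [tangentCoord_symm_apply hy]
  rfl

/-- The diagonal values are `normSq` at a point of the tangent bundle that varies smoothly;
polarization recovers the bilinear form from them. -/
lemma contDiffOn_gram (x₀ : Z) : ContDiffOn ℝ ∞ (gram g x₀) (extChartAt (𝓡 n) x₀).target := by
  have h1 : ∀ v : E, ContDiffOn ℝ ∞ (fun y => gram g x₀ y v v) (extChartAt (𝓡 n) x₀).target := by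
    intro v
    have h2 : ContMDiffOn 𝓘(ℝ, E) 𝓘(ℝ, ℝ) ∞
        (fun y => normSq g ((tangentCoord (𝓡 n) x₀).symm (y, v))) (extChartAt (𝓡 n) x₀).target := by
      refine (contMDiff_normSq g).comp_contMDiffOn ((contMDiffOn_tangentCoord_symm x₀).comp
        (ContDiff.contMDiff (contDiff_id.prodMk contDiff_const)).contMDiffOn ?_)
      intro y hy
      rw [mem_preimage, tangentCoord_target]
      exact ⟨hy, trivial⟩
    exact (contMDiffOn_iff_contDiffOn.1 h2).congr fun y hy => gram_self g hy v
  rw [contDiffOn_clm_apply]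
  intro v
  rw [contDiffOn_clm_apply]
  intro w
  have h3 := (((h1 (v + w)).sub (h1 v)).sub (h1 w)).div_const 2
  refine h3.congr fun y _ => ?_
  simp only [map_add, add_apply]
  rw [gram_symm g x₀ y w v]
  ring

lemma gram_pos {x₀ : Z} {y : E} (hy : y ∈ (extChartAt (𝓡 n) x₀).target) {v : E} (hv : v ≠ 0) :
    0 < gram g x₀ y v v := by
  let D : E →L[ℝ] E := mfderiv 𝓘(ℝ, E) (𝓡 n) (extChartAt (𝓡 n) x₀).symm y
  refine g.pos ((extChartAt (𝓡 n) x₀).symm y) (D v) fun h0 => hv ?_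
  have h1 : (tangentCoord (𝓡 n) x₀).symm (y, v) = (tangentCoord (𝓡 n) x₀).symm (y, 0) := by
    rw [tangentCoord_symm_apply hy, tangentCoord_symm_apply hy]
    refine congrArg (fun u => (⟨(extChartAt (𝓡 n) x₀).symm y, u⟩ : TangentBundle (𝓡 n) Z)) ?_
    exact h0.trans (map_zero (mfderiv 𝓘(ℝ, E) (𝓡 n) (extChartAt (𝓡 n) x₀).symm y)).symm
  have h2 := (tangentCoord (𝓡 n) x₀).symm.injOn
    (by rw [PartialEquiv.symm_source, tangentCoord_target]; exact ⟨hy, trivial⟩)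
    (by rw [PartialEquiv.symm_source, tangentCoord_target]; exact ⟨hy, trivial⟩) h1
  exact congrArg Prod.snd h2

/-- A positive definite form is injective as a map to the dual space, which has the same dimension.
This allows solving the geodesic equation, written with a lowered index, for the second derivative.
-/
lemma gram_isInvertible {x₀ : Z} {y : E} (hy : y ∈ (extChartAt (𝓡 n) x₀).target) :
    ∃ A : E ≃L[ℝ] (E →L[ℝ] ℝ), (A : E →L[ℝ] E →L[ℝ] ℝ) = gram g x₀ y := by
  have hinj : Function.Injective (gram g x₀ y) := by
    rw [injective_iff_map_eq_zero]
    intro v hv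
    by_contra hne
    have := gram_pos g hy hne
    rw [hv] at this
    simp at this
  have hfr : Module.finrank ℝ E = Module.finrank ℝ (E →L[ℝ] ℝ) := by
    rw [← LinearMap.toContinuousLinearMap.finrank_eq]
    exact (Subspace.dual_finrank_eq (K := ℝ) (V := E)).symm
  let A := LinearEquiv.ofInjectiveOfFinrankEq (gram g x₀ y).toLinearMap hinj hfr
  exact ⟨A.toContinuousLinearEquiv, by ext v w; rfl⟩

/-- The Christoffel symbols `G(∇_v v, ·)` as a linear form. -/
def christoffelForm (x₀ : Z) (p : E × E) : E →L[ℝ] ℝ :=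
  fderiv ℝ (gram g x₀) p.1 p.2 p.2
    - (2 : ℝ)⁻¹ • ((fderiv ℝ (gram g x₀) p.1).flip p.2).flip p.2

lemma christoffelForm_apply (x₀ : Z) (y v w : E) :
    christoffelForm g x₀ (y, v) w
      = fderiv ℝ (gram g x₀) y v v w - (2 : ℝ)⁻¹ * fderiv ℝ (gram g x₀) y w v v := rfl

lemma differentiableAt_gram {x₀ : Z} {y : E} (hy : y ∈ (extChartAt (𝓡 n) x₀).target) :
    DifferentiableAt ℝ (gram g x₀) y :=
  ((contDiffOn_gram g x₀).contDiffAt ((isOpen_extChartAt_target x₀).mem_nhds hy)).differentiableAt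
    (by simp)

/-- For equal first two arguments the first two derivatives in `christoffel` coincide, whence the
coefficients 1 and 1/2 of `christoffelForm`. -/
lemma christoffel_eq {x₀ : Z} {y : E} (hy : y ∈ (extChartAt (𝓡 n) x₀).target) (v w : E) :
    christoffel (localMetric g.form x₀) y v v w = christoffelForm g x₀ (y, v) w := by
  have h1 : ∀ a b : E, HasFDerivAt (fun z => localMetric g.form x₀ z a b)
      (((fderiv ℝ (gram g x₀) y).flip a).flip b) y := by
    intro a b
    have h2 := ((differentiableAt_gram g hy).hasFDerivAt.clm_apply (hasFDerivAt_const a y)).clm_apply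
      (hasFDerivAt_const b y)
    refine h2.congr_fderiv ?_
    ext u
    simp
  rw [christoffel, (h1 v w).fderiv, (h1 v v).fderiv, christoffelForm_apply]
  simp only [ContinuousLinearMap.flip_apply]
  ring

lemma contDiffOn_christoffelForm (x₀ : Z) :
    ContDiffOn ℝ ∞ (christoffelForm g x₀) ((extChartAt (𝓡 n) x₀).target ×ˢ univ) := by
  have h1 : ContDiffOn ℝ ∞ (fun p : E × E => fderiv ℝ (gram g x₀) p.1)
      ((extChartAt (𝓡 n) x₀).target ×ˢ univ) :=
    ((contDiffOn_gram g x₀).fderiv_of_isOpen (isOpen_extChartAt_target x₀) (by simp)).comp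
      contDiff_fst.contDiffOn fun p hp => hp.1
  rw [contDiffOn_clm_apply]
  intro w
  have h2 : ContDiffOn ℝ ∞ (fun p : E × E => p.2) ((extChartAt (𝓡 n) x₀).target ×ˢ univ) :=
    contDiff_snd.contDiffOn
  have h3 : ContDiffOn ℝ ∞ (fun _ : E × E => w) ((extChartAt (𝓡 n) x₀).target ×ˢ univ) :=
    contDiffOn_const
  exact (((h1.clm_apply h2).clm_apply h2).clm_apply h3).sub
    (contDiffOn_const.smul (((h1.clm_apply h3).clm_apply h2).clm_apply h2))

/-- The geodesic vector field in the coordinates `(x, ẋ)`. -/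
def geodesicField (x₀ : Z) (p : E × E) : E × E :=
  (p.2, -(gram g x₀ p.1).inverse (christoffelForm g x₀ p))

lemma contDiffOn_geodesicField (x₀ : Z) :
    ContDiffOn ℝ ∞ (geodesicField g x₀) ((extChartAt (𝓡 n) x₀).target ×ˢ univ) := by
  refine contDiff_snd.contDiffOn.prodMk (ContDiffOn.neg (ContDiffOn.clm_apply ?_
    (contDiffOn_christoffelForm g x₀)))
  intro p hp
  obtain ⟨A, hA⟩ := gram_isInvertible g hp.1
  have h1 : ContDiffAt ℝ ∞ ContinuousLinearMap.inverse (gram g x₀ p.1) := by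
    rw [← hA]
    exact contDiffAt_map_inverse A
  have h2 : ContDiffAt ℝ ∞ (gram g x₀) p.1 :=
    (contDiffOn_gram g x₀).contDiffAt ((isOpen_extChartAt_target x₀).mem_nhds hp.1)
  exact (h1.comp p (h2.comp p contDiffAt_fst)).contDiffWithinAt

/-- The geodesic equation solved for the second derivative. -/
lemma gram_geodesicField {x₀ : Z} {y : E} (hy : y ∈ (extChartAt (𝓡 n) x₀).target) (v w : E) :
    gram g x₀ y (geodesicField g x₀ (y, v)).2 w + christoffelForm g x₀ (y, v) w = 0 := by
  obtain ⟨A, hA⟩ := gram_isInvertible g hy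
  simp only [geodesicField]
  rw [map_neg, ← hA, ContinuousLinearMap.inverse_equiv]
  simp

variable {g}

/-- The velocity of a geodesic is an integral curve of the geodesic vector field. -/
lemma IsGeodesicOn.hasDerivAt_tangentCoord {γ : ℝ → Z} {J : Set ℝ}
    (h : IsGeodesicOn g.form γ J) {x₀ : Z} {t : ℝ} (ht : t ∈ J)
    (hx : γ t ∈ (extChartAt (𝓡 n) x₀).source) :
    HasDerivAt (fun s => tangentCoord (𝓡 n) x₀ (velocity (𝓡 n) γ s))
      (geodesicField g x₀ (tangentCoord (𝓡 n) x₀ (velocity (𝓡 n) γ t))) t := by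
  let x : ℝ → E := fun s => extChartAt (𝓡 n) x₀ (γ s)
  have hxs : ContDiffAt ℝ ∞ x t := contMDiffAt_iff_contDiffAt.1
    ((contMDiffAt_extChartAt' (by rwa [extChartAt_source] at hx)).comp t (h.contMDiffAt ht))
  have hx' : ContDiffAt ℝ ∞ (deriv x) t := by
    have := hxs.fderiv_right (m := ∞) (by simp)
    exact this.clm_apply contDiffAt_const
  have hev : (fun s => tangentCoord (𝓡 n) x₀ (velocity (𝓡 n) γ s)) =ᶠ[𝓝 t]
      fun s => (x s, deriv x s) := by
    filter_upwards [h.isOpen.mem_nhds ht, (h.contMDiffAt ht).continuousAt.preimage_mem_nhds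
      ((isOpen_extChartAt_source x₀).mem_nhds hx)] with s hs hs'
    exact tangentCoord_velocity (h.mdifferentiableAt hs) hs'
  have hd : HasDerivAt (fun s => (x s, deriv x s)) (deriv x t, deriv (deriv x) t) t :=
    (hxs.differentiableAt (by simp)).hasDerivAt.prodMk
      (hx'.differentiableAt (by simp)).hasDerivAt
  refine (hd.congr_of_eventuallyEq hev).congr_deriv ?_
  rw [hev.eq_of_nhds]
  refine Prod.ext rfl ?_
  have hy : x t ∈ (extChartAt (𝓡 n) x₀).target := (extChartAt (𝓡 n) x₀).map_source hx
  obtain ⟨A, hA⟩ := gram_isInvertible g hy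
  have hinj : Function.Injective (gram g x₀ (x t)) := by rw [← hA]; exact A.injective
  -- The Gram form is nondegenerate, so it suffices to pair with every `w`; both candidates for the
  -- acceleration satisfy the same lowered equation.
  apply hinj
  ext1 w
  have h1 := h.equation t ht x₀ hx w
  have h2 := gram_geodesicField g hy (deriv x t) w
  change localMetric g.form x₀ (x t) (deriv (deriv x) t) w
      + christoffel (localMetric g.form x₀) (x t) (deriv x t) (deriv x t) w = 0 at h1
  rw [localMetric_eq_gram, christoffel_eq g hy] at h1
  linarith

lemma IsGeodesicOn.continuousOn_velocity {γ : ℝ → Z} {J : Set ℝ} (h : IsGeodesicOn g.form γ J) :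
    ContinuousOn (velocity (𝓡 n) γ) J :=
  (ContMDiffOn.velocity h.isOpen h.contMDiffOn).continuousOn

/-- A curve in `TZ` that solves the geodesic equation in coordinates agrees with the velocity of
a geodesic. -/
lemma IsGeodesicOn.eventuallyEq_velocity {γ : ℝ → Z} {J : Set ℝ}
    (h : IsGeodesicOn g.form γ J) {x₀ : Z} {t : ℝ} (ht : t ∈ J)
    (hx : γ t ∈ (extChartAt (𝓡 n) x₀).source) {c : ℝ → E × E}
    (hc : ∀ᶠ s in 𝓝 t, HasDerivAt c (geodesicField g x₀ (c s)) s)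
    (heq : c t = tangentCoord (𝓡 n) x₀ (velocity (𝓡 n) γ t)) :
    (fun s => tangentCoord (𝓡 n) x₀ (velocity (𝓡 n) γ s)) =ᶠ[𝓝 t] c := by
  refine eventuallyEq_of_ode (X := geodesicField g x₀) ?_ ?_ hc heq.symm
  · have hmem : tangentCoord (𝓡 n) x₀ (velocity (𝓡 n) γ t)
        ∈ (extChartAt (𝓡 n) x₀).target ×ˢ (univ : Set E) := by
      rw [← tangentCoord_target]
      exact (tangentCoord (𝓡 n) x₀).map_source (by rw [tangentCoord_source]; exact hx)
    exact ((contDiffOn_geodesicField g x₀).contDiffAt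
      (((isOpen_extChartAt_target x₀).prod isOpen_univ).mem_nhds hmem)).of_le (by simp)
  · filter_upwards [h.isOpen.mem_nhds ht, (h.contMDiffAt ht).continuousAt.preimage_mem_nhds
      ((isOpen_extChartAt_source x₀).mem_nhds hx)] with s hs hs'
    exact h.hasDerivAt_tangentCoord hs hs'

/-- Two geodesics with the same velocity at one time have the same velocities. -/
theorem IsGeodesicOn.velocity_eqOn [T2Space Z] {γ δ : ℝ → Z} {J : Set ℝ}
    (hγ : IsGeodesicOn g.form γ J) (hδ : IsGeodesicOn g.form δ J) {t₀ : ℝ} (ht₀ : t₀ ∈ J)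
    (h₀ : velocity (𝓡 n) γ t₀ = velocity (𝓡 n) δ t₀) :
    EqOn (velocity (𝓡 n) γ) (velocity (𝓡 n) δ) J := by
  have : IsManifold (𝓡 n) 1 Z := IsManifold.of_le (n := ∞) (by simp)
  have : T2Space (TangentBundle (𝓡 n) Z) := t2Space_tangentBundle
  refine eqOn_of_eventuallyEq hγ.isOpen hγ.ordConnected hγ.continuousOn_velocity
    hδ.continuousOn_velocity (fun t ht heq => ?_) ht₀ h₀
  have hsrc : ∀ ζ : ℝ → Z, IsGeodesicOn g.form ζ J → ζ t = γ t →
      ∀ᶠ s in 𝓝 t, ζ s ∈ (extChartAt (𝓡 n) (γ t)).source := fun ζ hζ h =>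
    (hζ.contMDiffAt ht).continuousAt.preimage_mem_nhds (by
      rw [h]; exact extChartAt_source_mem_nhds (γ t))
  have hδγ : δ t = γ t := (congrArg TotalSpace.proj heq).symm
  have h1 := hγ.eventuallyEq_velocity (x₀ := γ t) ht (mem_extChartAt_source _)
    (c := fun s => tangentCoord (𝓡 n) (γ t) (velocity (𝓡 n) δ s)) (by
      filter_upwards [hγ.isOpen.mem_nhds ht, hsrc δ hδ hδγ] with s hs hs'
      exact hδ.hasDerivAt_tangentCoord hs hs') (by rw [heq])
  filter_upwards [h1, hsrc δ hδ hδγ, hsrc γ hγ rfl] with s hs hs1 hs2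
  exact (tangentCoord (𝓡 n) (γ t)).injOn (by rw [tangentCoord_source]; exact hs2)
    (by rw [tangentCoord_source]; exact hs1) hs

/-- The speed of a geodesic is constant. -/
theorem IsGeodesicOn.normSq_velocity {γ : ℝ → Z} (h : IsGeodesicOn g.form γ univ) (s t : ℝ) :
    normSq g (velocity (𝓡 n) γ s) = normSq g (velocity (𝓡 n) γ t) := by
  suffices hd : ∀ t, HasDerivAt (fun s => normSq g (velocity (𝓡 n) γ s)) 0 t from
    is_const_of_deriv_eq_zero (fun t => (hd t).differentiableAt) (fun t => (hd t).deriv) s t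
  intro t
  let x₀ := γ t
  let c : ℝ → E × E := fun s => tangentCoord (𝓡 n) x₀ (velocity (𝓡 n) γ s)
  have hsrc : ∀ᶠ s in 𝓝 t, γ s ∈ (extChartAt (𝓡 n) x₀).source :=
    (h.contMDiffAt (mem_univ t)).continuousAt.preimage_mem_nhds (extChartAt_source_mem_nhds (γ t))
  have hev : (fun s => normSq g (velocity (𝓡 n) γ s)) =ᶠ[𝓝 t]
      fun s => gram g x₀ (c s).1 (c s).2 (c s).2 := by
    filter_upwards [hsrc] with s hs
    have h1 : velocity (𝓡 n) γ s ∈ (tangentCoord (𝓡 n) x₀).source := by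
      rw [tangentCoord_source]; exact hs
    have h2 : c s ∈ (tangentCoord (𝓡 n) x₀).target := (tangentCoord (𝓡 n) x₀).map_source h1
    rw [tangentCoord_target] at h2
    rw [gram_self g h2.1, Prod.mk.eta, (tangentCoord (𝓡 n) x₀).left_inv h1]
  have hc := h.hasDerivAt_tangentCoord (x₀ := x₀) (mem_univ t) (mem_extChartAt_source _)
  have hy : (c t).1 ∈ (extChartAt (𝓡 n) x₀).target := by
    have h2 : c t ∈ (tangentCoord (𝓡 n) x₀).target := (tangentCoord (𝓡 n) x₀).map_source (by
      rw [tangentCoord_source]; exact mem_extChartAt_source _)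
    rw [tangentCoord_target] at h2
    exact h2.1
  have hc1 : HasDerivAt (fun s => (c s).1) (c t).2 t := hc.fst
  have hc2 : HasDerivAt (fun s => (c s).2) (geodesicField g x₀ (c t)).2 t := hc.snd
  have hfd : HasFDerivAt (gram g x₀) (fderiv ℝ (gram g x₀) (c t).1) ((fun s => (c s).1) t) :=
    (differentiableAt_gram g hy).hasFDerivAt
  have hG : HasDerivAt (fun s => gram g x₀ (c s).1) (fderiv ℝ (gram g x₀) (c t).1 (c t).2) t :=
    HasFDerivAt.comp_hasDerivAt (l := gram g x₀) (f := fun s => (c s).1) t hfd hc1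
  have hd := (hG.clm_apply hc2).clm_apply hc2
  refine (hd.congr_of_eventuallyEq hev).congr_deriv ?_
  -- The geodesic equation paired with the velocity v itself reads 2G(a, v) + ∂_v G(v, v) = 0, with
  -- a the acceleration; the left side is the derivative of G(v, v).
  have h3 := gram_geodesicField g hy (c t).2 (c t).2
  rw [christoffelForm_apply, Prod.mk.eta] at h3
  have h4 := gram_symm g x₀ (c t).1 (c t).2 (geodesicField g x₀ (c t)).2
  simp only [add_apply]
  rw [h4]
  linarith

end Riemannian

/-! ### Maps into embedded submanifolds; a criterion for regular points. -/

section Embedding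

variable {E : Type*} [NormedAddCommGroup E] [NormedSpace ℝ E]
  {H : Type*} [TopologicalSpace H] {I : ModelWithCorners ℝ E H}
  {M : Type*} [TopologicalSpace M] [ChartedSpace H M]
  {E' : Type*} [NormedAddCommGroup E'] [NormedSpace ℝ E']
  {H' : Type*} [TopologicalSpace H'] {I' : ModelWithCorners ℝ E' H'}
  {N : Type*} [TopologicalSpace N] [ChartedSpace H' N]
  {E'' : Type*} [NormedAddCommGroup E''] [NormedSpace ℝ E'']
  {H'' : Type*} [TopologicalSpace H''] {I'' : ModelWithCorners ℝ E'' H''}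
  {P : Type*} [TopologicalSpace P] [ChartedSpace H'' P]

/-- A map to an embedded submanifold is smooth if it is smooth as a map to the ambient manifold. -/
lemma IsSmoothEmbedding.contMDiffAt_of_comp [IsManifold I ∞ M] [IsManifold I' ∞ N]
    {i : M → N} (hi : IsSmoothEmbedding I I' ∞ i)
    {f : P → M} {p : P} (h : ContMDiffAt I'' I' ∞ (fun q => i (f q)) p) :
    ContMDiffAt I'' I ∞ f p :=
  (ContMDiffAt.iff_comp_isImmersionAt (hi.isImmersion.isImmersionAt (f p))).2
    ⟨hi.isEmbedding.isInducing.continuousAt_iff.2 h.continuousAt, h⟩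

/-- A function with a nonzero derivative along a curve has a surjective differential. -/
lemma surjective_mfderiv_of_curve {f : M → ℝ} {c : ℝ → M} {t : ℝ}
    (hf : MDifferentiableAt I 𝓘(ℝ, ℝ) f (c t)) (hc : MDifferentiableAt 𝓘(ℝ, ℝ) I c t) {a : ℝ}
    (ha : a ≠ 0) (hd : HasDerivAt (fun s => f (c s)) a t) :
    Function.Surjective (mfderiv I 𝓘(ℝ, ℝ) f (c t)) := by
  have h1 := velocity_comp hf hc
  rw [velocity_eq_deriv, show deriv (f ∘ c) t = a from hd.deriv] at h1
  have h2 : a = mfderiv I 𝓘(ℝ, ℝ) f (c t) (velocity I c t).2 :=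
    congrArg (fun v : TangentBundle 𝓘(ℝ, ℝ) ℝ => (show ℝ from v.2)) h1
  intro b
  let A : TangentSpace I (c t) →L[ℝ] ℝ := mfderiv I 𝓘(ℝ, ℝ) f (c t)
  have h3 : A (velocity I c t).2 = a := h2.symm
  let b' : ℝ := b
  have h4 : ∀ w, A w = a → A ((b' / a : ℝ) • w) = b' := fun w hw => by
    rw [map_smul, hw, smul_eq_mul, div_mul_cancel₀ _ ha]
  exact ⟨_, h4 _ h3⟩

end Embedding

/-! ### The manifold structure of STZ. -/

section UnitTangentBundle

variable {n : ℕ} {Z : Type*} [TopologicalSpace Z] [ChartedSpace (EuclideanSpace ℝ (Fin n)) Z]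
  [IsManifold (𝓡 n) ∞ Z] (g : RiemannianMetric n Z)

local notation "E" => EuclideanSpace ℝ (Fin n)

lemma mem_unitTangentBundle {v : TangentBundle (𝓡 n) Z} :
    v ∈ unitTangentBundle g ↔ normSq g v = 1 := Iff.rfl

/-- The value 1 of the squared norm is regular: along the ray s ↦ (1 + s)u it equals (1 + s)², whose
derivative at 0 is 2. -/
theorem exists_unitTangentBundle_manifold (hn : 1 ≤ n) :
    ∃ _ : ChartedSpace (EuclideanSpace ℝ (Fin (2 * n - 1))) (unitTangentBundle g),
      IsManifold (𝓡 (2 * n - 1)) ∞ (unitTangentBundle g) ∧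
      IsSmoothEmbedding (𝓡 (2 * n - 1)) (𝓡 n).tangent ∞
        (Subtype.val : unitTangentBundle g → TangentBundle (𝓡 n) Z) := by
  refine exists_levelSet_submanifold ?_ fun u hu => ?_
  · rw [Module.finrank_prod, finrank_euclideanSpace_fin]
    omega
  · have hsm : ContMDiff (𝓡 n).tangent 𝓘(ℝ, ℝ) ∞ fun v => normSq g v - 1 :=
      (contMDiff_normSq g).sub contMDiff_const
    refine ⟨fun v => normSq g v - 1, univ, isOpen_univ, trivial, hsm.contMDiffOn, ?_, ?_⟩
    · let c : ℝ → TangentBundle (𝓡 n) Z := fun s => ⟨u.1, (1 + s) • u.2⟩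
      have hc : ContMDiff 𝓘(ℝ, ℝ) (𝓡 n).tangent ∞ c := by
        refine contMDiff_tangentBundle_fiber u.1 (v := fun s : ℝ => (1 + s) • u.2) ?_
        exact ((contDiff_const.add contDiff_id).smul contDiff_const :
          ContDiff ℝ ∞ fun s : ℝ => (1 + s) • (show E from u.2))
      have hc0 : c 0 = u := by simp [c]
      have hval : (fun s => normSq g (c s) - 1) = fun s => (1 + s) ^ 2 - 1 := by
        ext s
        have hu' : g.inner u.1 u.2 u.2 = 1 := hu
        change g.inner u.1 ((1 + s) • u.2) ((1 + s) • u.2) - 1 = _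
        simp only [map_smul, smul_apply, smul_eq_mul, hu']
        ring
      have hd : HasDerivAt (fun s => normSq g (c s) - 1) 2 0 := by
        rw [hval]
        have := (((hasDerivAt_id (0 : ℝ)).const_add 1).pow 2).sub_const 1
        simpa using this
      have := surjective_mfderiv_of_curve (f := fun v => normSq g v - 1) (t := 0)
        (hsm.mdifferentiable (by simp) (c 0)) (hc.mdifferentiable (by simp) 0) two_ne_zero hd
      rwa [hc0] at this
    · intro q _
      rw [mem_unitTangentBundle, sub_eq_zero]

end UnitTangentBundle

/-! ### The geodesic flow of a Zoll manifold and its smoothness. -/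

section Flow

variable {n : ℕ} {Z : Type*} [TopologicalSpace Z] [ChartedSpace (EuclideanSpace ℝ (Fin n)) Z]
  [IsManifold (𝓡 n) ∞ Z] {g : RiemannianMetric n Z}

local notation "E" => EuclideanSpace ℝ (Fin n)

namespace IsZoll

variable (hZ : IsZoll g)

/-- The geodesic with a given unit initial vector. -/
def line (u : unitTangentBundle g) : ℝ → Z := (hZ u u.2).choose

lemma isGeodesicOn_line (u : unitTangentBundle g) : IsGeodesicOn g.form (hZ.line u) univ :=
  (hZ u u.2).choose_spec.1

lemma velocity_line_zero (u : unitTangentBundle g) : velocity (𝓡 n) (hZ.line u) 0 = u :=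
  (hZ u u.2).choose_spec.2.1

lemma periodic_line (u : unitTangentBundle g) :
    Function.Periodic (hZ.line u) (2 * Real.pi) :=
  (hZ u u.2).choose_spec.2.2.1

lemma le_of_periodic (u : unitTangentBundle g) {T : ℝ} (hT : 0 < T)
    (h : Function.Periodic (hZ.line u) T) : 2 * Real.pi ≤ T :=
  (hZ u u.2).choose_spec.2.2.2 T hT h

/-- The geodesic flow on the unit tangent bundle. -/
def flow (t : ℝ) (u : unitTangentBundle g) : unitTangentBundle g :=
  ⟨velocity (𝓡 n) (hZ.line u) t, by
    rw [mem_unitTangentBundle, (hZ.isGeodesicOn_line u).normSq_velocity t 0,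
      hZ.velocity_line_zero]
    exact u.2⟩

lemma coe_flow (t : ℝ) (u : unitTangentBundle g) :
    (hZ.flow t u : TangentBundle (𝓡 n) Z) = velocity (𝓡 n) (hZ.line u) t := rfl

lemma flow_fst (t : ℝ) (u : unitTangentBundle g) : (hZ.flow t u).1.1 = hZ.line u t := rfl

@[simp] lemma flow_zero (u : unitTangentBundle g) : hZ.flow 0 u = u :=
  Subtype.ext (hZ.velocity_line_zero u)

lemma velocity_line_add (u : unitTangentBundle g) (s t : ℝ) :
    velocity (𝓡 n) (fun r => hZ.line u (r + t)) s = velocity (𝓡 n) (hZ.line u) (s + t) := by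
  have h := velocity_comp_mul (hZ.line u) 1 t s
    ((hZ.isGeodesicOn_line u).mdifferentiableAt (mem_univ _))
  simp only [one_mul, one_smul] at h
  refine h.trans ?_
  rw [one_mul]
  rfl

lemma isGeodesicOn_line_add (u : unitTangentBundle g) (t : ℝ) :
    IsGeodesicOn g.form (fun r => hZ.line u (r + t)) univ := by
  have h := (hZ.isGeodesicOn_line u).comp_affine 1 t
  simpa only [one_mul] using h

variable [T2Space Z]

/-- Uniqueness of geodesics, in the form used from here on: compare `γ` with the chosen line of `u`
shifted to pass through `u` at time `t₀`. The group law of the flow is the special case of a shifted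
line. -/
lemma velocity_eq_flow {γ : ℝ → Z} {J : Set ℝ} (hγ : IsGeodesicOn g.form γ J) {t₀ : ℝ}
    (ht₀ : t₀ ∈ J) {u : unitTangentBundle g} (h : velocity (𝓡 n) γ t₀ = u) {t : ℝ} (ht : t ∈ J) :
    velocity (𝓡 n) γ t = hZ.flow (t - t₀) u := by
  have h1 := hγ.velocity_eqOn
    ((hZ.isGeodesicOn_line_add u (-t₀)).mono (subset_univ J) hγ.isOpen hγ.ordConnected
      hγ.nonempty) ht₀ (by rw [velocity_line_add, add_neg_cancel, velocity_line_zero, h])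
  rw [h1 ht, velocity_line_add, coe_flow, sub_eq_add_neg]

lemma flow_add (s t : ℝ) (u : unitTangentBundle g) :
    hZ.flow (s + t) u = hZ.flow s (hZ.flow t u) := by
  refine Subtype.ext ?_
  have h := hZ.velocity_eq_flow (hZ.isGeodesicOn_line_add u t) (mem_univ 0) (u := hZ.flow t u)
    (by rw [velocity_line_add, zero_add, coe_flow]) (mem_univ s)
  rwa [velocity_line_add, sub_zero] at h

lemma line_flow (s t : ℝ) (u : unitTangentBundle g) :
    hZ.line (hZ.flow t u) s = hZ.line u (s + t) := by
  rw [← flow_fst, ← flow_add, flow_fst]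

omit [T2Space Z] in
lemma flow_add_two_pi (t : ℝ) (u : unitTangentBundle g) :
    hZ.flow (t + 2 * Real.pi) u = hZ.flow t u := by
  refine Subtype.ext ?_
  rw [coe_flow, coe_flow, ← velocity_line_add]
  congr 1
  exact funext (hZ.periodic_line u)

omit [T2Space Z] in
lemma flow_add_int_mul_two_pi (t : ℝ) (k : ℤ) (u : unitTangentBundle g) :
    hZ.flow (t + k * (2 * Real.pi)) u = hZ.flow t u := by
  have h : Function.Periodic (fun t => hZ.flow t u) (2 * Real.pi) :=
    fun t => hZ.flow_add_two_pi t u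
  exact h.int_mul k t

/-- The geodesic flow has minimal period `2π` at every point. -/
lemma flow_eq_self_iff (t : ℝ) (u : unitTangentBundle g) :
    hZ.flow t u = u ↔ ∃ k : ℤ, t = k * (2 * Real.pi) := by
  constructor
  · intro h
    have hpi : 0 < 2 * Real.pi := Real.two_pi_pos
    -- Reduce `t` modulo 2π. A remainder strictly between 0 and 2π would be a period below the
    -- minimal one.
    let k : ℤ := ⌊t / (2 * Real.pi)⌋
    let r := t - k * (2 * Real.pi)
    have hr0 : 0 ≤ r := sub_nonneg.2 ((le_div_iff₀ hpi).1 (Int.floor_le _))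
    have hr1 : r < 2 * Real.pi := by
      have := (div_lt_iff₀ hpi).1 (Int.lt_floor_add_one (t / (2 * Real.pi)))
      simp only [r, k]
      linarith
    have hru : hZ.flow r u = u := by
      rw [← hZ.flow_add_int_mul_two_pi r k u, sub_add_cancel, h]
    refine ⟨k, ?_⟩
    rcases hr0.eq_or_lt with h0 | h0
    · exact sub_eq_zero.1 h0.symm
    · have hp : Function.Periodic (hZ.line u) r := fun s => by
        rw [← hZ.line_flow s r u, hru]
      exact absurd (hZ.le_of_periodic u h0 hp) (not_le.2 hr1)
  · rintro ⟨k, rfl⟩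
    have := hZ.flow_add_int_mul_two_pi 0 k u
    rwa [zero_add, flow_zero] at this

omit [T2Space Z] in
lemma continuous_flow_left (u : unitTangentBundle g) : Continuous fun t => hZ.flow t u :=
  Continuous.subtype_mk
    (continuousOn_univ.1 (hZ.isGeodesicOn_line u).continuousOn_velocity) _

/-- In the coordinates of the tangent bundle the geodesic flow is given by a smooth map near time
zero. -/
theorem exists_local_flow (u₀ : unitTangentBundle g) :
    ∃ (Ψ : ℝ × (E × E) → E × E) (W : Set (ℝ × (E × E))), IsOpen W ∧
      (0, tangentCoord (𝓡 n) u₀.1.1 u₀.1) ∈ W ∧ ContDiffOn ℝ ∞ Ψ W ∧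
      (∀ y, (0, y) ∈ W → Ψ (0, y) = geodesicField g u₀.1.1 y) ∧
      ∀ (τ : ℝ) (u : unitTangentBundle g), u.1.1 ∈ (extChartAt (𝓡 n) u₀.1.1).source →
        (τ, tangentCoord (𝓡 n) u₀.1.1 u.1) ∈ W →
        (hZ.flow τ u).1.1 ∈ (extChartAt (𝓡 n) u₀.1.1).source ∧
        tangentCoord (𝓡 n) u₀.1.1 (hZ.flow τ u).1 = tangentCoord (𝓡 n) u₀.1.1 u.1
          + τ • Ψ (τ, tangentCoord (𝓡 n) u₀.1.1 u.1) := by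
  have : IsManifold (𝓡 n) 1 Z := IsManifold.of_le (n := ∞) (by simp)
  have : T2Space (TangentBundle (𝓡 n) Z) := t2Space_tangentBundle
  let x₀ := u₀.1.1
  let T := tangentCoord (𝓡 n) x₀
  let p := T u₀.1
  let X := geodesicField g x₀
  have htar : T.target = (extChartAt (𝓡 n) x₀).target ×ˢ (univ : Set E) := tangentCoord_target x₀
  have hX : ContDiffOn ℝ ∞ X T.target := by
    rw [htar]; exact contDiffOn_geodesicField g x₀
  have hTo : IsOpen T.target := isOpen_tangentCoord_target x₀
  have hp : p ∈ T.target := T.map_source (by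
    rw [tangentCoord_source]; exact mem_extChartAt_source x₀)
  obtain ⟨r, hr, hrT⟩ := Metric.isOpen_iff.1 hTo p hp
  -- The local flow theorem needs a field that is smooth on the whole space. The cutoff equals 1 on
  -- the ball of radius r/4, where the solutions are required to stay, so they solve the original
  -- equation.
  let χ : ContDiffBump p := ⟨r / 4, r / 2, by positivity, by linarith⟩
  let Y : E × E → E × E := fun y => χ y • X y
  have hY : ContDiff ℝ ∞ Y := by
    rw [contDiff_iff_contDiffAt]
    intro y
    by_cases hy : y ∈ Metric.ball p r
    · exact χ.contDiff.contDiffAt.smul (hX.contDiffAt (hTo.mem_nhds (hrT hy)))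
    · have h0 : Y =ᶠ[𝓝 y] fun _ => 0 := by
        have : (tsupport χ)ᶜ ∈ 𝓝 y := by
          refine (isClosed_tsupport _).isOpen_compl.mem_nhds ?_
          rw [χ.tsupport_eq]
          intro h
          refine hy (Metric.closedBall_subset_ball ?_ h)
          change r / 2 < r
          linarith
        filter_upwards [this] with z hz
        simp only [Y]
        rw [image_eq_zero_of_notMem_tsupport hz, zero_smul]
      exact contDiffAt_const.congr_of_eventuallyEq h0
  have hYX : ∀ y ∈ Metric.ball p (r / 4), Y y = X y := by
    intro y hy
    simp only [Y]
    rw [χ.one_of_mem_closedBall (Metric.ball_subset_closedBall hy), one_smul]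
  have hVT : Metric.ball p (r / 4) ⊆ T.target :=
    (Metric.ball_subset_ball (by linarith)).trans hrT
  obtain ⟨Ψ, W, hW, hpW, hΨ, hΨ0, hβ⟩ := exists_smooth_local_flow hY p
    (Metric.ball_mem_nhds p (show 0 < r / 4 by positivity))
  refine ⟨Ψ, W, hW, hpW, hΨ, ?_, ?_⟩
  · intro y hy
    obtain ⟨β, hβ0, -, hβ'⟩ := hβ 0 y hy
    have := (hβ' 0 (by norm_num)).2
    rw [hβ0] at this
    rw [hΨ0 y hy, hYX y this]
  · intro τ u hu huW
    obtain ⟨β, hβ0, hβ1, hβ'⟩ := hβ τ _ huW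
    -- In coordinates `c₁` and `c₂` both solve y' = τX(y). The rescaled parameter reaches flow time
    -- τ at s = 1.
    let c₁ : ℝ → TangentBundle (𝓡 n) Z := fun s => velocity (𝓡 n) (hZ.line u) (τ * s)
    let c₂ : ℝ → TangentBundle (𝓡 n) Z := fun s => T.symm (β s)
    have hvel : Continuous (velocity (𝓡 n) (hZ.line u)) :=
      continuousOn_univ.1 (hZ.isGeodesicOn_line u).continuousOn_velocity
    have hc₁ : Continuous c₁ := hvel.comp (continuous_const.mul continuous_id)
    have hc₂ : ContinuousOn c₂ (Ioo (-2) 2) :=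
      (contMDiffOn_tangentCoord_symm x₀).continuousOn.comp
        (fun s hs => (hβ' s hs).1.continuousAt.continuousWithinAt) fun s hs => hVT (hβ' s hs).2
    have hsrcT : ∀ v : TangentBundle (𝓡 n) Z, v ∈ T.source ↔ v.1 ∈ (extChartAt (𝓡 n) x₀).source :=
      fun v => by rw [tangentCoord_source]; rfl
    have hTs : IsOpen T.source := isOpen_tangentCoord_source x₀
    have heq : EqOn c₁ c₂ (Ioo (-2) 2) := by
      refine eqOn_of_eventuallyEq isOpen_Ioo ordConnected_Ioo hc₁.continuousOn hc₂ ?_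
        (show (0 : ℝ) ∈ Ioo (-2 : ℝ) 2 by norm_num) ?_
      · intro t ht hct
        have hβt := hVT (hβ' t ht).2
        have hc₁t : c₁ t ∈ T.source := by rw [hct]; exact T.map_target hβt
        have hsrc : ∀ᶠ s in 𝓝 t, c₁ s ∈ T.source := hc₁.continuousAt.preimage_mem_nhds
          (hTs.mem_nhds hc₁t)
        have hJ : ∀ᶠ s in 𝓝 t, s ∈ Ioo (-2 : ℝ) 2 := isOpen_Ioo.mem_nhds ht
        have hkey : (fun s => T (c₁ s)) =ᶠ[𝓝 t] β := by
          refine eventuallyEq_of_ode (X := fun y => τ • X y) ?_ ?_ ?_ ?_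
          · have hXt : ContDiffAt ℝ ∞ X (T (c₁ t)) :=
              hX.contDiffAt (hTo.mem_nhds (T.map_source hc₁t))
            have h1 : ContDiffAt ℝ ∞ (fun y => τ • X y) (T (c₁ t)) := hXt.const_smul τ
            exact h1.of_le (by simp)
          · filter_upwards [hsrc] with s hs
            have h1 := (hZ.isGeodesicOn_line u).hasDerivAt_tangentCoord (x₀ := x₀)
              (mem_univ (τ * s)) ((hsrcT _).1 hs)
            have h2 : HasDerivAt (fun s : ℝ => τ * s) τ s := by
              simpa using (hasDerivAt_id s).const_mul τ
            exact h1.scomp s h2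
          · filter_upwards [hJ] with s hs
            have h1 := hβ' s hs
            rw [hYX _ h1.2] at h1
            exact h1.1
          · rw [hct]
            exact T.right_inv hβt
        filter_upwards [hkey, hsrc] with s hs hs'
        change c₁ s = T.symm (β s)
        rw [← hs, T.left_inv hs']
      · change velocity (𝓡 n) (hZ.line u) (τ * 0) = T.symm (β 0)
        rw [mul_zero, velocity_line_zero, hβ0, T.left_inv ((hsrcT _).2 hu)]
    have h1 : c₁ 1 = c₂ 1 := heq (by norm_num)
    have h2 : (hZ.flow τ u).1 = T.symm (β 1) := by
      rw [coe_flow, ← mul_one τ]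
      exact h1
    have hβ1T := hVT (hβ' 1 (by norm_num)).2
    have h3 : (hZ.flow τ u).1 ∈ T.source := by rw [h2]; exact T.map_target hβ1T
    refine ⟨(hsrcT _).1 h3, ?_⟩
    change T (hZ.flow τ u).1 = _
    rw [h2, T.right_inv hβ1T, hβ1]

variable {d : ℕ} [ChartedSpace (EuclideanSpace ℝ (Fin d)) (unitTangentBundle g)]
  [IsManifold (𝓡 d) ∞ (unitTangentBundle g)]
  (hemb : IsSmoothEmbedding (𝓡 d) (𝓡 n).tangent ∞
    (Subtype.val : unitTangentBundle g → TangentBundle (𝓡 n) Z))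

-- The coordinate formula y + τΨ(τ, y) makes the flow smooth as a map to TZ near time zero; the
-- embedding of STZ turns this into smoothness as a map to STZ.
include hemb in
lemma eventually_contMDiffAt_flow_zero (u₀ : unitTangentBundle g) :
    ∀ᶠ p in 𝓝 ((0 : ℝ), u₀), ContMDiffAt (𝓘(ℝ, ℝ).prod (𝓡 d)) (𝓡 d) ∞
      (fun p : ℝ × unitTangentBundle g => hZ.flow p.1 p.2) p := by
  obtain ⟨Ψ, W, hW, hpW, hΨ, -, hflow⟩ := hZ.exists_local_flow u₀
  let x₀ := u₀.1.1
  let T := tangentCoord (𝓡 n) x₀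
  have hsrcT : ∀ v : TangentBundle (𝓡 n) Z, v ∈ T.source ↔ v.1 ∈ (extChartAt (𝓡 n) x₀).source :=
    fun v => by rw [tangentCoord_source]; rfl
  have hTs : IsOpen T.source := isOpen_tangentCoord_source x₀
  let S : Set (ℝ × unitTangentBundle g) := {p | p.2.1 ∈ T.source}
  have hS : IsOpen S := hTs.preimage (continuous_subtype_val.comp continuous_snd)
  let y : ℝ × unitTangentBundle g → ℝ × (E × E) := fun p => (p.1, T p.2.1)
  have hy : ContMDiffOn (𝓘(ℝ, ℝ).prod (𝓡 d)) 𝓘(ℝ, ℝ × (E × E)) ∞ y S := by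
    refine contMDiffOn_fst.prodMk_space ?_
    exact (contMDiffOn_tangentCoord x₀).comp
      (hemb.contMDiff.comp contMDiff_snd).contMDiffOn fun p hp => hp
  have hopen : IsOpen (S ∩ y ⁻¹' W) := hy.continuousOn.isOpen_inter_preimage hS hW
  have hmem : ((0 : ℝ), u₀) ∈ S ∩ y ⁻¹' W := ⟨(hsrcT _).2 (mem_extChartAt_source x₀), hpW⟩
  filter_upwards [hopen.mem_nhds hmem] with p hp
  refine IsSmoothEmbedding.contMDiffAt_of_comp hemb ?_
  let F : ℝ × (E × E) → E × E := fun z => z.2 + z.1 • Ψ z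
  have hF : ContDiffOn ℝ ∞ F W := contDiff_snd.contDiffOn.add (contDiff_fst.contDiffOn.smul hΨ)
  have hFp : F (y p) ∈ T.target := by
    have h := hflow p.1 p.2 ((hsrcT _).1 hp.1) hp.2
    change T p.2.1 + p.1 • Ψ (p.1, T p.2.1) ∈ T.target
    rw [← h.2]
    exact T.map_source ((hsrcT _).2 h.1)
  have h1 : ContMDiffAt (𝓘(ℝ, ℝ).prod (𝓡 d)) 𝓘(ℝ, E × E) ∞ (fun q => F (y q)) p :=
    (hF.contMDiffOn.contMDiffAt (hW.mem_nhds hp.2)).comp p (hy.contMDiffAt (hS.mem_nhds hp.1))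
  have h2 : ContMDiffAt (𝓘(ℝ, ℝ).prod (𝓡 d)) (𝓡 n).tangent ∞ (fun q => T.symm (F (y q))) p :=
    ContMDiffAt.comp (g := T.symm) p ((contMDiffOn_tangentCoord_symm x₀).contMDiffAt
      ((isOpen_tangentCoord_target x₀).mem_nhds hFp)) h1
  refine h2.congr_of_eventuallyEq ?_
  filter_upwards [hopen.mem_nhds hp] with q hq
  have h := hflow q.1 q.2 ((hsrcT _).1 hq.1) hq.2
  change (hZ.flow q.1 q.2).1 = T.symm (T q.2.1 + q.1 • Ψ (q.1, T q.2.1))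
  rw [← h.2]
  exact (T.left_inv ((hsrcT _).2 h.1)).symm

include hemb in
/-- The geodesic flow on the unit tangent bundle is smooth. -/
theorem contMDiff_flow : ContMDiff (𝓘(ℝ, ℝ).prod (𝓡 d)) (𝓡 d) ∞
    (fun p : ℝ × unitTangentBundle g => hZ.flow p.1 p.2) := by
  rintro ⟨t₀, u₀⟩
  -- Goodness of a time is open by definition. It is closed as well: near a limit t of good times
  -- choose a good s so close that flow through t - s is smooth near the flow of u₀ to time s, and
  -- write flow_p as flow_{p-s} after flow_s. Connectedness of the line extends smoothness from time
  -- zero to all times.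
  let Good : ℝ → Prop := fun t => ∀ᶠ p in 𝓝 (t, u₀),
    ContMDiffAt (𝓘(ℝ, ℝ).prod (𝓡 d)) (𝓡 d) ∞
      (fun p : ℝ × unitTangentBundle g => hZ.flow p.1 p.2) p
  have hopen : IsOpen {t | Good t} := by
    have : Continuous fun t : ℝ => (t, u₀) := by fun_prop
    exact (isOpen_setOfPred_eventually_nhds (X := ℝ × unitTangentBundle g)).preimage this
  have hclosed : IsClosed {t | Good t} := by
    rw [← closure_subset_iff_isClosed]
    intro t ht
    have hloc := hZ.eventually_contMDiffAt_flow_zero hemb (hZ.flow t u₀)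
    have hcont : ContinuousAt (fun s : ℝ => (t - s, hZ.flow s u₀)) t :=
      (continuousAt_const.sub continuousAt_id).prodMk (hZ.continuous_flow_left u₀).continuousAt
    have hev : ∀ᶠ s in 𝓝 t, ∀ᶠ p in 𝓝 (t - s, hZ.flow s u₀),
        ContMDiffAt (𝓘(ℝ, ℝ).prod (𝓡 d)) (𝓡 d) ∞
          (fun p : ℝ × unitTangentBundle g => hZ.flow p.1 p.2) p := by
      refine Filter.Tendsto.eventually (p := fun z => ∀ᶠ p in 𝓝 z,
        ContMDiffAt (𝓘(ℝ, ℝ).prod (𝓡 d)) (𝓡 d) ∞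
          (fun p : ℝ × unitTangentBundle g => hZ.flow p.1 p.2) p) hcont ?_
      beta_reduce
      rw [sub_self]
      exact hloc.eventually_nhds
    obtain ⟨s, hs, hsG⟩ := mem_closure_iff_nhds.1 ht _ hev
    have hs' : ∀ᶠ p in 𝓝 (t - s, hZ.flow s u₀), ContMDiffAt (𝓘(ℝ, ℝ).prod (𝓡 d)) (𝓡 d) ∞
        (fun p : ℝ × unitTangentBundle g => hZ.flow p.1 p.2) p := hs
    have hsG' : Good s := hsG
    let σ : ℝ × unitTangentBundle g → ℝ × unitTangentBundle g := fun p => (s, p.2)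
    let ρ : ℝ × unitTangentBundle g → ℝ × unitTangentBundle g :=
      fun p => (p.1 - s, hZ.flow s p.2)
    have hσ : ContMDiff (𝓘(ℝ, ℝ).prod (𝓡 d)) (𝓘(ℝ, ℝ).prod (𝓡 d)) ∞ σ :=
      contMDiff_const.prodMk contMDiff_snd
    have hσev : ∀ᶠ p in 𝓝 (t, u₀), ContMDiffAt (𝓘(ℝ, ℝ).prod (𝓡 d)) (𝓡 d) ∞
        (fun p : ℝ × unitTangentBundle g => hZ.flow s p.2) p := by
      have h1 : ∀ᶠ p in 𝓝 (t, u₀), ContMDiffAt (𝓘(ℝ, ℝ).prod (𝓡 d)) (𝓡 d) ∞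
          (fun p : ℝ × unitTangentBundle g => hZ.flow p.1 p.2) (σ p) :=
        hσ.continuous.continuousAt (x := (t, u₀)) |>.eventually hsG'
      filter_upwards [h1] with p hp
      exact ContMDiffAt.comp (f := σ) p hp (hσ p)
    have hρt : ContinuousAt ρ (t, u₀) :=
      (continuousAt_fst.sub continuousAt_const).prodMk hσev.self_of_nhds.continuousAt
    have hρev : ∀ᶠ p in 𝓝 (t, u₀), ContMDiffAt (𝓘(ℝ, ℝ).prod (𝓡 d)) (𝓡 d) ∞
        (fun p : ℝ × unitTangentBundle g => hZ.flow p.1 p.2) (ρ p) := hρt.eventually hs'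
    change Good t
    filter_upwards [hσev, hρev] with p hp hp'
    have hρp : ContMDiffAt (𝓘(ℝ, ℝ).prod (𝓡 d)) (𝓘(ℝ, ℝ).prod (𝓡 d)) ∞ ρ p :=
      (contMDiffAt_fst.sub contMDiffAt_const).prodMk hp
    refine (ContMDiffAt.comp (f := ρ) p hp' hρp).congr_of_eventuallyEq (.of_forall fun q => ?_)
    change hZ.flow q.1 q.2 = hZ.flow (q.1 - s) (hZ.flow s q.2)
    rw [← flow_add, sub_add_cancel]
  have huniv : {t | Good t} = univ := IsClopen.eq_univ ⟨hclosed, hopen⟩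
    ⟨0, hZ.eventually_contMDiffAt_flow_zero hemb u₀⟩
  have : Good t₀ := by
    have h : t₀ ∈ {t | Good t} := by rw [huniv]; trivial
    exact h
  exact this.self_of_nhds

include hemb in
lemma contMDiff_flow_right (t : ℝ) : ContMDiff (𝓡 d) (𝓡 d) ∞ (hZ.flow t) :=
  (hZ.contMDiff_flow hemb).comp (contMDiff_const.prodMk contMDiff_id)

end IsZoll

end Flow

/-! ### Tangent vectors as velocities of curves. -/

section Curves

variable {E : Type*} [NormedAddCommGroup E] [NormedSpace ℝ E]
  {H : Type*} [TopologicalSpace H] {I : ModelWithCorners ℝ E H}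
  {M : Type*} [TopologicalSpace M] [ChartedSpace H M]

/-- Every tangent vector is the velocity of a curve. -/
lemma exists_velocity_eq [I.Boundaryless] [IsManifold I ∞ M] (v : TangentBundle I M) :
    ∃ w : ℝ → M, ContMDiffAt 𝓘(ℝ, ℝ) I ∞ w 0 ∧ velocity I w 0 = v := by
  let φ := extChartAt I v.1
  let T := tangentCoord I v.1
  have hv : v ∈ T.source := by
    rw [tangentCoord_source]; exact mem_extChartAt_source v.1
  have hφ : φ v.1 ∈ φ.target := mem_extChartAt_target v.1
  let y : ℝ → E := fun s => φ v.1 + s • (T v).2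
  have hy0 : y 0 = φ v.1 := by simp [y]
  have hyd : HasDerivAt y (T v).2 0 := by
    have := ((hasDerivAt_id (0 : ℝ)).smul_const (T v).2).const_add (φ v.1)
    rwa [one_smul] at this
  have hys : ContMDiff 𝓘(ℝ, ℝ) 𝓘(ℝ, E) ∞ y :=
    (contDiff_const.add (contDiff_id.smul contDiff_const)).contMDiff
  have hφs : ContMDiffAt 𝓘(ℝ, E) I ∞ φ.symm (y 0) := by
    rw [hy0]
    exact (contMDiffOn_extChartAt_symm v.1).contMDiffAt ((isOpen_extChartAt_target v.1).mem_nhds hφ)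
  refine ⟨fun s => φ.symm (y s), ContMDiffAt.comp (g := φ.symm) (f := y) 0 hφs (hys 0), ?_⟩
  have h1 := velocity_comp (f := φ.symm) (γ := y) (t := 0) (hφs.mdifferentiableAt (by simp))
    ((hys 0).mdifferentiableAt (by simp))
  rw [velocity_eq_deriv, hyd.deriv] at h1
  refine h1.trans ?_
  have h2 : T v = (φ v.1, (T v).2) := by
    have h3 : (T v).1 = φ v.1 :=
      congrArg Prod.fst (tangentCoord_apply (I := I) (mem_extChartAt_source v.1))
    exact Prod.ext h3 rfl
  rw [hy0]
  have h3 := tangentCoord_symm_apply (I := I) hφ (T v).2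
  rw [← h2, T.left_inv hv] at h3
  exact h3.symm

lemma velocity_comp_eq_tangentMap {E' : Type*} [NormedAddCommGroup E'] [NormedSpace ℝ E']
    {H' : Type*} [TopologicalSpace H'] {I' : ModelWithCorners ℝ E' H'}
    {N : Type*} [TopologicalSpace N] [ChartedSpace H' N] {f : M → N} {γ : ℝ → M} {t : ℝ}
    (hf : MDifferentiableAt I I' f (γ t)) (hγ : MDifferentiableAt 𝓘(ℝ, ℝ) I γ t) :
    velocity I' (fun s => f (γ s)) t = tangentMap I I' f (velocity I γ t) :=
  velocity_comp hf hγ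

lemma velocity_const (x : M) (t : ℝ) :
    velocity I (fun _ => x) t = ⟨x, (0 : TangentSpace I x)⟩ := by
  rw [velocity, mfderiv_const]
  rfl

/-- If a curve returns to the same point arbitrarily shortly, its velocity vanishes. -/
lemma velocity_eq_zero_of_frequently [I.Boundaryless] [IsManifold I ∞ M] [T2Space M]
    {γ : ℝ → M} {t : ℝ} {z : M}
    (hγ : MDifferentiableAt 𝓘(ℝ, ℝ) I γ t) (h : ∃ᶠ s in 𝓝[≠] t, γ s = z) :
    velocity I γ t = ⟨z, (0 : TangentSpace I z)⟩ := by
  have hz : γ t = z := by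
    by_contra hne
    have h1 : ∀ᶠ s in 𝓝[≠] t, γ s ≠ z :=
      (hγ.continuousAt.mono_left nhdsWithin_le_nhds).eventually_ne hne
    exact h (h1.mono fun s hs => hs)
  subst hz
  have hsrc : γ t ∈ (extChartAt I (γ t)).source := mem_extChartAt_source (γ t)
  let T := tangentCoord I (γ t)
  have h1 := tangentCoord_velocity hγ hsrc
  have h2 := tangentCoord_velocity (I := I) (γ := fun _ : ℝ => γ t) (t := t)
    mdifferentiableAt_const hsrc
  let x : ℝ → E := fun s => extChartAt I (γ t) (γ s)
  have hx : DifferentiableAt ℝ x t := by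
    rw [← mdifferentiableAt_iff_differentiableAt]
    have h3 : MDifferentiableAt I 𝓘(ℝ, E) (extChartAt I (γ t)) (γ t) :=
      mdifferentiableAt_extChartAt (by rwa [extChartAt_source] at hsrc)
    exact MDifferentiableAt.comp t h3 hγ
  have hd : deriv x t = 0 := by
    by_contra hne
    have h4 := hx.hasDerivAt.eventually_ne (c := x t) hne
    exact h (h4.mono fun s hs hs' => hs (by simp only [x, hs']))
  have h5 : T (velocity I γ t) = T (velocity I (fun _ : ℝ => γ t) t) := by
    rw [h1, h2, show deriv (fun s => extChartAt I (γ t) (γ s)) t = 0 from hd, deriv_const]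
  have h6 := T.injOn (by rw [tangentCoord_source]; exact hsrc)
    (by rw [tangentCoord_source]; exact hsrc) h5
  rw [h6, velocity_const]

/-- Otherwise each of the finitely many curves avoids `z` on a punctured neighbourhood of `t`, and
these neighbourhoods have a common point. Which curve is at `z` may change with the parameter; this
is what happens along a curve in a sky with several branches. -/
lemma exists_velocity_eq_zero [I.Boundaryless] [IsManifold I ∞ M] [T2Space M] {ι : Type*} [Finite ι]
    {γ : ι → ℝ → M} {t : ℝ} {z : M} (hγ : ∀ i, MDifferentiableAt 𝓘(ℝ, ℝ) I (γ i) t)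
    (h : ∀ᶠ s in 𝓝 t, ∃ i, γ i s = z) :
    ∃ i, velocity I (γ i) t = ⟨z, (0 : TangentSpace I z)⟩ := by
  by_contra! hne
  have h1 : ∀ i, ∀ᶠ s in 𝓝[≠] t, γ i s ≠ z := fun i => by
    by_contra h2
    exact hne i (velocity_eq_zero_of_frequently (hγ i) (by
      rw [Filter.Frequently]; exact h2))
  obtain ⟨s, hs, i, hi⟩ :=
    ((Filter.eventually_all.2 h1).and (h.filter_mono nhdsWithin_le_nhds)).exists
  exact hs i hi

end Curves

/-! ### The first variation formula in coordinates. -/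

section Flow

variable {n : ℕ} {Z : Type*} [TopologicalSpace Z] [ChartedSpace (EuclideanSpace ℝ (Fin n)) Z]
  [IsManifold (𝓡 n) ∞ Z] {g : RiemannianMetric n Z}

local notation "E" => EuclideanSpace ℝ (Fin n)

/-- The metric in terms of its coordinate expression. -/
lemma inner_eq_gram {x₀ z : Z} (hz : z ∈ (extChartAt (𝓡 n) x₀).source)
    (a b : TangentSpace (𝓡 n) z) :
    g.inner z a b = gram g x₀ (extChartAt (𝓡 n) x₀ z) (tangentCoord (𝓡 n) x₀ ⟨z, a⟩).2
      (tangentCoord (𝓡 n) x₀ ⟨z, b⟩).2 := by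
  let T := tangentCoord (𝓡 n) x₀
  let L : E →L[ℝ] E := mfderiv (𝓡 n) 𝓘(ℝ, E) (extChartAt (𝓡 n) x₀) z
  have hT : ∀ w : TangentSpace (𝓡 n) z, T ⟨z, w⟩ = (extChartAt (𝓡 n) x₀ z, L w) := fun w =>
    tangentCoord_apply (I := 𝓡 n) (x₀ := x₀) (v := ⟨z, w⟩) hz
  let y := extChartAt (𝓡 n) x₀ z
  have hy : y ∈ (extChartAt (𝓡 n) x₀).target := (extChartAt (𝓡 n) x₀).map_source hz
  let B : E →L[ℝ] E →L[ℝ] ℝ := g.inner z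
  have hQ : ∀ w : E, B w w = gram g x₀ y (L w) (L w) := fun w => by
    rw [gram_self g hy, ← hT w, T.left_inv (by rw [tangentCoord_source]; exact hz)]
    rfl
  have hs : ∀ v w : E, B v w = B w v := fun v w => g.symm z v w
  change B a b = gram g x₀ y (T ⟨z, a⟩).2 (T ⟨z, b⟩).2
  rw [hT, hT]
  change B a b = gram g x₀ y (L a) (L b)
  -- Polarization: the two bilinear forms agree because their quadratic forms do.
  have key : ∀ a b : E, B (a + b) (a + b) = B a a + B b b + 2 * B a b := fun a b => by
    simp only [map_add, add_apply, hs b a]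
    ring
  have key' : ∀ a b : E, B a b = gram g x₀ y (L a) (L b) := fun a b => by
    have h1 := key a b
    rw [hQ, hQ, hQ, map_add, map_add, map_add, add_apply, add_apply,
      gram_symm g x₀ y (L b) (L a)] at h1
    linarith
  exact key' a b

/-- The coordinate form of the first variation of arc length: along a one-parameter family of
unit speed geodesics, the inner product of the velocity and of the variation field is
constant. -/
lemma hasDerivAt_gram_variation {x₀ : Z} {F : ℝ × ℝ → E × E} {t₀ : ℝ}
    (hF : ContDiffAt ℝ ∞ F (t₀, 0)) (hmem : (F (t₀, 0)).1 ∈ (extChartAt (𝓡 n) x₀).target)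
    (hode : ∀ᶠ p in 𝓝 (t₀, (0 : ℝ)),
      HasDerivAt (fun t => F (t, p.2)) (geodesicField g x₀ (F p)) p.1)
    (hunit : ∀ᶠ p in 𝓝 (t₀, (0 : ℝ)), gram g x₀ (F p).1 (F p).2 (F p).2 = 1) :
    HasDerivAt (fun t => gram g x₀ (F (t, 0)).1 (F (t, 0)).2 (deriv (fun s => (F (t, s)).1) 0))
      0 t₀ := by
  let p₀ : ℝ × ℝ := (t₀, 0)
  let D := fderiv ℝ F
  have hDs : ContDiffAt ℝ ∞ D p₀ := hF.fderiv_right (by simp)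
  have hDd : HasFDerivAt D (fderiv ℝ D p₀) p₀ := (hDs.differentiableAt (by simp)).hasFDerivAt
  have hdiff : ∀ᶠ p in 𝓝 p₀, DifferentiableAt ℝ F p :=
    ((hF.of_le (by simp : (1 : WithTop ℕ∞) ≤ ∞)).eventually (by simp)).mono
      fun p hp => hp.differentiableAt (by simp)
  have hl₁ : ∀ p : ℝ × ℝ, HasDerivAt (fun t : ℝ => (t, p.2)) ((1 : ℝ), (0 : ℝ)) p.1 := fun p =>
    (hasDerivAt_id p.1).prodMk (hasDerivAt_const p.1 p.2)
  have hl₂ : ∀ p : ℝ × ℝ, HasDerivAt (fun s : ℝ => (p.1, s)) ((0 : ℝ), (1 : ℝ)) p.2 := fun p =>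
    (hasDerivAt_const p.2 p.1).prodMk (hasDerivAt_id p.2)
  have hDt : ∀ᶠ p in 𝓝 p₀, D p (1, 0) = geodesicField g x₀ (F p) := by
    filter_upwards [hdiff, hode] with p hp hp'
    have h1 := HasFDerivAt.comp_hasDerivAt (l := F) (f := fun t : ℝ => (t, p.2)) p.1
      (show HasFDerivAt F (D p) (p.1, p.2) from hp.hasFDerivAt) (hl₁ p)
    exact h1.unique hp'
  have hDs' : ∀ᶠ p in 𝓝 p₀, HasDerivAt (fun s => F (p.1, s)) (D p (0, 1)) p.2 := by
    filter_upwards [hdiff] with p hp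
    exact HasFDerivAt.comp_hasDerivAt (l := F) (f := fun s : ℝ => (p.1, s)) p.2
      (show HasFDerivAt F (D p) (p.1, p.2) from hp.hasFDerivAt) (hl₂ p)
  set x := (F p₀).1
  set v := (F p₀).2
  set ξ := (D p₀ (0, 1)).1
  set η := (D p₀ (0, 1)).2
  set a := (geodesicField g x₀ (F p₀)).2
  have hgeo : geodesicField g x₀ (F p₀) = (v, a) := rfl
  have hG : HasFDerivAt (gram g x₀) (fderiv ℝ (gram g x₀) x) x :=
    (differentiableAt_gram g hmem).hasFDerivAt
  have hl₁0 : HasDerivAt (fun t : ℝ => (t, (0 : ℝ))) ((1 : ℝ), (0 : ℝ)) t₀ := hl₁ p₀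
  have hl₂0 : HasDerivAt (fun s : ℝ => (t₀, s)) ((0 : ℝ), (1 : ℝ)) 0 := hl₂ p₀
  have ht : HasDerivAt (fun t => F (t, 0)) (v, a) t₀ := hode.self_of_nhds
  have hs : HasDerivAt (fun s => F (t₀, s)) (ξ, η) 0 := hDs'.self_of_nhds
  -- Mixed second derivatives commute, so the time derivative of the variation field ξ of the base
  -- point is the variation η of the velocity.
  have hJ : HasDerivAt (fun t => (D (t, 0) (0, 1)).1) η t₀ := by
    have h1 : HasDerivAt (fun t => D (t, 0)) (fderiv ℝ D p₀ (1, 0)) t₀ :=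
      HasFDerivAt.comp_hasDerivAt (l := D) (f := fun t : ℝ => (t, (0 : ℝ))) t₀ hDd hl₁0
    have h2 : HasDerivAt (fun t => D (t, 0) (0, 1)) (fderiv ℝ D p₀ (1, 0) (0, 1)) t₀ := by
      simpa using h1.clm_apply (hasDerivAt_const t₀ ((0 : ℝ), (1 : ℝ)))
    have hsymm : fderiv ℝ D p₀ (1, 0) (0, 1) = fderiv ℝ D p₀ (0, 1) (1, 0) :=
      (hF.isSymmSndFDerivAt (by
        rw [minSmoothness_of_isRCLikeNormedField]
        exact WithTop.coe_le_coe.2 (le_top : (2 : ℕ∞) ≤ ⊤))) (1, 0) (0, 1)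
    have h3 : HasDerivAt (fun s => D (t₀, s)) (fderiv ℝ D p₀ (0, 1)) 0 :=
      HasFDerivAt.comp_hasDerivAt (l := D) (f := fun s : ℝ => (t₀, s)) 0 hDd hl₂0
    have h4 : HasDerivAt (fun s => D (t₀, s) (1, 0)) (fderiv ℝ D p₀ (0, 1) (1, 0)) 0 := by
      simpa using h3.clm_apply (hasDerivAt_const 0 ((1 : ℝ), (0 : ℝ)))
    have h5 : (fun s => (D (t₀, s) (1, 0)).1) =ᶠ[𝓝 0] fun s => (F (t₀, s)).2 := by
      have hc : Filter.Tendsto (fun s : ℝ => (t₀, s)) (𝓝 0) (𝓝 p₀) := hl₂0.continuousAt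
      filter_upwards [hc.eventually hDt] with s hs
      rw [hs]
      rfl
    have h6 : (fderiv ℝ D p₀ (0, 1) (1, 0)).1 = η :=
      (hasFDerivAt_fst.comp_hasDerivAt 0 h4).unique
        ((hasFDerivAt_snd.comp_hasDerivAt 0 hs).congr_of_eventuallyEq h5)
    have h7 := hasFDerivAt_fst (𝕜 := ℝ) (p := D (t₀, 0) (0, 1)) |>.comp_hasDerivAt t₀ h2
    rw [hsymm] at h7
    rw [← h6]
    exact h7
  have hder : ∀ᶠ t in 𝓝 t₀, deriv (fun s => (F (t, s)).1) 0 = (D (t, 0) (0, 1)).1 := by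
    have hc : Filter.Tendsto (fun t : ℝ => (t, (0 : ℝ))) (𝓝 t₀) (𝓝 p₀) := hl₁0.continuousAt
    filter_upwards [hc.eventually hDs'] with t ht
    exact (hasFDerivAt_fst.comp_hasDerivAt 0 ht).deriv
  have hx_t : HasDerivAt (fun t => (F (t, 0)).1) v t₀ :=
    (ContinuousLinearMap.fst ℝ E E).hasFDerivAt.comp_hasDerivAt t₀ ht
  have hv_t : HasDerivAt (fun t => (F (t, 0)).2) a t₀ :=
    (ContinuousLinearMap.snd ℝ E E).hasFDerivAt.comp_hasDerivAt t₀ ht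
  have hx_s : HasDerivAt (fun s => (F (t₀, s)).1) ξ 0 :=
    (ContinuousLinearMap.fst ℝ E E).hasFDerivAt.comp_hasDerivAt 0 hs
  have hv_s : HasDerivAt (fun s => (F (t₀, s)).2) η 0 :=
    (ContinuousLinearMap.snd ℝ E E).hasFDerivAt.comp_hasDerivAt 0 hs
  have hGt : HasDerivAt (fun t => gram g x₀ (F (t, 0)).1) (fderiv ℝ (gram g x₀) x v) t₀ :=
    HasFDerivAt.comp_hasDerivAt (l := gram g x₀) (f := fun t => (F (t, 0)).1) t₀ hG hx_t
  have hGs : HasDerivAt (fun s => gram g x₀ (F (t₀, s)).1) (fderiv ℝ (gram g x₀) x ξ) 0 :=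
    HasFDerivAt.comp_hasDerivAt (l := gram g x₀) (f := fun s => (F (t₀, s)).1) 0 hG hx_s
  have h1 := (hGt.clm_apply hv_t).clm_apply hJ
  have h2 := (hGs.clm_apply hv_s).clm_apply hv_s
  have h3 : HasDerivAt (fun s => gram g x₀ (F (t₀, s)).1 (F (t₀, s)).2 (F (t₀, s)).2) 0 0 := by
    refine (hasDerivAt_const (0 : ℝ) (1 : ℝ)).congr_of_eventuallyEq ?_
    have hc : Filter.Tendsto (fun s : ℝ => (t₀, s)) (𝓝 0) (𝓝 p₀) := hl₂0.continuousAt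
    exact hc.eventually hunit
  have h4 := h2.unique h3
  -- The geodesic equation paired with ξ gives G(a, ξ) + ∂_v G(v, ξ) = ½ ∂_ξ G(v, v). Varying the
  -- unit speed condition in `h4` gives ∂_ξ G(v, v) + 2G(v, η) = 0. Together they cancel the
  -- derivative of G(v, ξ).
  have h5 := gram_geodesicField g hmem v ξ
  rw [christoffelForm_apply] at h5
  refine HasDerivAt.congr_of_eventuallyEq (f := fun t => gram g x₀ (F (t, 0)).1 (F (t, 0)).2
    (D (t, 0) (0, 1)).1) ?_ (hder.mono fun t ht => by simp only [ht])
  refine h1.congr_deriv ?_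
  have h6 : fderiv ℝ (gram g x₀) x ξ v v + gram g x₀ x η v + gram g x₀ x v η = 0 := by
    simpa [add_apply] using h4
  have h7 : gram g x₀ x η v = gram g x₀ x v η := gram_symm g x₀ x η v
  have h8 : gram g x₀ x a ξ + (fderiv ℝ (gram g x₀) x v v ξ
    - (2 : ℝ)⁻¹ * fderiv ℝ (gram g x₀) x ξ v v) = 0 := h5
  change (fderiv ℝ (gram g x₀) x v v + gram g x₀ x a) ξ + gram g x₀ x v η = 0
  rw [add_apply]
  linarith

end Flow

/-! ### Invariance of the contact form; absence of conjugate points at short distance. -/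

section Contact

variable {n : ℕ} {Z : Type*} [TopologicalSpace Z] [ChartedSpace (EuclideanSpace ℝ (Fin n)) Z]
  [IsManifold (𝓡 n) ∞ Z] (g : RiemannianMetric n Z)
  {d : ℕ} [ChartedSpace (EuclideanSpace ℝ (Fin d)) (unitTangentBundle g)]

local notation "E" => EuclideanSpace ℝ (Fin n)

/-- The projection of the unit tangent bundle. -/
def basePoint (u : unitTangentBundle g) : Z := u.1.1

/-- The canonical contact form `ξ ↦ g(u, dπ ξ)` of the unit tangent bundle, as a function on its
tangent bundle. -/
def contactForm (ξ : TangentBundle (𝓡 d) (unitTangentBundle g)) : ℝ :=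
  g.inner ξ.1.1.1 ξ.1.1.2 (mfderiv (𝓡 d) (𝓡 n) (basePoint g) ξ.1 ξ.2)

lemma mem_canonicalContact {u : unitTangentBundle g} {ξ : TangentSpace (𝓡 d) u} :
    ξ ∈ canonicalContact g u ↔ contactForm g ⟨u, ξ⟩ = 0 := Iff.rfl

variable {g} [IsManifold (𝓡 d) ∞ (unitTangentBundle g)]
  (hemb : IsSmoothEmbedding (𝓡 d) (𝓡 n).tangent ∞
    (Subtype.val : unitTangentBundle g → TangentBundle (𝓡 n) Z))

include hemb in
omit [IsManifold (𝓡 d) ∞ (unitTangentBundle g)] in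
lemma contMDiff_basePoint : ContMDiff (𝓡 d) (𝓡 n) ∞ (basePoint g) :=
  (contMDiff_proj (TangentSpace (𝓡 n) : Z → Type _)).comp hemb.contMDiff

include hemb in
omit [IsManifold (𝓡 d) ∞ (unitTangentBundle g)] in
/-- The contact form on the velocity of a curve, in coordinates. -/
lemma contactForm_velocity {c : ℝ → unitTangentBundle g} {s : ℝ}
    (hc : MDifferentiableAt 𝓘(ℝ, ℝ) (𝓡 d) c s) {x₀ : Z}
    (hx : (c s).1.1 ∈ (extChartAt (𝓡 n) x₀).source) :
    contactForm g (velocity (𝓡 d) c s)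
      = gram g x₀ (tangentCoord (𝓡 n) x₀ (c s).1).1 (tangentCoord (𝓡 n) x₀ (c s).1).2
        (deriv (fun r => (tangentCoord (𝓡 n) x₀ (c r).1).1) s) := by
  let T := tangentCoord (𝓡 n) x₀
  have hπ : MDifferentiableAt (𝓡 d) (𝓡 n) (basePoint g) (c s) :=
    (contMDiff_basePoint hemb).mdifferentiable (by simp) (c s)
  have h1 : velocity (𝓡 n) (fun r => (c r).1.1) s
      = ⟨(c s).1.1, mfderiv (𝓡 d) (𝓡 n) (basePoint g) (c s) (velocity (𝓡 d) c s).2⟩ :=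
    velocity_comp_eq_tangentMap (f := basePoint g) hπ hc
  have hπc : MDifferentiableAt 𝓘(ℝ, ℝ) (𝓡 n) (fun r => (c r).1.1) s :=
    MDifferentiableAt.comp (g := basePoint g) s hπ hc
  have h2 := tangentCoord_velocity hπc hx
  have hT1 : ∀ v : TangentBundle (𝓡 n) Z, v.1 ∈ (extChartAt (𝓡 n) x₀).source →
      (T v).1 = extChartAt (𝓡 n) x₀ v.1 := fun v hv =>
    congrArg Prod.fst (tangentCoord_apply (I := 𝓡 n) hv)
  have h3 : (fun r => (T (c r).1).1) =ᶠ[𝓝 s] fun r => extChartAt (𝓡 n) x₀ (c r).1.1 := by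
    filter_upwards [hπc.continuousAt.preimage_mem_nhds
      ((isOpen_extChartAt_source x₀).mem_nhds hx)] with r hr
    exact hT1 _ hr
  have h4 := inner_eq_gram (g := g) hx (c s).1.2
    (mfderiv (𝓡 d) (𝓡 n) (basePoint g) (c s) (velocity (𝓡 d) c s).2)
  refine h4.trans ?_
  have h5 := congrArg (fun v => (T v).2) h1
  rw [hT1 _ hx, h3.deriv_eq]
  refine congrArg (gram g x₀ (extChartAt (𝓡 n) x₀ (c s).1.1) (T (c s).1).2) ?_
  refine h5.symm.trans ?_
  exact congrArg Prod.snd h2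

namespace IsZoll

variable (hZ : IsZoll g) [T2Space Z]

include hemb in
/-- The geodesic flow preserves the contact form. -/
theorem contactForm_tangentMap_flow (t : ℝ) (ξ : TangentBundle (𝓡 d) (unitTangentBundle g)) :
    contactForm g (tangentMap (𝓡 d) (𝓡 d) (hZ.flow t) ξ) = contactForm g ξ := by
  obtain ⟨w, hw, hwξ⟩ := exists_velocity_eq ξ
  have hwd : MDifferentiableAt 𝓘(ℝ, ℝ) (𝓡 d) w 0 := hw.mdifferentiableAt (by simp)
  have hfl := hZ.contMDiff_flow hemb
  -- Represent ξ by a curve `w` and let it flow. The contact form on the transported vector is the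
  -- inner product in the first variation formula, hence constant in time.
  let Γ : ℝ × ℝ → unitTangentBundle g := fun p => hZ.flow p.1 (w p.2)
  have hΓ : ∀ t, ContMDiffAt 𝓘(ℝ, ℝ × ℝ) (𝓡 d) ∞ Γ (t, 0) := by
    intro t
    have h1 : ContMDiffAt 𝓘(ℝ, ℝ × ℝ) (𝓘(ℝ, ℝ).prod (𝓡 d)) ∞
        (fun p : ℝ × ℝ => (p.1, w p.2)) (t, 0) := by
      refine ContMDiffAt.prodMk contDiff_fst.contMDiff.contMDiffAt ?_
      exact ContMDiffAt.comp (g := w) (f := fun p : ℝ × ℝ => p.2) (t, (0 : ℝ)) hw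
        contDiff_snd.contMDiff.contMDiffAt
    exact ContMDiffAt.comp (g := fun p : ℝ × unitTangentBundle g => hZ.flow p.1 p.2)
      (f := fun p : ℝ × ℝ => (p.1, w p.2)) (t, (0 : ℝ)) (hfl _) h1
  let A : ℝ → ℝ := fun t => contactForm g (velocity (𝓡 d) (fun s => hZ.flow t (w s)) 0)
  have hA : ∀ t, A t = contactForm g (tangentMap (𝓡 d) (𝓡 d) (hZ.flow t) ξ) := by
    intro t
    simp only [A]
    rw [velocity_comp_eq_tangentMap (f := hZ.flow t)
      ((hZ.contMDiff_flow_right hemb t).mdifferentiable (by simp) (w 0)) hwd, hwξ]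
  suffices hd : ∀ t, HasDerivAt A 0 t by
    have h1 := is_const_of_deriv_eq_zero (fun t => (hd t).differentiableAt)
      (fun t => (hd t).deriv) t 0
    rw [← hA, h1]
    simp only [A, flow_zero]
    rw [hwξ]
  intro t₀
  let x₀ : Z := (Γ (t₀, 0)).1.1
  let T := tangentCoord (𝓡 n) x₀
  let F : ℝ × ℝ → E × E := fun p => T (Γ p).1
  have hsrc0 : (Γ (t₀, 0)).1 ∈ T.source := by
    rw [tangentCoord_source]; exact mem_extChartAt_source x₀
  have hTs : IsOpen T.source := isOpen_tangentCoord_source x₀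
  have hιΓ : ContMDiffAt 𝓘(ℝ, ℝ × ℝ) (𝓡 n).tangent ∞ (fun p => (Γ p).1) (t₀, 0) :=
    ContMDiffAt.comp (g := (Subtype.val : unitTangentBundle g → TangentBundle (𝓡 n) Z)) (f := Γ)
      (t₀, (0 : ℝ)) (hemb.contMDiff _) (hΓ t₀)
  have hF : ContDiffAt ℝ ∞ F (t₀, 0) := by
    rw [← contMDiffAt_iff_contDiffAt]
    exact ContMDiffAt.comp (g := T) (f := fun p => (Γ p).1) (t₀, (0 : ℝ))
      ((contMDiffOn_tangentCoord x₀).contMDiffAt (hTs.mem_nhds hsrc0)) hιΓ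
  have hsrc : ∀ᶠ p in 𝓝 (t₀, (0 : ℝ)), (Γ p).1 ∈ T.source :=
    hιΓ.continuousAt.preimage_mem_nhds (hTs.mem_nhds hsrc0)
  have hsrc' : ∀ v : TangentBundle (𝓡 n) Z, v ∈ T.source →
      v.1 ∈ (extChartAt (𝓡 n) x₀).source := fun v hv => by
    rw [tangentCoord_source] at hv; exact hv
  have hT1 : ∀ v ∈ T.source, (T v).1 = extChartAt (𝓡 n) x₀ v.1 := fun v hv =>
    congrArg Prod.fst (tangentCoord_apply (I := 𝓡 n) (hsrc' v hv))
  have htar : ∀ v ∈ T.source, (T v).1 ∈ (extChartAt (𝓡 n) x₀).target := fun v hv => by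
    rw [hT1 v hv]; exact (extChartAt (𝓡 n) x₀).map_source (hsrc' v hv)
  have hkey := hasDerivAt_gram_variation (g := g) (x₀ := x₀) hF (htar _ hsrc0) ?_ ?_
  · refine hkey.congr_of_eventuallyEq ?_
    have hc : Filter.Tendsto (fun t : ℝ => (t, (0 : ℝ))) (𝓝 t₀) (𝓝 (t₀, 0)) :=
      (continuous_id.prodMk continuous_const).continuousAt
    filter_upwards [hc.eventually hsrc] with t ht
    exact contactForm_velocity hemb (c := fun s => hZ.flow t (w s)) (x₀ := x₀)
      (MDifferentiableAt.comp (g := hZ.flow t) (f := w) 0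
        ((hZ.contMDiff_flow_right hemb t).mdifferentiable (by simp) (w 0)) hwd) (hsrc' _ ht)
  · filter_upwards [hsrc] with p hp
    exact (hZ.isGeodesicOn_line (w p.2)).hasDerivAt_tangentCoord (x₀ := x₀) (mem_univ p.1)
      (hsrc' _ hp)
  · filter_upwards [hsrc] with p hp
    rw [gram_self g (htar _ hp)]
    change normSq g (T.symm (T (Γ p).1)) = 1
    rw [T.left_inv hp]
    exact (Γ p).2

include hemb in
/-- Close points of a geodesic are not conjugate. -/
theorem exists_pos_forall_tangentMap_flow (u : unitTangentBundle g) :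
    ∃ ε > 0, ∀ τ : ℝ, τ ≠ 0 → |τ| < ε → ∀ ξ : TangentSpace (𝓡 d) u,
      mfderiv (𝓡 d) (𝓡 n) (basePoint g) u ξ = 0 →
      mfderiv (𝓡 d) (𝓡 n) (fun v => basePoint g (hZ.flow τ v)) u ξ = 0 → ξ = 0 := by
  obtain ⟨Ψ, W, hW, huW, hΨ, hΨ0, hflow⟩ := hZ.exists_local_flow u
  let x₀ : Z := u.1.1
  let T := tangentCoord (𝓡 n) x₀
  let y₀ : E × E := T u.1
  have hTs : IsOpen T.source := isOpen_tangentCoord_source x₀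
  have hu : u.1 ∈ T.source := by
    rw [tangentCoord_source]; exact mem_extChartAt_source x₀
  have hsrc' : ∀ v : TangentBundle (𝓡 n) Z, v ∈ T.source →
      v.1 ∈ (extChartAt (𝓡 n) x₀).source := fun v hv => by
    rw [tangentCoord_source] at hv; exact hv
  have hT1 : ∀ v : TangentBundle (𝓡 n) Z, v.1 ∈ (extChartAt (𝓡 n) x₀).source →
      (T v).1 = extChartAt (𝓡 n) x₀ v.1 := fun v hv =>
    congrArg Prod.fst (tangentCoord_apply (I := 𝓡 n) hv)
  let inj : E →L[ℝ] ℝ × (E × E) :=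
    (ContinuousLinearMap.inr ℝ ℝ (E × E)).comp (ContinuousLinearMap.inr ℝ E E)
  -- The derivative, in the fibre direction, of the base component of Ψ. At τ = 0 that component of
  -- the geodesic field is the velocity itself, so `B 0` is the identity and `B τ` stays injective
  -- for small τ. A vertical variation e moves the base point at time τ by τ B(τ) e to first order.
  let B : ℝ → E →L[ℝ] E := fun τ =>
    (ContinuousLinearMap.fst ℝ E E).comp ((fderiv ℝ Ψ (τ, y₀)).comp inj)
  have hΨd : ∀ τ, (τ, y₀) ∈ W → HasFDerivAt Ψ (fderiv ℝ Ψ (τ, y₀)) (τ, y₀) := fun τ hτ =>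
    ((hΨ.contDiffAt (hW.mem_nhds hτ)).differentiableAt (by simp)).hasFDerivAt
  have hB0 : B 0 = ContinuousLinearMap.id ℝ E := by
    ext1 w
    have hl : HasDerivAt (fun s : ℝ => (y₀.1, y₀.2 + s • w)) ((0 : E), w) 0 := by
      have h2 : HasDerivAt (fun s : ℝ => y₀.2 + s • w) w 0 := by
        have := ((hasDerivAt_id (0 : ℝ)).smul_const w).const_add y₀.2
        rwa [one_smul] at this
      exact (hasDerivAt_const 0 y₀.1).prodMk h2
    have hl0 : (y₀.1, y₀.2 + (0 : ℝ) • w) = y₀ := by rw [zero_smul, add_zero]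
    have hl' : HasDerivAt (fun s : ℝ => ((0 : ℝ), (y₀.1, y₀.2 + s • w))) (inj w) 0 :=
      (hasDerivAt_const 0 (0 : ℝ)).prodMk hl
    have h1 : HasDerivAt (fun s : ℝ => Ψ (0, (y₀.1, y₀.2 + s • w)))
        (fderiv ℝ Ψ (0, y₀) (inj w)) 0 :=
      HasFDerivAt.comp_hasDerivAt (l := Ψ) (f := fun s : ℝ => ((0 : ℝ), (y₀.1, y₀.2 + s • w))) 0
        (by rw [hl0]; exact hΨd 0 huW) hl'
    have h2 : HasDerivAt (fun s : ℝ => (Ψ (0, (y₀.1, y₀.2 + s • w))).1) (B 0 w) 0 :=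
      (ContinuousLinearMap.fst ℝ E E).hasFDerivAt.comp_hasDerivAt 0 h1
    have h3 : HasDerivAt (fun s : ℝ => y₀.2 + s • w) w 0 := by
      have := ((hasDerivAt_id (0 : ℝ)).smul_const w).const_add y₀.2
      rwa [one_smul] at this
    refine h2.unique (h3.congr_of_eventuallyEq ?_)
    have hmem : ∀ᶠ s in 𝓝 (0 : ℝ), ((0 : ℝ), (y₀.1, y₀.2 + s • w)) ∈ W :=
      hl'.continuousAt.preimage_mem_nhds (hW.mem_nhds (by rw [hl0]; exact huW))
    filter_upwards [hmem] with s hs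
    rw [hΨ0 _ hs]
    rfl
  have hcurve : Continuous fun τ : ℝ => (τ, y₀) := continuous_id.prodMk continuous_const
  have hBc : ContinuousAt B 0 := by
    have h1 : ContinuousAt (fderiv ℝ Ψ) ((0 : ℝ), y₀) :=
      ((hΨ.contDiffAt (hW.mem_nhds huW)).fderiv_right (m := 0) (by simp)).continuousAt
    have h2 : ContinuousAt (fun τ : ℝ => fderiv ℝ Ψ (τ, y₀)) 0 :=
      ContinuousAt.comp (g := fderiv ℝ Ψ) (f := fun τ : ℝ => (τ, y₀)) h1 hcurve.continuousAt
    exact continuousAt_const.clm_comp (h2.clm_comp continuousAt_const)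
  have hBinj : ∀ᶠ τ in 𝓝 (0 : ℝ), Function.Injective (B τ) := by
    have hunit : ∀ᶠ τ in 𝓝 (0 : ℝ), IsUnit (B τ) :=
      hBc.preimage_mem_nhds (Units.isOpen.mem_nhds (by
        change IsUnit (B 0)
        rw [hB0]; exact isUnit_one))
    filter_upwards [hunit] with τ hτ
    obtain ⟨V, hV⟩ := hτ
    intro a b hab
    have h1 : ∀ a, (V⁻¹ : (E →L[ℝ] E)ˣ).1 (B τ a) = a := fun a => by
      rw [← hV]
      exact congrArg (fun L : E →L[ℝ] E => L a) (Units.inv_mul V)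
    rw [← h1 a, hab, h1]
  have hWev : ∀ᶠ τ in 𝓝 (0 : ℝ), (τ, y₀) ∈ W :=
    hcurve.continuousAt.preimage_mem_nhds (hW.mem_nhds huW)
  obtain ⟨ε, hε, hball⟩ := Metric.eventually_nhds_iff.1 (hBinj.and hWev)
  refine ⟨ε, hε, fun τ hτ0 hτε ξ h₁ h₂ => ?_⟩
  obtain ⟨hinj, hτW⟩ := hball (y := τ) (by rwa [Real.dist_eq, sub_zero])
  obtain ⟨w, hw, hwξ⟩ := exists_velocity_eq (⟨u, ξ⟩ : TangentBundle (𝓡 d) (unitTangentBundle g))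
  have hw0 : w 0 = u := congrArg (fun v => v.1) hwξ
  have hwd : MDifferentiableAt 𝓘(ℝ, ℝ) (𝓡 d) w 0 := hw.mdifferentiableAt (by simp)
  have hιd : MDifferentiableAt (𝓡 d) (𝓡 n).tangent
      (Subtype.val : unitTangentBundle g → TangentBundle (𝓡 n) Z) (w 0) :=
    hemb.contMDiff.mdifferentiable (by simp) _
  have hιw : MDifferentiableAt 𝓘(ℝ, ℝ) (𝓡 n).tangent (fun s => (w s).1) 0 :=
    MDifferentiableAt.comp (g := (Subtype.val : unitTangentBundle g → TangentBundle (𝓡 n) Z))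
      (f := w) 0 hιd hwd
  have hw0s : (w 0).1 ∈ T.source := by rw [hw0]; exact hu
  have hwsrc : ∀ᶠ s in 𝓝 (0 : ℝ), (w s).1 ∈ T.source :=
    hιw.continuousAt.preimage_mem_nhds (hTs.mem_nhds hw0s)
  let y : ℝ → E × E := fun s => T (w s).1
  have hy0 : y 0 = y₀ := by simp only [y, hw0]; rfl
  have hyd : DifferentiableAt ℝ y 0 := by
    rw [← mdifferentiableAt_iff_differentiableAt]
    exact MDifferentiableAt.comp (g := T) (f := fun s => (w s).1) 0
      (((contMDiffOn_tangentCoord x₀).contMDiffAt (hTs.mem_nhds hw0s)).mdifferentiableAt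
        (by simp)) hιw
  -- a curve whose projection has zero velocity has zero derivative in the base coordinates
  have hbase : ∀ c : ℝ → unitTangentBundle g, (∀ᶠ s in 𝓝 0, (c s).1.1 ∈
      (extChartAt (𝓡 n) x₀).source) → MDifferentiableAt 𝓘(ℝ, ℝ) (𝓡 d) c 0 →
      velocity (𝓡 n) (fun s => basePoint g (c s)) 0
        = ⟨basePoint g (c 0), (0 : TangentSpace (𝓡 n) (basePoint g (c 0)))⟩ →
      HasDerivAt (fun s => (T (c s).1).1) 0 0 := by
    intro c hc hcd hv
    have hπc : MDifferentiableAt 𝓘(ℝ, ℝ) (𝓡 n) (fun s => basePoint g (c s)) 0 :=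
      MDifferentiableAt.comp (g := basePoint g) (f := c) 0
        ((contMDiff_basePoint hemb).mdifferentiable (by simp) _) hcd
    have hx : DifferentiableAt ℝ (fun s => extChartAt (𝓡 n) x₀ (basePoint g (c s))) 0 := by
      rw [← mdifferentiableAt_iff_differentiableAt]
      refine MDifferentiableAt.comp (g := extChartAt (𝓡 n) x₀) (f := fun s => basePoint g (c s)) 0
        (mdifferentiableAt_extChartAt ?_) hπc
      have := hc.self_of_nhds
      rwa [extChartAt_source] at this
    have hd1 := tangentCoord_velocity hπc hc.self_of_nhds
    have hd2 := tangentCoord_velocity (I := 𝓡 n) (γ := fun _ : ℝ => basePoint g (c 0)) (t := 0)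
      mdifferentiableAt_const (x₀ := x₀) hc.self_of_nhds
    rw [velocity_const, ← hv, hd1, deriv_const] at hd2
    have h0 : deriv (fun s => extChartAt (𝓡 n) x₀ (basePoint g (c s))) 0 = 0 :=
      congrArg Prod.snd hd2
    have hx' := hx.hasDerivAt
    rw [h0] at hx'
    refine hx'.congr_of_eventuallyEq ?_
    filter_upwards [hc] with s hs
    exact hT1 _ hs
  have hy1 : HasDerivAt (fun s => (y s).1) 0 0 := by
    refine hbase w (hwsrc.mono fun s hs => hsrc' _ hs) hwd ?_
    rw [velocity_comp_eq_tangentMap (f := basePoint g)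
      ((contMDiff_basePoint hemb).mdifferentiable (by simp) _) hwd, hwξ, hw0]
    exact congrArg (fun a => (⟨basePoint g u, a⟩ : TangentBundle (𝓡 n) Z)) h₁
  have hfst : (deriv y 0).1 = 0 :=
    ((ContinuousLinearMap.fst ℝ E E).hasFDerivAt.comp_hasDerivAt 0 hyd.hasDerivAt).unique hy1
  -- The first hypothesis on ξ says that it is vertical: its coordinates are (0, e).
  obtain ⟨e, he⟩ : ∃ e : E, deriv y 0 = (0, e) := ⟨(deriv y 0).2, Prod.ext hfst rfl⟩
  have hyd' : HasDerivAt y ((0 : E), e) 0 := he ▸ hyd.hasDerivAt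
  have hyW : ∀ᶠ s in 𝓝 (0 : ℝ), (τ, y s) ∈ W := by
    have h1 : ContinuousAt (fun s => (τ, y s)) 0 := continuousAt_const.prodMk hyd.continuousAt
    exact h1.preimage_mem_nhds (hW.mem_nhds (by rw [hy0]; exact hτW))
  have hfd : MDifferentiableAt (𝓡 d) (𝓡 d) (hZ.flow τ) (w 0) :=
    (hZ.contMDiff_flow_right hemb τ).mdifferentiable (by simp) _
  have hfw : MDifferentiableAt 𝓘(ℝ, ℝ) (𝓡 d) (fun s => hZ.flow τ (w s)) 0 :=
    MDifferentiableAt.comp (g := hZ.flow τ) (f := w) 0 hfd hwd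
  have hy2 : HasDerivAt (fun s => (T (hZ.flow τ (w s)).1).1) 0 0 := by
    refine hbase (fun s => hZ.flow τ (w s)) ?_ hfw ?_
    · filter_upwards [hwsrc, hyW] with s hs hs'
      exact (hflow τ (w s) (hsrc' _ hs) hs').1
    · have hπf : MDifferentiableAt (𝓡 d) (𝓡 n) (fun v => basePoint g (hZ.flow τ v)) (w 0) :=
        MDifferentiableAt.comp (g := basePoint g) (f := hZ.flow τ) (w 0)
          ((contMDiff_basePoint hemb).mdifferentiable (by simp) _) hfd
      rw [velocity_comp_eq_tangentMap (f := fun v => basePoint g (hZ.flow τ v)) hπf hwd, hwξ, hw0]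
      exact congrArg (fun a => (⟨basePoint g (hZ.flow τ u), a⟩ : TangentBundle (𝓡 n) Z)) h₂
  have hy3 : HasDerivAt (fun s => (y s).1 + τ • (Ψ (τ, y s)).1) (0 + τ • B τ e) 0 := by
    have h1 : HasDerivAt (fun s => (τ, y s)) (inj e) 0 := (hasDerivAt_const 0 τ).prodMk hyd'
    have h2 : HasDerivAt (fun s => Ψ (τ, y s)) (fderiv ℝ Ψ (τ, y₀) (inj e)) 0 :=
      HasFDerivAt.comp_hasDerivAt (l := Ψ) (f := fun s => (τ, y s)) 0
        (by rw [hy0]; exact hΨd τ hτW) h1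
    have h3 : HasDerivAt (fun s => (Ψ (τ, y s)).1) (B τ e) 0 :=
      (ContinuousLinearMap.fst ℝ E E).hasFDerivAt.comp_hasDerivAt 0 h2
    exact hy1.add (h3.const_smul τ)
  have hBe : B τ e = 0 := by
    have h1 : (fun s => (y s).1 + τ • (Ψ (τ, y s)).1) =ᶠ[𝓝 0]
        fun s => (T (hZ.flow τ (w s)).1).1 := by
      filter_upwards [hwsrc, hyW] with s hs hs'
      exact (congrArg Prod.fst (hflow τ (w s) (hsrc' _ hs) hs').2).symm
    have h2 := hy3.unique (hy2.congr_of_eventuallyEq h1)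
    rw [zero_add] at h2
    exact (smul_eq_zero.1 h2).resolve_left hτ0
  have he0 : e = 0 := hinj (by rw [hBe, map_zero])
  have hdy : deriv y 0 = 0 := by rw [he, he0]; rfl
  have hy0t : y 0 ∈ T.target := T.map_source hw0s
  -- The coordinates of the variation have zero derivative. It remains to transport this back
  -- through the chart of TZ and through the differential of the embedding, which is injective.
  have hιv : velocity (𝓡 n).tangent (fun s => (w s).1) 0
      = tangentMap 𝓘(ℝ, E × E) (𝓡 n).tangent T.symm (velocity 𝓘(ℝ, E × E) y 0) := by
    rw [← velocity_comp_eq_tangentMap (f := T.symm)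
      (((contMDiffOn_tangentCoord_symm x₀).contMDiffAt
        ((isOpen_tangentCoord_target x₀).mem_nhds hy0t)).mdifferentiableAt (by simp))
      hyd.mdifferentiableAt]
    refine velocity_congr ?_
    filter_upwards [hwsrc] with s hs
    exact (T.left_inv hs).symm
  have hιξ : tangentMap (𝓡 d) (𝓡 n).tangent
      (Subtype.val : unitTangentBundle g → TangentBundle (𝓡 n) Z) ⟨u, ξ⟩
      = ⟨u.1, (0 : E × E)⟩ := by
    rw [← hwξ, ← velocity_comp_eq_tangentMap hιd hwd, hιv, velocity_eq_deriv, hdy]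
    have h1 : T.symm (y 0) = u.1 := by
      change T.symm (T (w 0).1) = u.1
      rw [T.left_inv hw0s, hw0]
    have h2 : ∀ L : E × E →L[ℝ] E × E, L 0 = 0 := fun L => map_zero L
    change (⟨T.symm (y 0), mfderiv 𝓘(ℝ, E × E) (𝓡 n).tangent T.symm (y 0) (0 : E × E)⟩ :
      TangentBundle (𝓡 n).tangent (TangentBundle (𝓡 n) Z)) = _
    refine (congrArg (fun a : E × E => (⟨T.symm (y 0), a⟩ :
      TangentBundle (𝓡 n).tangent (TangentBundle (𝓡 n) Z))) (h2 _)).trans ?_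
    rw [h1]
  have hfin : mfderiv (𝓡 d) (𝓡 n).tangent
      (Subtype.val : unitTangentBundle g → TangentBundle (𝓡 n) Z) u ξ = (0 : E × E) := by
    have h := hιξ
    exact eq_of_heq (TotalSpace.mk.inj h).2
  refine NullGeodesics.IsImmersion.mfderiv_injective hemb.isImmersion u (hfin.trans ?_)
  exact (map_zero (mfderiv (𝓡 d) (𝓡 n).tangent
    (Subtype.val : unitTangentBundle g → TangentBundle (𝓡 n) Z) u)).symm

end IsZoll

end Contact

/-! ### Dimensions of the vertical spaces and of χ; coincidences of geodesics. -/

section Vertical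

variable {n : ℕ} {Z : Type*} [TopologicalSpace Z] [ChartedSpace (EuclideanSpace ℝ (Fin n)) Z]
  [IsManifold (𝓡 n) ∞ Z] (g : RiemannianMetric n Z)
  {d : ℕ} [ChartedSpace (EuclideanSpace ℝ (Fin d)) (unitTangentBundle g)]

local notation "E" => EuclideanSpace ℝ (Fin n)

/-- The velocities at `u` of curves in the fibre of `STZ` through `u`. -/
def verticalVelocities (u : unitTangentBundle g) : Set (TangentSpace (𝓡 d) u) :=
  {ζ | ∃ κ : ℝ → unitTangentBundle g, ContMDiff 𝓘(ℝ, ℝ) (𝓡 d) ∞ κ ∧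
    (∀ s, basePoint g (κ s) = basePoint g u) ∧ velocity (𝓡 d) κ 0 = ⟨u, ζ⟩}

variable {g} [IsManifold (𝓡 d) ∞ (unitTangentBundle g)]
  (hemb : IsSmoothEmbedding (𝓡 d) (𝓡 n).tangent ∞
    (Subtype.val : unitTangentBundle g → TangentBundle (𝓡 n) Z))

include hemb in
/-- Every tangent vector of `Z` orthogonal to `u` is the velocity of a curve of unit vectors. -/
lemma exists_fiber_curve (u : unitTangentBundle g) (w : E) (hw : g.inner u.1.1 u.1.2 w = 0) :
    ∃ κ : ℝ → unitTangentBundle g, ContMDiff 𝓘(ℝ, ℝ) (𝓡 d) ∞ κ ∧ κ 0 = u ∧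
      (∀ s, basePoint g (κ s) = basePoint g u) ∧ ∃ v : ℝ → E, HasDerivAt v w 0 ∧
        ∀ s, (κ s).1 = ⟨u.1.1, v s⟩ := by
  let B : E →L[ℝ] E →L[ℝ] ℝ := g.inner u.1.1
  let a : E := u.1.2
  have haa : B a a = 1 := u.2
  have haw : B a w = 0 := hw
  have hwa : B w a = 0 := (g.symm u.1.1 w a).trans hw
  have hq : 0 ≤ B w w := by
    by_cases h : w = 0
    · rw [h, map_zero]
    · exact (g.pos u.1.1 w h).le
  -- The squared length of a + sw, since w is orthogonal to the unit vector a. It is stationary at s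
  -- = 0, so normalizing does not change the velocity w.
  let N : ℝ → ℝ := fun s => 1 + s ^ 2 * B w w
  have hN : ∀ s, 0 < N s := fun s => by positivity
  let v : ℝ → E := fun s => (Real.sqrt (N s))⁻¹ • (a + s • w)
  have hNs : ContDiff ℝ ∞ N := contDiff_const.add ((contDiff_id.pow 2).mul contDiff_const)
  have hsq : ContDiff ℝ ∞ fun s => (Real.sqrt (N s))⁻¹ :=
    (hNs.sqrt fun s => (hN s).ne').inv fun s => (Real.sqrt_pos.2 (hN s)).ne'
  have hv : ContDiff ℝ ∞ v :=
    hsq.smul (contDiff_const.add (contDiff_id.smul contDiff_const))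
  have hunit : ∀ s, B (v s) (v s) = 1 := by
    intro s
    have h1 : B (a + s • w) (a + s • w) = N s := by
      simp only [map_add, map_smul, add_apply, smul_apply, smul_eq_mul, haa, haw, hwa, N]
      ring
    have h2 : Real.sqrt (N s) * Real.sqrt (N s) = N s := Real.mul_self_sqrt (hN s).le
    have h3 := (Real.sqrt_pos.2 (hN s)).ne'
    simp only [v, map_smul, smul_apply, smul_eq_mul, h1]
    field_simp
    rw [sq, h2]
  let κ : ℝ → unitTangentBundle g := fun s => ⟨⟨u.1.1, v s⟩, hunit s⟩
  have hκ : ContMDiff 𝓘(ℝ, ℝ) (𝓡 d) ∞ κ := fun s =>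
    IsSmoothEmbedding.contMDiffAt_of_comp hemb (contMDiff_tangentBundle_fiber u.1.1 hv s)
  have hv0 : v 0 = a := by simp [v, N]
  have hvd : HasDerivAt v w 0 := by
    have h1 : HasDerivAt N 0 0 := by
      exact (((hasDerivAt_pow 2 (0 : ℝ)).mul_const (B w w)).const_add 1).congr_deriv (by simp)
    have h2 : HasDerivAt (fun s => (Real.sqrt (N s))⁻¹) 0 0 := by
      exact ((h1.sqrt (hN 0).ne').inv (Real.sqrt_pos.2 (hN 0)).ne').congr_deriv (by simp)
    have h3 : HasDerivAt (fun s : ℝ => a + s • w) w 0 := by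
      have := ((hasDerivAt_id (0 : ℝ)).smul_const w).const_add a
      rwa [one_smul] at this
    have h4 := h2.smul h3
    have hN0 : N 0 = 1 := by simp [N]
    refine h4.congr_deriv ?_
    rw [hN0, Real.sqrt_one, inv_one, one_smul, zero_smul, add_zero]
  refine ⟨κ, hκ, Subtype.ext ?_, fun s => rfl, v, hvd, fun s => rfl⟩
  change (⟨u.1.1, v 0⟩ : TangentBundle (𝓡 n) Z) = u.1
  rw [hv0]

-- Curves of unit vectors realize every direction orthogonal to `u`. In coordinates of TZ the
-- vertical velocities thus span at least an injective image of the orthogonal complement of `u`, of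
-- dimension n - 1.
include hemb in
theorem le_finrank_span_verticalVelocities (u : unitTangentBundle g) :
    n ≤ Module.finrank ℝ (Submodule.span ℝ (verticalVelocities g (d := d) u)) + 1 := by
  let B : E →L[ℝ] E →L[ℝ] ℝ := g.inner u.1.1
  let a : E := u.1.2
  have haa : B a a = 1 := u.2
  let ℓ : Module.Dual ℝ E := (B a).toLinearMap
  have hℓ : ℓ ≠ 0 := fun h => by
    have : ℓ a = 1 := haa
    rw [h] at this
    simp at this
  have hker := Module.Dual.finrank_ker_add_one_of_ne_zero hℓ
  rw [finrank_euclideanSpace_fin] at hker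
  let x₀ : Z := u.1.1
  let T := tangentCoord (𝓡 n) x₀
  have hTs : IsOpen T.source := isOpen_tangentCoord_source x₀
  have hsrc : ∀ w : E, (⟨x₀, w⟩ : TangentBundle (𝓡 n) Z) ∈ T.source := fun w => by
    rw [tangentCoord_source]; exact mem_extChartAt_source x₀
  let L : E →L[ℝ] E := mfderiv (𝓡 n) 𝓘(ℝ, E) (extChartAt (𝓡 n) x₀) x₀
  have hT : ∀ w : E, T ⟨x₀, w⟩ = (extChartAt (𝓡 n) x₀ x₀, L w) := fun w =>
    tangentCoord_apply (I := 𝓡 n) (x₀ := x₀) (v := ⟨x₀, w⟩) (mem_extChartAt_source x₀)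
  have hL : Function.Injective L := fun w w' h => by
    have h1 : T ⟨x₀, w⟩ = T ⟨x₀, w'⟩ := by rw [hT, hT, h]
    exact eq_of_heq (TotalSpace.mk.inj (T.injOn (hsrc w) (hsrc w') h1)).2
  let G : unitTangentBundle g → E × E := fun v => T v.1
  have hGd : MDifferentiableAt (𝓡 d) 𝓘(ℝ, E × E) G u :=
    MDifferentiableAt.comp (g := T)
      (f := (Subtype.val : unitTangentBundle g → TangentBundle (𝓡 n) Z)) u
      (((contMDiffOn_tangentCoord x₀).contMDiffAt (hTs.mem_nhds (hsrc u.1.2))).mdifferentiableAt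
        (by simp)) (hemb.contMDiff.mdifferentiable (by simp) u)
  let K : EuclideanSpace ℝ (Fin d) →L[ℝ] E × E := mfderiv (𝓡 d) 𝓘(ℝ, E × E) G u
  let V : Submodule ℝ (EuclideanSpace ℝ (Fin d)) :=
    Submodule.span ℝ (verticalVelocities g (d := d) u)
  let R : E →ₗ[ℝ] E × E := (LinearMap.inr ℝ E E).comp L.toLinearMap
  have hR : Function.Injective R := LinearMap.inr_injective.comp hL
  have hle : (LinearMap.ker ℓ).map R ≤ V.map K.toLinearMap := by
    rintro _ ⟨w, hw, rfl⟩
    obtain ⟨κ, hκ, hκ0, hκb, v, hv, hκv⟩ := exists_fiber_curve hemb u w hw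
    obtain ⟨ζ, hζ⟩ : ∃ ζ : EuclideanSpace ℝ (Fin d), velocity (𝓡 d) κ 0 = ⟨u, ζ⟩ := by
      refine ⟨(velocity (𝓡 d) κ 0).2, ?_⟩
      rw [← hκ0]
      rfl
    refine ⟨ζ, Submodule.subset_span ⟨κ, hκ, hκb, hζ⟩, ?_⟩
    have h1 := velocity_comp_eq_tangentMap (f := G) (γ := κ) (t := 0) (by rw [hκ0]; exact hGd)
      (hκ.mdifferentiable (by simp) 0)
    rw [hζ, velocity_eq_deriv] at h1
    have h2 : deriv (fun s => G (κ s)) 0 = K ζ :=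
      congrArg (fun x : TangentBundle 𝓘(ℝ, E × E) (E × E) => (show E × E from x.2)) h1
    have h3 : HasDerivAt (fun s => G (κ s)) ((0 : E), L w) 0 := by
      have h4 : (fun s => G (κ s)) = fun s => (extChartAt (𝓡 n) x₀ x₀, L (v s)) := by
        funext s
        rw [← hT, ← hκv]
      rw [h4]
      exact (hasDerivAt_const _ _).prodMk (L.hasFDerivAt.comp_hasDerivAt 0 hv)
    exact h2.symm.trans h3.deriv
  have h1 := Submodule.finrank_mono hle
  have h2 : Module.finrank ℝ ((LinearMap.ker ℓ).map R) = Module.finrank ℝ (LinearMap.ker ℓ) :=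
    (Submodule.equivMapOfInjective R hR _).finrank_eq.symm
  have h3 := Submodule.finrank_map_le K.toLinearMap V
  change n ≤ Module.finrank ℝ V + 1
  omega

namespace IsZoll

variable (hZ : IsZoll g) [T2Space Z]

-- The contact form takes the value 1 on the generator of the geodesic flow, so its kernel is a
-- hyperplane.
include hemb hZ in
theorem finrank_canonicalContact (u : unitTangentBundle g) :
    Module.finrank ℝ (canonicalContact g (d := d) u) + 1 = d := by
  let D : EuclideanSpace ℝ (Fin d) →L[ℝ] E := mfderiv (𝓡 d) (𝓡 n) (basePoint g) u
  let B : E →L[ℝ] E →L[ℝ] ℝ := g.inner u.1.1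
  let a : E := u.1.2
  let ℓ : Module.Dual ℝ (EuclideanSpace ℝ (Fin d)) := ((B a).comp D).toLinearMap
  have hfl : ContMDiff 𝓘(ℝ, ℝ) (𝓡 d) ∞ fun t => hZ.flow t u :=
    (hZ.contMDiff_flow hemb).comp (contMDiff_id.prodMk contMDiff_const)
  have h1 := velocity_comp_eq_tangentMap (f := basePoint g) (γ := fun t => hZ.flow t u) (t := 0)
    ((contMDiff_basePoint hemb).mdifferentiable (by simp) _) (hfl.mdifferentiable (by simp) 0)
  obtain ⟨ζ, hζ⟩ : ∃ ζ : EuclideanSpace ℝ (Fin d),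
      velocity (𝓡 d) (fun t => hZ.flow t u) 0 = ⟨u, ζ⟩ := by
    refine ⟨(velocity (𝓡 d) (fun t => hZ.flow t u) 0).2, ?_⟩
    have h0 : (velocity (𝓡 d) (fun t => hZ.flow t u) 0).1 = u := hZ.flow_zero u
    generalize velocity (𝓡 d) (fun t => hZ.flow t u) 0 = x at h0
    subst h0
    rfl
  rw [hζ] at h1
  have h2 : (⟨u.1.1, D ζ⟩ : TangentBundle (𝓡 n) Z) = u.1 :=
    h1.symm.trans (hZ.velocity_line_zero u)
  have h3 : D ζ = a := eq_of_heq (TotalSpace.mk.inj h2).2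
  have hℓ : ℓ ≠ 0 := fun h => by
    have h4 : ℓ ζ = 1 := by
      change B a (D ζ) = 1
      rw [h3]
      exact u.2
    rw [h] at h4
    simp at h4
  have hker := Module.Dual.finrank_ker_add_one_of_ne_zero hℓ
  rw [finrank_euclideanSpace_fin] at hker
  exact hker

omit [IsManifold (𝓡 d) ∞ (unitTangentBundle g)] in
/-- Two geodesics that agree at all times up to finitely many time shifts agree up to one of
them. -/
theorem exists_eq_flow {ι : Type*} [Finite ι] {u u' : unitTangentBundle g} (τ : ι → ℝ)
    (h : ∀ s, ∃ i, hZ.line u s = hZ.line u' (s + τ i)) : ∃ i, u = hZ.flow (τ i) u' := by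
  have hc : ∀ u, Continuous (hZ.line u) := fun u => (hZ.isGeodesicOn_line u).contMDiff.continuous
  -- Finitely many closed sets cover the line, so by Baire one of them contains an interval. On it
  -- the two geodesics agree, hence so do their velocities, and flowing back gives the claim.
  let S : ι → Set ℝ := fun i => {s | hZ.line u s = hZ.line u' (s + τ i)}
  have hS : ∀ i, IsClosed (S i) := fun i =>
    isClosed_eq (hc u) ((hc u').comp (continuous_id.add continuous_const))
  have hU : ⋃ i, S i = univ := eq_univ_of_forall fun s => mem_iUnion.2 (h s)
  obtain ⟨i, s, hs⟩ := nonempty_interior_of_iUnion_of_closed hS hU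
  refine ⟨i, ?_⟩
  have h1 : hZ.line u =ᶠ[𝓝 s] fun r => hZ.line u' (r + τ i) := mem_interior_iff_mem_nhds.1 hs
  have h2 := velocity_congr (I := 𝓡 n) h1
  rw [velocity_line_add] at h2
  have h3 : hZ.flow s u = hZ.flow (s + τ i) u' := Subtype.ext h2
  have h4 := congrArg (hZ.flow (-s)) h3
  rwa [← flow_add, ← flow_add, neg_add_cancel, flow_zero, neg_add_cancel_left] at h4

end IsZoll

end Vertical

/-! ### The angle form on the circle. -/

section Circle

local notation "E₁" => EuclideanSpace ℝ (Fin 1)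

lemma contMDiff_circle_coe : ContMDiff (𝓡 1) 𝓘(ℝ, ℂ) ∞ (fun z : Circle => (z : ℂ)) :=
  haveI : Fact (Module.finrank ℝ ℂ = 1 + 1) := ⟨Complex.finrank_real_complex⟩
  contMDiff_coe_sphere (E := ℂ) (n := 1)

/-- The form `dt` of the circle as a function on its tangent bundle. -/
def circleDt (v : TangentBundle (𝓡 1) Circle) : ℝ := dtCircle v.1 v.2

lemma circleDt_eq (v : TangentBundle (𝓡 1) Circle) :
    circleDt v = (fun (z : ℂ) (w : TangentBundle 𝓘(ℝ, ℂ) ℂ) => (ContinuousLinearMap.mul ℝ ℂ (star z) w.2).im) v.1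
      (tangentMap (𝓡 1) 𝓘(ℝ, ℂ) (fun z : Circle => (z : ℂ)) v) := rfl

lemma circleDt_velocity {κ : ℝ → Circle} {s : ℝ} (hκ : MDifferentiableAt 𝓘(ℝ, ℝ) (𝓡 1) κ s) :
    circleDt (velocity (𝓡 1) κ s) = (star (κ s : ℂ) * deriv (fun r => (κ r : ℂ)) s).im := by
  have h1 := velocity_comp_eq_tangentMap (f := fun z : Circle => (z : ℂ))
    (contMDiff_circle_coe.mdifferentiable (by simp) (κ s)) hκ
  rw [circleDt_eq, ← h1, velocity_eq_deriv]
  rfl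

lemma contMDiff_circleExp_affine (a b : ℝ) :
    ContMDiff 𝓘(ℝ, ℝ) (𝓡 1) ∞ fun s : ℝ => Circle.exp (a * s + b) :=
  contMDiff_circleExp.comp
    ((contDiff_const.mul contDiff_id).add contDiff_const : ContDiff ℝ ∞ _).contMDiff

lemma circleDt_velocity_exp (a b s : ℝ) :
    circleDt (velocity (𝓡 1) (fun s : ℝ => Circle.exp (a * s + b)) s) = a := by
  rw [circleDt_velocity ((contMDiff_circleExp_affine a b).mdifferentiable (by simp) s)]
  have h1 : HasDerivAt (fun r : ℝ => ((a * r + b : ℝ) : ℂ) * Complex.I) (a * Complex.I) s := by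
    have h2 : HasDerivAt (fun r : ℝ => a * r + b) a s := by
      simpa using ((hasDerivAt_id s).const_mul a).add_const b
    exact h2.ofReal_comp.mul_const Complex.I
  have h3 : HasDerivAt (fun r : ℝ => (Circle.exp (a * r + b) : ℂ))
      (Circle.exp (a * s + b) * (a * Complex.I)) s := by
    simp only [Circle.coe_exp]
    exact h1.cexp
  rw [h3.deriv, ← mul_assoc]
  have h4 : star (Circle.exp (a * s + b) : ℂ) * (Circle.exp (a * s + b) : ℂ) = 1 := by
    rw [Complex.star_def, ← Circle.coe_inv_eq_conj, ← Circle.coe_mul, inv_mul_cancel,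
      Circle.coe_one]
  rw [h4, one_mul]
  simp

/-- The tangent space is a line, and dt takes the value 1 on the velocity of s ↦ e^{i(s + θ)}. -/
lemma dtCircle_injective (z : Circle) : Function.Injective (dtCircle z) := by
  let A : E₁ →L[ℝ] ℝ := dtCircle z
  obtain ⟨θ, hθ⟩ := Circle.exp_surjective z
  have h1 : (velocity (𝓡 1) (fun s : ℝ => Circle.exp (1 * s + θ)) 0).1 = z := by
    change Circle.exp (1 * 0 + θ) = z
    rw [mul_zero, zero_add, hθ]
  have h2 := circleDt_velocity_exp 1 θ 0
  generalize velocity (𝓡 1) (fun s : ℝ => Circle.exp (1 * s + θ)) 0 = v at h1 h2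
  subst h1
  have hA : A v.2 = 1 := h2
  have hne : A.toLinearMap ≠ 0 := fun h => by
    have h3 : A.toLinearMap v.2 = 1 := hA
    rw [h] at h3
    exact zero_ne_one h3
  have hker := Module.Dual.finrank_ker_add_one_of_ne_zero (f := A.toLinearMap) hne
  rw [finrank_euclideanSpace_fin] at hker
  have h4 : LinearMap.ker A.toLinearMap = ⊥ := Submodule.finrank_eq_zero.1 (by omega)
  exact LinearMap.ker_eq_bot.1 h4

/-- A curve in the circle with constant angular velocity. -/
lemma eqOn_circleExp_of_circleDt {κ : ℝ → Circle} {J : Set ℝ} (hJ : IsOpen J) (hc : J.OrdConnected)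
    (hκ : ∀ s ∈ J, MDifferentiableAt 𝓘(ℝ, ℝ) (𝓡 1) κ s) {a : ℝ}
    (ha : ∀ s ∈ J, circleDt (velocity (𝓡 1) κ s) = a) {t₀ : ℝ} (ht₀ : t₀ ∈ J) :
    ∀ s ∈ J, κ s = Circle.exp (a * (s - t₀)) * κ t₀ := by
  -- The product of κ̄ and κ' has imaginary part a by hypothesis and real part 0 because |κ| = 1.
  -- Hence κ' = iaκ.
  have hd : ∀ s ∈ J, HasDerivAt (fun r => (κ r : ℂ)) (a * Complex.I * κ s) s := by
    intro s hs
    have h1 : DifferentiableAt ℝ (fun r => (κ r : ℂ)) s := by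
      rw [← mdifferentiableAt_iff_differentiableAt]
      exact MDifferentiableAt.comp (g := fun z : Circle => (z : ℂ)) s
        (contMDiff_circle_coe.mdifferentiable (by simp) (κ s)) (hκ s hs)
    have h2 := ha s hs
    rw [circleDt_velocity (hκ s hs)] at h2
    have h3 : HasDerivAt (fun r => star (κ r : ℂ) * (κ r : ℂ))
        (star (deriv (fun r => (κ r : ℂ)) s) * κ s
          + star (κ s : ℂ) * deriv (fun r => (κ r : ℂ)) s) s :=
      h1.hasDerivAt.star.mul h1.hasDerivAt
    have hu : ∀ r, star (κ r : ℂ) * (κ r : ℂ) = 1 := fun r => by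
      rw [Complex.star_def, ← Circle.coe_inv_eq_conj, ← Circle.coe_mul, inv_mul_cancel,
        Circle.coe_one]
    simp only [hu] at h3
    have h4 := h3.unique (hasDerivAt_const s (1 : ℂ))
    set D := deriv (fun r => (κ r : ℂ)) s
    have h5 : (star (κ s : ℂ) * D).re = 0 := by
      have h6 : star D * (κ s : ℂ) = star (star (κ s : ℂ) * D) := by
        rw [star_mul, star_star]
      rw [h6] at h4
      generalize star (κ s : ℂ) * D = Q at h4
      have := congrArg Complex.re h4
      simp only [Complex.add_re, Complex.star_def, Complex.conj_re, Complex.zero_re] at this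
      linarith
    have h7 : star (κ s : ℂ) * D = a * Complex.I := by
      apply Complex.ext
      · rw [h5]; simp
      · rw [h2]; simp
    have h8 : D = a * Complex.I * κ s := by
      rw [← h7, mul_right_comm, hu, one_mul]
    rw [← h8]
    exact h1.hasDerivAt
  -- Multiplication by the integrating factor e^{-ias} gives a constant function.
  have hd' : ∀ s ∈ J, HasDerivAt (fun r : ℝ => (κ r : ℂ) * Complex.exp (-(a * r) * Complex.I))
      0 s := by
    intro s hs
    have h1 : HasDerivAt (fun r : ℝ => -((a : ℂ) * r) * Complex.I) (-(a : ℂ) * Complex.I) s := by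
      have h2 : HasDerivAt (fun r : ℝ => (r : ℂ)) 1 s := (hasDerivAt_id s).ofReal_comp
      simpa using ((h2.const_mul (a : ℂ)).neg).mul_const Complex.I
    exact ((hd s hs).mul h1.cexp).congr_deriv (by ring)
  intro s hs
  have hconv : Convex ℝ J := hc.convex
  have h1 := hconv.is_const_of_fderivWithin_eq_zero (𝕜 := ℝ)
    (fun r hr => (hd' r hr).differentiableAt.differentiableWithinAt)
    (fun r hr => by
      rw [fderivWithin_of_isOpen hJ hr]
      ext
      simpa using (hd' r hr).deriv) hs ht₀
  apply Circle.ext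
  rw [Circle.coe_mul, Circle.coe_exp]
  have h2 : (κ s : ℂ) = κ s * Complex.exp (-(a * s) * Complex.I)
      * Complex.exp (a * s * Complex.I) := by
    rw [mul_assoc, ← Complex.exp_add]
    simp
  rw [h2, h1, mul_assoc, ← Complex.exp_add, mul_comm]
  congr 2
  push_cast
  ring

/-- The form `dt` in the chart of the circle at `θ₀`. -/
def angularForm (θ₀ : Circle) (η : E₁) : E₁ →L[ℝ] ℝ :=
  let D : E₁ →L[ℝ] E₁ := mfderiv 𝓘(ℝ, E₁) (𝓡 1) (extChartAt (𝓡 1) θ₀).symm η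
  let A : E₁ →L[ℝ] ℝ := dtCircle ((extChartAt (𝓡 1) θ₀).symm η)
  A.comp D

lemma circleDt_tangentCoord_symm {θ₀ : Circle} {η : E₁} (hη : η ∈ (extChartAt (𝓡 1) θ₀).target)
    (w : E₁) : circleDt ((tangentCoord (𝓡 1) θ₀).symm (η, w)) = angularForm θ₀ η w := by
  rw [tangentCoord_symm_apply hη]
  rfl

lemma angularForm_ne_zero {θ₀ : Circle} {η : E₁} (hη : η ∈ (extChartAt (𝓡 1) θ₀).target)
    {w : E₁} (hw : w ≠ 0) : angularForm θ₀ η w ≠ 0 := by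
  intro h
  let T := tangentCoord (𝓡 1) θ₀
  let D : E₁ →L[ℝ] E₁ := mfderiv 𝓘(ℝ, E₁) (𝓡 1) (extChartAt (𝓡 1) θ₀).symm η
  have hD : D w = D 0 := by
    refine dtCircle_injective _ (Eq.trans ?_ (map_zero (angularForm θ₀ η)).symm)
    exact h
  have ht : ∀ w : E₁, (η, w) ∈ T.target := fun w => by
    rw [tangentCoord_target]; exact ⟨hη, trivial⟩
  have h1 : T.symm (η, w) = T.symm (η, 0) := by
    rw [tangentCoord_symm_apply hη, tangentCoord_symm_apply hη]
    exact congrArg (fun a => (⟨_, a⟩ : TangentBundle (𝓡 1) Circle)) hD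
  exact hw (congrArg Prod.snd (T.symm.injOn (ht w) (ht 0) h1))

/-- With f the chart parametrization followed by the inclusion in ℂ, dt is Im(f̄ df), an expression
in f and its derivative. -/
lemma contDiffOn_angularForm (θ₀ : Circle) :
    ContDiffOn ℝ ∞ (angularForm θ₀) (extChartAt (𝓡 1) θ₀).target := by
  let ψ := extChartAt (𝓡 1) θ₀
  let f : E₁ → ℂ := fun η => (ψ.symm η : ℂ)
  have hto : IsOpen ψ.target := isOpen_extChartAt_target θ₀
  have hf : ContDiffOn ℝ ∞ f ψ.target := by
    rw [← contMDiffOn_iff_contDiffOn]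
    exact contMDiff_circle_coe.comp_contMDiffOn (contMDiffOn_extChartAt_symm θ₀)
  have h1 : ContDiffOn ℝ ∞ (fun η => (ContinuousLinearMap.mul ℝ ℂ (star (f η))).comp
      (fderiv ℝ f η)) ψ.target := by
    refine ContDiffOn.clm_comp ?_ (hf.fderiv_of_isOpen hto (by simp))
    exact (ContinuousLinearMap.mul ℝ ℂ).contDiff.comp_contDiffOn
      (Complex.conjCLE.contDiff.comp_contDiffOn hf)
  have h2 : ContDiffOn ℝ ∞ (fun η => Complex.imCLM.comp
      ((ContinuousLinearMap.mul ℝ ℂ (star (f η))).comp (fderiv ℝ f η))) ψ.target :=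
    contDiffOn_const.clm_comp h1
  refine h2.congr fun η hη => ?_
  have h3 : mfderiv 𝓘(ℝ, E₁) 𝓘(ℝ, ℂ) f η
      = (mfderiv (𝓡 1) 𝓘(ℝ, ℂ) (fun z : Circle => (z : ℂ)) (ψ.symm η)).comp
        (mfderiv 𝓘(ℝ, E₁) (𝓡 1) ψ.symm η) :=
    mfderiv_comp (g := fun z : Circle => (z : ℂ)) η
      (contMDiff_circle_coe.mdifferentiable (by simp) _)
      (((contMDiffOn_extChartAt_symm (n := ∞) θ₀).contMDiffAt
        (hto.mem_nhds hη)).mdifferentiableAt (by simp))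
  rw [mfderiv_eq_fderiv] at h3
  rw [h3]
  rfl

/-- On a line every bilinear form is symmetric. Applied to the derivative of the angle form, this
says that dt is closed. -/
lemma bilin_comm (B : E₁ →L[ℝ] E₁ →L[ℝ] ℝ) (v w : E₁) : B v w = B w v := by
  have h : ∀ v : E₁, v = v 0 • EuclideanSpace.single 0 (1 : ℝ) := fun v => by
    ext i
    fin_cases i
    simp
  rw [h v, h w]
  simp only [map_smul, smul_apply, smul_eq_mul]
  ring

end Circle

lemma differentiableAt_deriv {F : Type*} [NormedAddCommGroup F] [NormedSpace ℝ F] {x : ℝ → F} {t : ℝ}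
    (h : ContDiffAt ℝ ∞ x t) : DifferentiableAt ℝ (deriv x) t := by
  have h1 : ContDiffAt ℝ ∞ (fderiv ℝ x) t := h.fderiv_right (by simp)
  have h2 := (h1.differentiableAt (by simp)).clm_apply (differentiableAt_const (1 : ℝ))
  simpa using h2

/-! ### Geodesics of the Lorentzian product. -/

section Lorentz

variable {n : ℕ} {Z : Type*} [TopologicalSpace Z] [ChartedSpace (EuclideanSpace ℝ (Fin n)) Z]
  [IsManifold (𝓡 n) ∞ Z] (g : RiemannianMetric n Z) (c : ℕ)

local notation "E" => EuclideanSpace ℝ (Fin n)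
local notation "E₁" => EuclideanSpace ℝ (Fin 1)
local notation "IM" => ModelWithCorners.prod (𝓡 n) (𝓡 1)

omit [IsManifold (𝓡 n) ∞ Z] in
lemma extChartAt_prod_target (p₀ : Z × Circle) : (extChartAt IM p₀).target
    = (extChartAt (𝓡 n) p₀.1).target ×ˢ (extChartAt (𝓡 1) p₀.2).target := by
  rw [extChartAt_prod]
  rfl

/-- In a product chart the Lorentzian metric splits. -/
lemma localMetric_lorentzMetric {p₀ : Z × Circle} {q : E × E₁}
    (hq : q ∈ (extChartAt IM p₀).target) (v w : E × E₁) :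
    localMetric (lorentzMetric g c) p₀ q v w = gram g p₀.1 q.1 v.1 w.1
      - 1 / (c : ℝ) ^ 2 * (angularForm p₀.2 q.2 v.2 * angularForm p₀.2 q.2 w.2) := by
  let S := (extChartAt IM p₀).symm
  let φ := extChartAt (𝓡 n) p₀.1
  let ψ := extChartAt (𝓡 1) p₀.2
  have hq' := hq
  rw [extChartAt_prod_target] at hq'
  have hS : MDifferentiableAt 𝓘(ℝ, E × E₁) IM S q :=
    ((contMDiffOn_extChartAt_symm (n := ∞) p₀).contMDiffAt
      ((isOpen_extChartAt_target p₀).mem_nhds hq)).mdifferentiableAt (by simp)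
  have hφ : MDifferentiableAt 𝓘(ℝ, E) (𝓡 n) φ.symm q.1 :=
    ((contMDiffOn_extChartAt_symm (n := ∞) p₀.1).contMDiffAt
      ((isOpen_extChartAt_target p₀.1).mem_nhds hq'.1)).mdifferentiableAt (by simp)
  have hψ : MDifferentiableAt 𝓘(ℝ, E₁) (𝓡 1) ψ.symm q.2 :=
    ((contMDiffOn_extChartAt_symm (n := ∞) p₀.2).contMDiffAt
      ((isOpen_extChartAt_target p₀.2).mem_nhds hq'.2)).mdifferentiableAt (by simp)
  have hSe : ∀ q, S q = (φ.symm q.1, ψ.symm q.2) := fun q => by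
    change (extChartAt IM p₀).symm q = _
    rw [extChartAt_prod]
    rfl
  have hfst : MDifferentiableAt 𝓘(ℝ, E × E₁) 𝓘(ℝ, E) (Prod.fst : E × E₁ → E) q :=
    differentiableAt_fst.mdifferentiableAt
  have hsnd : MDifferentiableAt 𝓘(ℝ, E × E₁) 𝓘(ℝ, E₁) (Prod.snd : E × E₁ → E₁) q :=
    differentiableAt_snd.mdifferentiableAt
  have h1 : (Prod.fst : Z × Circle → Z) ∘ S = φ.symm ∘ (Prod.fst : E × E₁ → E) := by
    funext q
    simp [hSe]
  have h2 : (Prod.snd : Z × Circle → Circle) ∘ S = ψ.symm ∘ (Prod.snd : E × E₁ → E₁) := by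
    funext q
    simp [hSe]
  have hD1 : (mfderiv IM (𝓡 n) Prod.fst (S q)).comp (mfderiv 𝓘(ℝ, E × E₁) IM S q)
      = (mfderiv 𝓘(ℝ, E) (𝓡 n) φ.symm q.1).comp (ContinuousLinearMap.fst ℝ E E₁) := by
    have ha := mfderiv_comp q (g := (Prod.fst : Z × Circle → Z)) (I' := IM)
      (mdifferentiableAt_fst (I := 𝓡 n) (I' := 𝓡 1)) hS
    have hb := mfderiv_comp q (g := φ.symm) (f := (Prod.fst : E × E₁ → E)) hφ hfst
    rw [mfderiv_eq_fderiv, fderiv_fst] at hb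
    rw [h1] at ha
    exact ha.symm.trans hb
  have hD2 : (mfderiv IM (𝓡 1) Prod.snd (S q)).comp (mfderiv 𝓘(ℝ, E × E₁) IM S q)
      = (mfderiv 𝓘(ℝ, E₁) (𝓡 1) ψ.symm q.2).comp (ContinuousLinearMap.snd ℝ E E₁) := by
    have ha := mfderiv_comp q (g := (Prod.snd : Z × Circle → Circle)) (I' := IM)
      (mdifferentiableAt_snd (I := 𝓡 n) (I' := 𝓡 1)) hS
    have hb := mfderiv_comp q (g := ψ.symm) (f := (Prod.snd : E × E₁ → E₁)) hψ hsnd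
    rw [mfderiv_eq_fderiv, fderiv_snd] at hb
    rw [h2] at ha
    exact ha.symm.trans hb
  let D : E × E₁ →L[ℝ] E × E₁ := mfderiv 𝓘(ℝ, E × E₁) IM S q
  let A₁ : E × E₁ →L[ℝ] E := mfderiv IM (𝓡 n) Prod.fst (S q)
  let A₂ : E × E₁ →L[ℝ] E₁ := mfderiv IM (𝓡 1) Prod.snd (S q)
  let B₁ : E →L[ℝ] E := mfderiv 𝓘(ℝ, E) (𝓡 n) φ.symm q.1
  let B₂ : E₁ →L[ℝ] E₁ := mfderiv 𝓘(ℝ, E₁) (𝓡 1) ψ.symm q.2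
  have hA1 : ∀ v, A₁ (D v) = B₁ v.1 := fun v => congrArg (fun L : E × E₁ →L[ℝ] E => L v) hD1
  have hA2 : ∀ v, A₂ (D v) = B₂ v.2 := fun v => congrArg (fun L : E × E₁ →L[ℝ] E₁ => L v) hD2
  let G : Z → E →L[ℝ] E →L[ℝ] ℝ := fun z => g.inner z
  let C : Circle → E₁ →L[ℝ] ℝ := fun z => dtCircle z
  change G (S q).1 (A₁ (D v)) (A₁ (D w)) - 1 / (c : ℝ) ^ 2 *
    (C (S q).2 (A₂ (D v)) * C (S q).2 (A₂ (D w))) = _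
  rw [hA1, hA1, hA2, hA2, hSe]
  rfl

/-- With h the coordinate form of dt, the product rule for h ⊗ h yields h'(v, v)h(w) + h(v)h'(v, w)
- h(v)h'(w, v). The last two terms cancel by `bilin_comm`. -/
lemma christoffel_lorentzMetric {p₀ : Z × Circle} {q : E × E₁}
    (hq : q ∈ (extChartAt IM p₀).target) (v w : E × E₁) :
    christoffel (localMetric (lorentzMetric g c) p₀) q v v w
      = christoffel (localMetric g.form p₀.1) q.1 v.1 v.1 w.1
        - 1 / (c : ℝ) ^ 2 * (fderiv ℝ (angularForm p₀.2) q.2 v.2 v.2 * angularForm p₀.2 q.2 w.2)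
      := by
  have hq' := hq
  rw [extChartAt_prod_target] at hq'
  let h' := fderiv ℝ (angularForm p₀.2) q.2
  let G' := fderiv ℝ (gram g p₀.1) q.1
  have hA : HasFDerivAt (fun z : E × E₁ => gram g p₀.1 z.1)
      (G'.comp (ContinuousLinearMap.fst ℝ E E₁)) q :=
    HasFDerivAt.comp (g := gram g p₀.1) (f := (Prod.fst : E × E₁ → E)) q
      (differentiableAt_gram g hq'.1).hasFDerivAt hasFDerivAt_fst
  have hB : HasFDerivAt (fun z : E × E₁ => angularForm p₀.2 z.2)
      (h'.comp (ContinuousLinearMap.snd ℝ E E₁)) q :=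
    HasFDerivAt.comp (g := angularForm p₀.2) (f := (Prod.snd : E × E₁ → E₁)) q
      (((contDiffOn_angularForm p₀.2).contDiffAt
        ((isOpen_extChartAt_target p₀.2).mem_nhds hq'.2)).differentiableAt (by simp)).hasFDerivAt
      hasFDerivAt_snd
  have key : ∀ a b u : E × E₁,
      fderiv ℝ (fun z => localMetric (lorentzMetric g c) p₀ z a b) q u
        = G' u.1 a.1 b.1 - 1 / (c : ℝ) ^ 2 *
          (h' u.2 a.2 * angularForm p₀.2 q.2 b.2 + angularForm p₀.2 q.2 a.2 * h' u.2 b.2) := by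
    intro a b u
    have e1 : (fun z => localMetric (lorentzMetric g c) p₀ z a b) =ᶠ[𝓝 q] fun z =>
        gram g p₀.1 z.1 a.1 b.1
          - 1 / (c : ℝ) ^ 2 * (angularForm p₀.2 z.2 a.2 * angularForm p₀.2 z.2 b.2) := by
      filter_upwards [(isOpen_extChartAt_target p₀).mem_nhds hq] with z hz
      exact localMetric_lorentzMetric g c hz a b
    have d1 := (hA.clm_apply (hasFDerivAt_const a.1 q)).clm_apply (hasFDerivAt_const b.1 q)
    have d2 := hB.clm_apply (hasFDerivAt_const a.2 q)
    have d3 := hB.clm_apply (hasFDerivAt_const b.2 q)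
    have d4 := d1.sub ((d2.mul d3).const_mul (1 / (c : ℝ) ^ 2))
    rw [e1.fderiv_eq]
    refine (congrArg (fun L : E × E₁ →L[ℝ] ℝ => L u) d4.fderiv).trans ?_
    simp
    ring
  have key' : ∀ a b u : E,
      fderiv ℝ (fun z => localMetric g.form p₀.1 z a b) q.1 u = G' u a b := by
    intro a b u
    have d1 := ((differentiableAt_gram g hq'.1).hasFDerivAt.clm_apply
      (hasFDerivAt_const a q.1)).clm_apply (hasFDerivAt_const b q.1)
    refine (congrArg (fun L : E →L[ℝ] ℝ => L u) d1.fderiv).trans ?_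
    simp [G']
  have hcomm := bilin_comm h' v.2 w.2
  simp only [christoffel, key, key', hcomm]
  ring

variable {g c}

/-- The left-hand side of the geodesic equation of the product. -/
lemma geodesic_equation_lorentzMetric {γ : ℝ → Z × Circle} {t : ℝ}
    (h : ContMDiffAt 𝓘(ℝ, ℝ) IM ∞ γ t) {p₀ : Z × Circle}
    (hs : γ t ∈ (extChartAt IM p₀).source) (w : E × E₁) :
    let x : ℝ → E × E₁ := fun s => extChartAt IM p₀ (γ s)
    let x₁ : ℝ → E := fun s => extChartAt (𝓡 n) p₀.1 (γ s).1
    localMetric (lorentzMetric g c) p₀ (x t) (deriv (deriv x) t) w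
        + christoffel (localMetric (lorentzMetric g c) p₀) (x t) (deriv x t) (deriv x t) w
      = (localMetric g.form p₀.1 (x₁ t) (deriv (deriv x₁) t) w.1
        + christoffel (localMetric g.form p₀.1) (x₁ t) (deriv x₁ t) (deriv x₁ t) w.1)
        - 1 / (c : ℝ) ^ 2 * (deriv (fun s => circleDt (velocity (𝓡 1) (fun r => (γ r).2) s)) t
          * angularForm p₀.2 (extChartAt (𝓡 1) p₀.2 (γ t).2) w.2) := by
  intro x x₁
  let x₂ : ℝ → E₁ := fun s => extChartAt (𝓡 1) p₀.2 (γ s).2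
  have hx : x = fun s => (x₁ s, x₂ s) := by
    funext s
    simp only [x, extChartAt_prod]
    rfl
  have hs' := hs
  rw [extChartAt_prod] at hs'
  have hs1 : (γ t).1 ∈ (extChartAt (𝓡 n) p₀.1).source := hs'.1
  have hs2 : (γ t).2 ∈ (extChartAt (𝓡 1) p₀.2).source := hs'.2
  have hγ1 : ContMDiffAt 𝓘(ℝ, ℝ) (𝓡 n) ∞ (fun s => (γ s).1) t :=
    ContMDiffAt.comp (g := (Prod.fst : Z × Circle → Z)) t contMDiffAt_fst h
  have hγ2 : ContMDiffAt 𝓘(ℝ, ℝ) (𝓡 1) ∞ (fun s => (γ s).2) t :=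
    ContMDiffAt.comp (g := (Prod.snd : Z × Circle → Circle)) t contMDiffAt_snd h
  have hx1 : ContDiffAt ℝ ∞ x₁ t := by
    rw [← contMDiffAt_iff_contDiffAt]
    exact ContMDiffAt.comp (g := extChartAt (𝓡 n) p₀.1) (f := fun s => (γ s).1) t
      (contMDiffAt_extChartAt' (by rwa [extChartAt_source] at hs1)) hγ1
  have hx2 : ContDiffAt ℝ ∞ x₂ t := by
    rw [← contMDiffAt_iff_contDiffAt]
    exact ContMDiffAt.comp (g := extChartAt (𝓡 1) p₀.2) (f := fun s => (γ s).2) t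
      (contMDiffAt_extChartAt' (by rwa [extChartAt_source] at hs2)) hγ2
  have hev1 : ∀ᶠ s in 𝓝 t, DifferentiableAt ℝ x₁ s :=
    ((hx1.of_le (by simp : (1 : WithTop ℕ∞) ≤ ∞)).eventually (by simp)).mono
      fun p hp => hp.differentiableAt (by simp)
  have hev2 : ∀ᶠ s in 𝓝 t, DifferentiableAt ℝ x₂ s :=
    ((hx2.of_le (by simp : (1 : WithTop ℕ∞) ≤ ∞)).eventually (by simp)).mono
      fun p hp => hp.differentiableAt (by simp)
  have hdx1 : DifferentiableAt ℝ (deriv x₁) t :=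
    differentiableAt_deriv hx1
  have hdx2 : DifferentiableAt ℝ (deriv x₂) t :=
    differentiableAt_deriv hx2
  have hdx : deriv x =ᶠ[𝓝 t] fun s => (deriv x₁ s, deriv x₂ s) := by
    filter_upwards [hev1, hev2] with s h1 h2
    rw [hx]
    exact (h1.hasDerivAt.prodMk h2.hasDerivAt).deriv
  have hddx : deriv (deriv x) t = (deriv (deriv x₁) t, deriv (deriv x₂) t) := by
    rw [hdx.deriv_eq]
    exact (hdx1.hasDerivAt.prodMk hdx2.hasDerivAt).deriv
  have hxt : x t = (x₁ t, x₂ t) := by rw [hx]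
  have hx2t : x₂ t ∈ (extChartAt (𝓡 1) p₀.2).target := (extChartAt (𝓡 1) p₀.2).map_source hs2
  have htar : x t ∈ (extChartAt IM p₀).target := (extChartAt IM p₀).map_source hs
  have hdt : (fun s => circleDt (velocity (𝓡 1) (fun r => (γ r).2) s))
      =ᶠ[𝓝 t] fun s => angularForm p₀.2 (x₂ s) (deriv x₂ s) := by
    have hm : ∀ᶠ s in 𝓝 t, MDifferentiableAt 𝓘(ℝ, ℝ) (𝓡 1) (fun r => (γ r).2) s :=
      ((contMDiffAt_iff_contMDiffAt_nhds (by simp)).1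
        (hγ2.of_le (by simp : (1 : WithTop ℕ∞) ≤ ∞))).mono
        fun p hp => hp.mdifferentiableAt (by simp)
    filter_upwards [hm, hγ2.continuousAt.preimage_mem_nhds
      ((isOpen_extChartAt_source p₀.2).mem_nhds hs2)] with s h1 h2
    have h3 := tangentCoord_velocity h1 h2
    have h4 : velocity (𝓡 1) (fun r => (γ r).2) s ∈ (tangentCoord (𝓡 1) p₀.2).source := by
      rw [tangentCoord_source]; exact h2
    rw [← (tangentCoord (𝓡 1) p₀.2).left_inv h4, h3]
    exact circleDt_tangentCoord_symm ((extChartAt (𝓡 1) p₀.2).map_source h2) _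
  -- The derivative of the angular velocity h(x₂)(x₂') is h'(x₂', x₂') + h(x₂''), exactly the
  -- combination left in the circle part of the equation.
  have hd2 : deriv (fun s => circleDt (velocity (𝓡 1) (fun r => (γ r).2) s)) t
      = fderiv ℝ (angularForm p₀.2) (x₂ t) (deriv x₂ t) (deriv x₂ t)
        + angularForm p₀.2 (x₂ t) (deriv (deriv x₂) t) := by
    rw [hdt.deriv_eq]
    have ha : HasFDerivAt (angularForm p₀.2) (fderiv ℝ (angularForm p₀.2) (x₂ t)) (x₂ t) :=
      (((contDiffOn_angularForm p₀.2).contDiffAt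
        ((isOpen_extChartAt_target p₀.2).mem_nhds hx2t)).differentiableAt (by simp)).hasFDerivAt
    have hb := HasFDerivAt.comp_hasDerivAt (l := angularForm p₀.2) (f := x₂) t ha
      hev2.self_of_nhds.hasDerivAt
    exact (hb.clm_apply hdx2.hasDerivAt).deriv
  rw [localMetric_lorentzMetric g c htar, christoffel_lorentzMetric g c htar, hddx,
    hdx.self_of_nhds, hxt, hd2]
  simp only [localMetric_eq_gram]
  ring

/-- Geodesics of the product split. -/
theorem isGeodesicOn_lorentzMetric_iff (hc : 0 < c) {γ : ℝ → Z × Circle} {J : Set ℝ} :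
    IsGeodesicOn (lorentzMetric g c) γ J ↔ IsGeodesicOn g.form (fun s => (γ s).1) J ∧
      ContMDiffOn 𝓘(ℝ, ℝ) (𝓡 1) ∞ (fun s => (γ s).2) J ∧
      ∀ t ∈ J, deriv (fun s => circleDt (velocity (𝓡 1) (fun r => (γ r).2) s)) t = 0 := by
  have hk : 1 / (c : ℝ) ^ 2 ≠ 0 := by positivity
  constructor
  · intro h
    have heq : ∀ t ∈ J, ∀ p₀ : Z × Circle, γ t ∈ (extChartAt IM p₀).source → ∀ w : E × E₁, _ :=
      fun t ht p₀ hp w => (geodesic_equation_lorentzMetric (g := g) (c := c) (h.contMDiffAt ht) hp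
        w).symm.trans (h.equation t ht p₀ hp w)
    refine ⟨⟨h.isOpen, h.ordConnected, h.nonempty, contMDiff_fst.comp_contMDiffOn h.contMDiffOn,
      fun t ht z₀ hz w => ?_⟩, contMDiff_snd.comp_contMDiffOn h.contMDiffOn, fun t ht => ?_⟩
    · have h1 := heq t ht (z₀, (γ t).2) (by
        rw [extChartAt_prod]; exact ⟨hz, mem_extChartAt_source _⟩) (w, 0)
      simpa using h1
    · have h1 := heq t ht (γ t) (mem_extChartAt_source _) (0, EuclideanSpace.single 0 1)
      have h2 : angularForm (γ t).2 (extChartAt (𝓡 1) (γ t).2 (γ t).2)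
          (EuclideanSpace.single 0 1) ≠ 0 :=
        angularForm_ne_zero (mem_extChartAt_target _) (by simp)
      have h3 : ∀ (x₁ : ℝ → E), localMetric g.form (γ t).1 (x₁ t) (deriv (deriv x₁) t) 0
          + christoffel (localMetric g.form (γ t).1) (x₁ t) (deriv x₁ t) (deriv x₁ t) 0 = 0 := by
        intro x₁
        have h5 : ∀ (z v : E), localMetric g.form (γ t).1 z v 0 = 0 := fun z v => by
          rw [localMetric_eq_gram, map_zero]
        simp [christoffel, h5]
      have h4 := (eq_of_sub_eq_zero h1).symm.trans (h3 fun s => extChartAt (𝓡 n) (γ t).1 (γ s).1)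
      exact ((mul_eq_zero.1 h4).resolve_left hk |> mul_eq_zero.1).resolve_right h2
  · rintro ⟨h1, h2, h3⟩
    have hγ : ContMDiffOn 𝓘(ℝ, ℝ) IM ∞ γ J := h1.contMDiffOn.prodMk h2
    refine ⟨h1.isOpen, h1.ordConnected, h1.nonempty, hγ, fun t ht p₀ hp w => ?_⟩
    have hp' := hp
    rw [extChartAt_prod] at hp'
    refine (geodesic_equation_lorentzMetric (g := g) (c := c)
      (hγ.contMDiffAt (h1.isOpen.mem_nhds ht)) hp w).trans ?_
    rw [h3 t ht, zero_mul, mul_zero, sub_zero]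
    exact h1.equation t ht p₀.1 hp'.1 w.1

end Lorentz

lemma contMDiff_circleDt : ContMDiff (𝓡 1).tangent 𝓘(ℝ, ℝ) ∞ circleDt := by
  have h1 : ContMDiff (𝓡 1).tangent 𝓘(ℝ, ℂ) ∞
      (fun v : TangentBundle (𝓡 1) Circle => (v.1 : ℂ)) :=
    contMDiff_circle_coe.comp (contMDiff_proj (TangentSpace (𝓡 1) : Circle → Type _))
  have h2 : ContMDiff (𝓡 1).tangent 𝓘(ℝ, ℂ) ∞ (fun v : TangentBundle (𝓡 1) Circle =>
      ((tangentMap (𝓡 1) 𝓘(ℝ, ℂ) (fun z : Circle => (z : ℂ)) v).2 : ℂ)) :=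
    (contMDiff_snd_tangentBundle_modelSpace ℂ 𝓘(ℝ, ℂ)).comp
      (contMDiff_circle_coe.contMDiff_tangentMap (by simp))
  have h3 : ContDiff ℝ ∞ fun p : ℂ × ℂ => Complex.imCLM (Complex.conjCLE p.1 * p.2) :=
    Complex.imCLM.contDiff.comp ((Complex.conjCLE.contDiff.comp contDiff_fst).mul contDiff_snd)
  exact h3.contMDiff.comp (h1.prodMk_space h2)

lemma circleDt_ext {v w : TangentBundle (𝓡 1) Circle} (h : v.1 = w.1)
    (hd : circleDt v = circleDt w) : v = w := by
  obtain ⟨z, v⟩ := v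
  obtain ⟨z', w⟩ := w
  obtain rfl : z = z' := h
  exact congrArg (TotalSpace.mk z) (dtCircle_injective z hd)

/-! ### Null geodesics and the map from STZ onto them. -/

section Null

variable {n : ℕ} {Z : Type*} [TopologicalSpace Z] [ChartedSpace (EuclideanSpace ℝ (Fin n)) Z]
  [IsManifold (𝓡 n) ∞ Z] {g : RiemannianMetric n Z} {c : ℕ}

local notation "E" => EuclideanSpace ℝ (Fin n)
local notation "E₁" => EuclideanSpace ℝ (Fin 1)
local notation "IM" => ModelWithCorners.prod (𝓡 n) (𝓡 1)

/-- The space component of a tangent vector of `Z × S¹`. -/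
abbrev spacePart (v : TangentBundle IM (Z × Circle)) : TangentBundle (𝓡 n) Z :=
  tangentMap IM (𝓡 n) Prod.fst v

/-- The time component of a tangent vector of `Z × S¹`. -/
abbrev timePart (v : TangentBundle IM (Z × Circle)) : TangentBundle (𝓡 1) Circle :=
  tangentMap IM (𝓡 1) Prod.snd v

lemma contMDiff_spacePart : ContMDiff (ModelWithCorners.tangent IM) (𝓡 n).tangent ∞
    (spacePart (n := n) (Z := Z)) :=
  contMDiff_fst.contMDiff_tangentMap (n := ∞) (by simp)

lemma contMDiff_timePart : ContMDiff (ModelWithCorners.tangent IM) (𝓡 1).tangent ∞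
    (timePart (n := n) (Z := Z)) :=
  contMDiff_snd.contMDiff_tangentMap (n := ∞) (by simp)

omit [IsManifold (𝓡 n) ∞ Z] in
lemma tangentBundle_prod_ext {v w : TangentBundle IM (Z × Circle)}
    (h1 : spacePart v = spacePart w) (h2 : timePart v = timePart w) : v = w := by
  rw [spacePart, spacePart, tangentMap_prodFst, tangentMap_prodFst] at h1
  rw [timePart, timePart, tangentMap_prodSnd, tangentMap_prodSnd] at h2
  exact (equivTangentBundleProd (𝓡 n) Z (𝓡 1) Circle).injective (Prod.ext h1 h2)

omit [IsManifold (𝓡 n) ∞ Z] in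
lemma spacePart_velocity {γ : ℝ → Z × Circle} {s : ℝ} (h : MDifferentiableAt 𝓘(ℝ, ℝ) IM γ s) :
    spacePart (velocity IM γ s) = velocity (𝓡 n) (fun r => (γ r).1) s :=
  (velocity_comp_eq_tangentMap (f := (Prod.fst : Z × Circle → Z)) mdifferentiableAt_fst h).symm

omit [IsManifold (𝓡 n) ∞ Z] in
lemma timePart_velocity {γ : ℝ → Z × Circle} {s : ℝ} (h : MDifferentiableAt 𝓘(ℝ, ℝ) IM γ s) :
    timePart (velocity IM γ s) = velocity (𝓡 1) (fun r => (γ r).2) s :=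
  (velocity_comp_eq_tangentMap (f := (Prod.snd : Z × Circle → Circle)) mdifferentiableAt_snd h).symm

/-- Positivity of dt already implies that the vector is nonzero. The null condition ties the speed
in `Z` to the angular velocity. -/
lemma mem_futureCone_iff {v : TangentBundle IM (Z × Circle)} :
    v ∈ futureCone (lorentzMetric g c) dt ↔ 0 < circleDt (timePart v) ∧
      normSq g (spacePart v) = 1 / (c : ℝ) ^ 2 * circleDt (timePart v) ^ 2 := by
  have h1 : lorentzMetric g c v.1 v.2 v.2
      = normSq g (spacePart v) - 1 / (c : ℝ) ^ 2 * (circleDt (timePart v) * circleDt (timePart v)) :=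
    rfl
  have h2 : dt v.1 v.2 = circleDt (timePart v) := rfl
  change v.2 ≠ 0 ∧ lorentzMetric g c v.1 v.2 v.2 = 0 ∧ 0 < dt v.1 v.2 ↔ _
  rw [h1, h2, sub_eq_zero, ← sq]
  constructor
  · exact fun h => ⟨h.2.2, h.2.1⟩
  · refine fun h => ⟨fun h0 => h.1.ne' ?_, h.2, h.1⟩
    rw [← h2, h0]
    exact map_zero (dt v.1)

lemma normSq_smul (x : Z) (a : ℝ) (v : TangentSpace (𝓡 n) x) :
    normSq g ⟨x, a • v⟩ = a ^ 2 * normSq g ⟨x, v⟩ := by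
  let B : E →L[ℝ] E →L[ℝ] ℝ := g.inner x
  have h : ∀ v, B (a • v) (a • v) = a ^ 2 * B v v := fun v => by
    rw [map_smul, map_smul, smul_apply, smul_eq_mul, smul_eq_mul]
    ring
  exact h v

/-- The unit vector that generates the projection to `Z` of a null geodesic. -/
def futureConeUnit (hc : 0 < c) (v : futureCone (lorentzMetric g c) dt) : unitTangentBundle g :=
  ⟨⟨v.1.1.1, (c / circleDt (timePart v.1)) • (spacePart v.1).2⟩, by
    obtain ⟨h1, h2⟩ := mem_futureCone_iff.1 v.2
    rw [mem_unitTangentBundle]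
    refine (normSq_smul _ _ _).trans ?_
    change (c / circleDt (timePart v.1)) ^ 2 * normSq g (spacePart v.1) = 1
    rw [h2]
    have : (c : ℝ) ≠ 0 := by positivity
    field_simp⟩

namespace IsZoll

variable (hZ : IsZoll g)

variable (c) in
/-- The null geodesics, parametrized affinely. -/
def nullCurve (u : unitTangentBundle g) (a b : ℝ) (s : ℝ) : Z × Circle :=
  -- Speed `a` in `Z` goes with angular velocity `c * a`; the offset `b` moves the angle by `c * b`,
  -- so parameter zero of the line is always at time zero.
  (hZ.line u (a * s + b), Circle.exp (c * a * s + c * b))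

lemma contMDiff_nullCurve (u : unitTangentBundle g) (a b : ℝ) :
    ContMDiff 𝓘(ℝ, ℝ) IM ∞ (hZ.nullCurve c u a b) :=
  ((hZ.isGeodesicOn_line u).comp_affine a b).contMDiff.prodMk (contMDiff_circleExp_affine _ _)

lemma isGeodesicOn_nullCurve (hc : 0 < c) (u : unitTangentBundle g) (a b : ℝ) :
    IsGeodesicOn (lorentzMetric g c) (hZ.nullCurve c u a b) univ := by
  refine (isGeodesicOn_lorentzMetric_iff hc).2 ⟨(hZ.isGeodesicOn_line u).comp_affine a b,
    (contMDiff_circleExp_affine _ _).contMDiffOn, fun t _ => ?_⟩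
  have h : (fun s => circleDt (velocity (𝓡 1) (fun r => (hZ.nullCurve c u a b r).2) s))
      = fun _ => (c * a : ℝ) := funext fun s => circleDt_velocity_exp _ _ s
  rw [h, deriv_const]

lemma velocity_line_affine (u : unitTangentBundle g) (a b s : ℝ) :
    velocity (𝓡 n) (fun r => hZ.line u (a * r + b)) s
      = ⟨hZ.line u (a * s + b), a • (hZ.flow (a * s + b) u).1.2⟩ :=
  velocity_comp_mul (hZ.line u) a b s ((hZ.isGeodesicOn_line u).mdifferentiableAt (mem_univ _))

lemma velocity_nullCurve_mem (hc : 0 < c) (u : unitTangentBundle g) {a : ℝ} (ha : 0 < a) (b s : ℝ) :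
    velocity IM (hZ.nullCurve c u a b) s ∈ futureCone (lorentzMetric g c) dt := by
  have hd := (hZ.contMDiff_nullCurve (c := c) u a b).mdifferentiable (by simp) s
  have hc' : (0 : ℝ) < c := by exact_mod_cast hc
  rw [mem_futureCone_iff, spacePart_velocity hd, timePart_velocity hd]
  have h1 : circleDt (velocity (𝓡 1) (fun r => (hZ.nullCurve c u a b r).2) s) = c * a :=
    circleDt_velocity_exp _ _ s
  have h2 : normSq g (velocity (𝓡 n) (fun r => (hZ.nullCurve c u a b r).1) s) = a ^ 2 := by
    change normSq g (velocity (𝓡 n) (fun r => hZ.line u (a * r + b)) s) = a ^ 2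
    rw [velocity_line_affine]
    refine (normSq_smul _ _ _).trans ?_
    have : normSq g ⟨hZ.line u (a * s + b), (hZ.flow (a * s + b) u).1.2⟩ = 1 :=
      (hZ.flow (a * s + b) u).2
    exact (congrArg (a ^ 2 * ·) this).trans (mul_one _)
  rw [h1, h2]
  refine ⟨by positivity, ?_⟩
  field_simp

variable [T2Space Z]

/-- A geodesic with the same initial velocity as a null curve agrees with it. -/
lemma eqOn_nullCurve (hc : 0 < c) {γ : ℝ → Z × Circle} {J : Set ℝ}
    (hγ : IsGeodesicOn (lorentzMetric g c) γ J) {t₀ : ℝ} (ht₀ : t₀ ∈ J) {u : unitTangentBundle g}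
    {a b : ℝ} (h : velocity IM γ t₀ = velocity IM (hZ.nullCurve c u a b) t₀) :
    EqOn γ (hZ.nullCurve c u a b) J := by
  obtain ⟨h1, h2, h3⟩ := (isGeodesicOn_lorentzMetric_iff hc).1 hγ
  have hd := (hZ.contMDiff_nullCurve (c := c) u a b).mdifferentiable (by simp) t₀
  have hs := congrArg spacePart h
  have ht := congrArg timePart h
  rw [spacePart_velocity hd, spacePart_velocity (hγ.mdifferentiableAt ht₀)] at hs
  rw [timePart_velocity hd, timePart_velocity (hγ.mdifferentiableAt ht₀)] at ht
  have hline : EqOn (velocity (𝓡 n) fun s => (γ s).1)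
      (velocity (𝓡 n) fun s => hZ.line u (a * s + b)) J :=
    h1.velocity_eqOn (((hZ.isGeodesicOn_line u).comp_affine a b).mono (subset_univ J) hγ.isOpen
      hγ.ordConnected hγ.nonempty) ht₀ hs
  let κ : ℝ → Circle := fun s => (γ s).2
  have hvel : ContMDiffOn 𝓘(ℝ, ℝ) (𝓡 1).tangent ∞ (velocity (𝓡 1) κ) J :=
    ContMDiffOn.velocity hγ.isOpen h2
  have hdt : DifferentiableOn ℝ (fun s => circleDt (velocity (𝓡 1) κ s)) J := by
    rw [← mdifferentiableOn_iff_differentiableOn]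
    exact (contMDiff_circleDt.comp_contMDiffOn hvel).mdifferentiableOn (by simp)
  have hconst : ∀ s ∈ J, circleDt (velocity (𝓡 1) κ s) = c * a := by
    intro s hs
    have h4 := hγ.ordConnected.convex.is_const_of_fderivWithin_eq_zero (𝕜 := ℝ) hdt
      (fun r hr => by
        rw [fderivWithin_of_isOpen hγ.isOpen hr]
        ext
        simpa using h3 r hr) hs ht₀
    rw [h4]
    exact (congrArg circleDt ht).trans (circleDt_velocity_exp _ _ t₀)
  have hκ := eqOn_circleExp_of_circleDt hγ.isOpen hγ.ordConnected
    (fun s hs => (h2.contMDiffAt (hγ.isOpen.mem_nhds hs)).mdifferentiableAt (by simp)) hconst ht₀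
  intro s hsJ
  refine Prod.ext (congrArg (fun v => v.1) (hline hsJ)) ?_
  have h5 : κ t₀ = Circle.exp (c * a * t₀ + c * b) := congrArg (fun v => v.1) ht
  change κ s = Circle.exp (c * a * s + c * b)
  have h6 : κ s = Circle.exp (c * a * (s - t₀)) * κ t₀ := hκ s hsJ
  rw [h6, h5, ← Circle.exp_add]
  congr 1
  ring

/-- The normalized space part of `v` sits at angle θ, which the line reaches at parameter θ/c.
Flowing it back by θ/c gives the unit vector at time zero. The speed in `Z` is the angular velocity
of `v` divided by `c`. -/
lemma velocity_nullCurve_futureConeUnit (hc : 0 < c) (v : futureCone (lorentzMetric g c) dt) {θ : ℝ}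
    (hθ : Circle.exp θ = v.1.1.2) :
    velocity IM (hZ.nullCurve c (hZ.flow (-(θ / c)) (futureConeUnit hc v))
      (circleDt (timePart v.1) / c) (θ / c)) 0 = v := by
  have hc' : (c : ℝ) ≠ 0 := by positivity
  obtain ⟨hpos, -⟩ := mem_futureCone_iff.1 v.2
  set u₀ := futureConeUnit hc v
  set a := circleDt (timePart v.1) / c
  have hd := (hZ.contMDiff_nullCurve (c := c) (hZ.flow (-(θ / c)) u₀) a (θ / c)).mdifferentiable
    (by simp) 0
  refine tangentBundle_prod_ext ?_ ?_
  · rw [spacePart_velocity hd]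
    change velocity (𝓡 n) (fun r => hZ.line (hZ.flow (-(θ / c)) u₀) (a * r + θ / c)) 0 = _
    rw [velocity_line_affine]
    have h1 : hZ.flow (a * 0 + θ / c) (hZ.flow (-(θ / c)) u₀) = u₀ := by
      rw [← flow_add, mul_zero, zero_add, add_neg_cancel, flow_zero]
    have h2 : (⟨(hZ.flow (a * 0 + θ / c) (hZ.flow (-(θ / c)) u₀)).1.1,
        a • (hZ.flow (a * 0 + θ / c) (hZ.flow (-(θ / c)) u₀)).1.2⟩ : TangentBundle (𝓡 n) Z)
        = ⟨u₀.1.1, a • u₀.1.2⟩ := by rw [h1]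
    refine h2.trans ?_
    have h3 : ∀ w : E, a • (c / circleDt (timePart v.1)) • w = w := fun w => by
      rw [smul_smul]
      have : a * (c / circleDt (timePart v.1)) = 1 := by
        simp only [a]
        field_simp
      rw [this, one_smul]
    exact congrArg (fun w => (⟨v.1.1.1, w⟩ : TangentBundle (𝓡 n) Z)) (h3 _)
  · rw [timePart_velocity hd]
    refine circleDt_ext ?_ ?_
    · change Circle.exp (c * a * 0 + c * (θ / c)) = v.1.1.2
      rw [← hθ]
      congr 1
      field_simp
      ring
    · refine (circleDt_velocity_exp _ _ 0).trans ?_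
      simp only [a]
      field_simp

omit [T2Space Z] in
lemma isMaximalGeodesic_nullCurve (hc : 0 < c) (u : unitTangentBundle g) (a b : ℝ) :
    IsMaximalGeodesic (lorentzMetric g c) (hZ.nullCurve c u a b) univ :=
  ⟨hZ.isGeodesicOn_nullCurve hc u a b, fun _ _ _ h _ => univ_subset_iff.1 h⟩

omit [T2Space Z] in
lemma range_nullCurve (u : unitTangentBundle g) {a : ℝ} (ha : a ≠ 0) (b : ℝ) :
    range (hZ.nullCurve c u a b) = range (hZ.nullCurve c u 1 0) := by
  have h1 : hZ.nullCurve c u a b = hZ.nullCurve c u 1 0 ∘ fun s => a * s + b := by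
    funext s
    simp only [nullCurve, Function.comp]
    congr 2 <;> ring
  have h2 : Function.Surjective fun s : ℝ => a * s + b := fun s => ⟨(s - b) / a, by field_simp; ring⟩
  rw [h1, h2.range_comp]

/-- The null geodesic of `Z × S¹` generated by a unit vector at time zero. -/
def toNullGeodesic (hc : 0 < c) (u : unitTangentBundle g) : NullGeodesic (lorentzMetric g c) dt :=
  ⟨range (hZ.nullCurve c u 1 0), hZ.nullCurve c u 1 0, univ,
    hZ.isMaximalGeodesic_nullCurve hc u 1 0,
    fun s _ => hZ.velocity_nullCurve_mem hc u one_pos 0 s, image_univ.symm⟩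

/-- A null geodesic agrees on its interval with a null curve. The latter is a geodesic on the whole
line, so maximality forces the interval to be the line. -/
lemma toNullGeodesic_surjective (hc : 0 < c) : Function.Surjective (hZ.toNullGeodesic hc) := by
  rintro ⟨A, γ, J, hγ, hv, rfl⟩
  obtain ⟨t₀, ht₀⟩ := hγ.1.nonempty
  let v : futureCone (lorentzMetric g c) dt := ⟨velocity IM γ t₀, hv t₀ ht₀⟩
  obtain ⟨θ, hθ⟩ := Circle.exp_surjective v.1.1.2
  obtain ⟨hpos, -⟩ := mem_futureCone_iff.1 v.2
  have ha : circleDt (timePart v.1) / c ≠ 0 := by positivity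
  set a := circleDt (timePart v.1) / c
  let u := hZ.flow (-(θ / c)) (futureConeUnit hc v)
  have h1 := hZ.velocity_nullCurve_futureConeUnit hc v hθ
  have hsh : hZ.nullCurve c u a (θ / c - a * t₀)
      = fun s => hZ.nullCurve c u a (θ / c) (1 * s + -t₀) := by
    funext s
    simp only [nullCurve]
    congr 2 <;> ring
  have h2 : velocity IM γ t₀ = velocity IM (hZ.nullCurve c u a (θ / c - a * t₀)) t₀ := by
    rw [hsh, velocity_comp_mul _ _ _ _
      ((hZ.contMDiff_nullCurve u a (θ / c)).mdifferentiable (by simp) _)]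
    have h3 : (1 : ℝ) * t₀ + -t₀ = 0 := by ring
    rw [h3]
    refine (show velocity IM γ t₀ = v.1 from rfl).trans (h1.symm.trans ?_)
    exact congrArg (TotalSpace.mk _) (one_smul ℝ _).symm
  have h3 := hZ.eqOn_nullCurve hc hγ.1 ht₀ h2
  have hJ := hγ.2 _ univ (hZ.isGeodesicOn_nullCurve hc u a (θ / c - a * t₀)) (subset_univ J) h3.symm
  subst hJ
  refine ⟨u, Subtype.ext ?_⟩
  change range (hZ.nullCurve c u 1 0) = γ '' univ
  rw [image_univ, show γ = _ from funext fun s => h3 (mem_univ s), hZ.range_nullCurve u ha]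

omit [T2Space Z] in
variable (c) in
/-- An integer number of turns amounts to fewer than `c` of them. -/
lemma line_add_turns (hc : 0 < c) (u : unitTangentBundle g) (s : ℝ) (m : ℤ) :
    ∃ i : Fin c, hZ.line u (s + m * (2 * Real.pi / c)) = hZ.line u (s + i * (2 * Real.pi / c)) := by
  have hc' : (c : ℤ) ≠ 0 := by exact_mod_cast hc.ne'
  have hcr : (c : ℝ) ≠ 0 := by positivity
  have h0 := Int.emod_nonneg m hc'
  have h1 := Int.emod_lt_of_pos m (by exact_mod_cast hc : (0 : ℤ) < c)
  refine ⟨⟨(m % c).toNat, by omega⟩, ?_⟩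
  have h2 : (((m % c).toNat : ℕ) : ℝ) = ((m % c : ℤ) : ℝ) := by
    rw [← Int.cast_natCast, Int.toNat_of_nonneg h0]
  have h3 : (m : ℝ) = ((m % c : ℤ) : ℝ) + c * ((m / c : ℤ) : ℝ) := by
    exact_mod_cast (Int.emod_add_mul_ediv m c).symm
  have h4 : s + m * (2 * Real.pi / c)
      = s + ((m % c : ℤ) : ℝ) * (2 * Real.pi / c) + ((m / c : ℤ) : ℝ) * (2 * Real.pi) := by
    rw [h3]
    field_simp
    ring
  simp only [h2]
  rw [h4]
  exact (hZ.periodic_line u).int_mul _ _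

lemma circleExp_eq_iff (hc : 0 < c) {s t : ℝ} :
    Circle.exp (c * s) = Circle.exp (c * t) ↔ ∃ m : ℤ, s = t + m * (2 * Real.pi / c) := by
  have hcr : (c : ℝ) ≠ 0 := by positivity
  rw [Circle.exp_eq_exp]
  refine exists_congr fun m => ?_
  constructor
  · intro h
    field_simp
    linarith
  · rintro rfl
    field_simp

omit [T2Space Z] in
lemma nullCurve_one_zero (u : unitTangentBundle g) (s : ℝ) :
    hZ.nullCurve c u 1 0 s = (hZ.line u s, Circle.exp (c * s)) := by
  simp [nullCurve]

/-- Advancing the line by m·2π/c advances the angle by m full turns, so the null curve is only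
reparametrized. -/
lemma toNullGeodesic_flow (hc : 0 < c) (u : unitTangentBundle g) (m : ℤ) :
    hZ.toNullGeodesic hc (hZ.flow (m * (2 * Real.pi / c)) u) = hZ.toNullGeodesic hc u := by
  refine Subtype.ext ?_
  change range _ = range _
  have h : hZ.nullCurve c (hZ.flow (m * (2 * Real.pi / c)) u) 1 0
      = hZ.nullCurve c u 1 0 ∘ fun s => s + m * (2 * Real.pi / c) := by
    funext s
    simp only [Function.comp, nullCurve_one_zero, line_flow]
    exact Prod.ext rfl ((circleExp_eq_iff hc).2 ⟨-m, by push_cast; ring⟩)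
  rw [h, (add_right_surjective _).range_comp]

/-- Each event of the first curve lies on the second, at a parameter differing by i·2π/c modulo the
period. The index i may depend on the event; `exists_eq_flow` finds one for which the geodesics
agree throughout. -/
lemma exists_eq_flow_of_toNullGeodesic_eq (hc : 0 < c) {u u' : unitTangentBundle g}
    (h : hZ.toNullGeodesic hc u = hZ.toNullGeodesic hc u') :
    ∃ i : Fin c, u = hZ.flow (i * (2 * Real.pi / c)) u' := by
  refine hZ.exists_eq_flow (fun i : Fin c => i * (2 * Real.pi / c)) fun s => ?_
  have h1 : hZ.nullCurve c u 1 0 s ∈ range (hZ.nullCurve c u' 1 0) := by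
    have h0 : range (hZ.nullCurve c u 1 0) = range (hZ.nullCurve c u' 1 0) :=
      congrArg Subtype.val h
    rw [← h0]
    exact mem_range_self s
  obtain ⟨s', hs'⟩ := h1
  rw [nullCurve_one_zero, nullCurve_one_zero] at hs'
  obtain ⟨m, hm⟩ := (circleExp_eq_iff hc).1 (congrArg Prod.snd hs')
  obtain ⟨i, hi⟩ := hZ.line_add_turns c hc u' s m
  exact ⟨i, by rw [← hi, ← hm]; exact (congrArg Prod.fst hs').symm⟩

-- The angle cθ recurs at parameters spaced by 2π/c, and c of these exhaust a period. Pulled back to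
-- STZ, a sky is therefore a union of c branches.
omit [T2Space Z] in
lemma toNullGeodesic_mem_sky (hc : 0 < c) {u : unitTangentBundle g} {z : Z} {θ : ℝ} :
    hZ.toNullGeodesic hc u ∈ sky (lorentzMetric g c) dt (z, Circle.exp (c * θ)) ↔
      ∃ i : Fin c, hZ.line u (θ + i * (2 * Real.pi / c)) = z := by
  change (z, Circle.exp (c * θ)) ∈ range (hZ.nullCurve c u 1 0) ↔ _
  constructor
  · rintro ⟨s, hs⟩
    rw [nullCurve_one_zero] at hs
    obtain ⟨m, hm⟩ := (circleExp_eq_iff hc).1 (congrArg Prod.snd hs)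
    obtain ⟨i, hi⟩ := hZ.line_add_turns c hc u θ m
    exact ⟨i, by rw [← hi, ← hm]; exact congrArg Prod.fst hs⟩
  · rintro ⟨i, hi⟩
    refine ⟨θ + i * (2 * Real.pi / c), ?_⟩
    rw [nullCurve_one_zero, hi]
    exact Prod.ext rfl ((circleExp_eq_iff hc).2 ⟨i, by simp⟩)

end IsZoll

end Null

/-! ### The manifold structure of C⁺. -/

section FutureCone

variable {n : ℕ} {Z : Type*} [TopologicalSpace Z] [ChartedSpace (EuclideanSpace ℝ (Fin n)) Z]
  [IsManifold (𝓡 n) ∞ Z] (g : RiemannianMetric n Z) {c : ℕ}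

local notation "E" => EuclideanSpace ℝ (Fin n)
local notation "E₁" => EuclideanSpace ℝ (Fin 1)
local notation "IM" => ModelWithCorners.prod (𝓡 n) (𝓡 1)

/-- Futurity is an open condition, and the null equation is regular on it: stretching only the space
component by 1 + s changes the equation at rate twice its squared norm, which is positive for null
vectors with dt > 0. -/
theorem exists_futureCone_manifold (hc : 0 < c) :
    ∃ _ : ChartedSpace (EuclideanSpace ℝ (Fin (2 * n + 1))) (futureCone (lorentzMetric g c) dt),
      IsManifold (𝓡 (2 * n + 1)) ∞ (futureCone (lorentzMetric g c) dt) ∧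
      IsSmoothEmbedding (𝓡 (2 * n + 1)) (ModelWithCorners.tangent IM) ∞
        (Subtype.val : futureCone (lorentzMetric g c) dt → TangentBundle IM (Z × Circle)) := by
  have hc' : (0 : ℝ) < c := by exact_mod_cast hc
  let F : TangentBundle IM (Z × Circle) → ℝ := fun v =>
    normSq g (spacePart v) - 1 / (c : ℝ) ^ 2 * circleDt (timePart v) ^ 2
  have ht : ContMDiff (ModelWithCorners.tangent IM) 𝓘(ℝ, ℝ) ∞
      fun v : TangentBundle IM (Z × Circle) => circleDt (timePart v) :=
    contMDiff_circleDt.comp contMDiff_timePart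
  have hF : ContMDiff (ModelWithCorners.tangent IM) 𝓘(ℝ, ℝ) ∞ F :=
    ((contMDiff_normSq g).comp contMDiff_spacePart).sub (contMDiff_const.mul (ht.pow 2))
  refine exists_levelSet_submanifold ?_ fun v hv => ?_
  · rw [Module.finrank_prod, Module.finrank_prod, finrank_euclideanSpace_fin,
      finrank_euclideanSpace_fin]
    omega
  · obtain ⟨h1, h2⟩ := mem_futureCone_iff.1 hv
    refine ⟨F, {w | 0 < circleDt (timePart w)}, isOpen_lt continuous_const ht.continuous, h1,
      hF.contMDiffOn, ?_, ?_⟩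
    · let a : E := v.2.1
      let b : E₁ := v.2.2
      let κ : ℝ → TangentBundle IM (Z × Circle) := fun s => ⟨v.1, ((1 + s) • a, b)⟩
      have hκ : ContMDiff 𝓘(ℝ, ℝ) (ModelWithCorners.tangent IM) ∞ κ := by
        refine contMDiff_tangentBundle_fiber (I := IM) v.1
          (v := fun s : ℝ => (((1 + s) • a, b) : E × E₁)) ?_
        exact (((contDiff_const.add contDiff_id).smul contDiff_const).prodMk contDiff_const :
          ContDiff ℝ ∞ fun s : ℝ => (((1 + s) • a, b) : E × E₁))
      have hκ0 : κ 0 = v := by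
        have h3 : (((1 + (0 : ℝ)) • a, b) : E × E₁) = v.2 := by
          rw [add_zero, one_smul]
          rfl
        exact congrArg (fun w : E × E₁ => (⟨v.1, w⟩ : TangentBundle IM (Z × Circle))) h3
      have hsp : normSq g (spacePart v) = normSq g ⟨v.1.1, a⟩ := by
        rw [spacePart, tangentMap_prodFst]
      have hval : (fun s => F (κ s)) = fun s => (1 + s) ^ 2 * normSq g (spacePart v)
          - 1 / (c : ℝ) ^ 2 * circleDt (timePart v) ^ 2 := by
        funext s
        have h3 : normSq g (spacePart (κ s)) = (1 + s) ^ 2 * normSq g (spacePart v) := by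
          rw [hsp, spacePart, tangentMap_prodFst]
          exact normSq_smul v.1.1 (1 + s) a
        have h4 : timePart (κ s) = timePart v := by
          rw [timePart, timePart, tangentMap_prodSnd, tangentMap_prodSnd]
        simp only [F, h3, h4]
      have hpos : 0 < normSq g (spacePart v) := by
        rw [h2]; positivity
      have hd : HasDerivAt (fun s => F (κ s)) (2 * normSq g (spacePart v)) 0 := by
        rw [hval]
        have := ((((hasDerivAt_id (0 : ℝ)).const_add 1).pow 2).mul_const
          (normSq g (spacePart v))).sub_const (1 / (c : ℝ) ^ 2 * circleDt (timePart v) ^ 2)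
        exact this.congr_deriv (by simp)
      have h5 := surjective_mfderiv_of_curve (f := F) (t := 0)
        (hF.mdifferentiable (by simp) (κ 0)) (hκ.mdifferentiable (by simp) 0)
        (mul_pos two_pos hpos).ne' hd
      rwa [hκ0] at h5
    · intro w hw
      rw [mem_futureCone_iff]
      exact ⟨fun h => sub_eq_zero.2 h.2, fun h => ⟨hw, sub_eq_zero.1 h⟩⟩

end FutureCone

/-! ### Descending maps and lifting curves along local diffeomorphisms. -/

section LocalDiffeo

variable {E : Type*} [NormedAddCommGroup E] [NormedSpace ℝ E]
  {H : Type*} [TopologicalSpace H] {I : ModelWithCorners ℝ E H}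
  {M : Type*} [TopologicalSpace M] [ChartedSpace H M]
  {E' : Type*} [NormedAddCommGroup E'] [NormedSpace ℝ E']
  {H' : Type*} [TopologicalSpace H'] {I' : ModelWithCorners ℝ E' H'}
  {N : Type*} [TopologicalSpace N] [ChartedSpace H' N]
  {E'' : Type*} [NormedAddCommGroup E''] [NormedSpace ℝ E'']
  {H'' : Type*} [TopologicalSpace H''] {I'' : ModelWithCorners ℝ E'' H''}
  {P : Type*} [TopologicalSpace P] [ChartedSpace H'' P]

lemma contMDiff_of_comp_isLocalDiffeomorph {r : M → N} (hr : IsLocalDiffeomorph I I' ∞ r)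
    (hs : Function.Surjective r) {f : N → P} (hf : ContMDiff I I'' ∞ fun x => f (r x)) :
    ContMDiff I' I'' ∞ f := by
  intro y
  obtain ⟨x, rfl⟩ := hs y
  have h1 := (hr x).localInverse_contMDiffAt
  refine (ContMDiffAt.comp (g := fun x => f (r x)) (r x) (hf _) h1).congr_of_eventuallyEq ?_
  filter_upwards [(hr x).localInverse_eventuallyEq_right] with z hz
  exact (congrArg f hz).symm

lemma IsLocalDiffeomorph.mfderiv_bijective {r : M → N} (hr : IsLocalDiffeomorph I I' ∞ r) (x : M) :
    Function.Bijective (mfderiv I I' r x) := by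
  rw [← hr.mfderivToContinuousLinearEquiv_coe (by simp)]
  exact (hr.mfderivToContinuousLinearEquiv (by simp) x).bijective

/-- Curves lift through local diffeomorphisms. -/
lemma exists_lift_of_isLocalDiffeomorph {r : M → N} (hr : IsLocalDiffeomorph I I' ∞ r) {x : M}
    {σ : ℝ → N} (hσ : ContMDiffAt 𝓘(ℝ, ℝ) I' ∞ σ 0) (h0 : σ 0 = r x) :
    ∃ w : ℝ → M, ContMDiffAt 𝓘(ℝ, ℝ) I ∞ w 0 ∧ w 0 = x ∧ (fun s => r (w s)) =ᶠ[𝓝 0] σ := by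
  let ρ := (hr x).localInverse
  have h1 : ContMDiffAt I' I ∞ ρ (σ 0) := by
    rw [h0]
    exact (hr x).localInverse_contMDiffAt
  refine ⟨fun s => ρ (σ s), ContMDiffAt.comp (g := ρ) 0 h1 hσ, ?_, ?_⟩
  · change ρ (σ 0) = x
    rw [h0]
    exact (hr x).localInverse_left_inv ((hr x).localInverse_mem_target)
  · have h2 := (hr x).localInverse_eventuallyEq_right
    rw [← h0] at h2
    filter_upwards [hσ.continuousAt.eventually h2] with s hs
    exact hs

end LocalDiffeo

/-! ### Descent of the contact structure to quotients. -/

section Pushforward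

variable {n : ℕ} {Z : Type*} [TopologicalSpace Z] [ChartedSpace (EuclideanSpace ℝ (Fin n)) Z]
  [IsManifold (𝓡 n) ∞ Z] {g : RiemannianMetric n Z}
  {d : ℕ} [ChartedSpace (EuclideanSpace ℝ (Fin d)) (unitTangentBundle g)]
  [IsManifold (𝓡 d) ∞ (unitTangentBundle g)]
  (hemb : IsSmoothEmbedding (𝓡 d) (𝓡 n).tangent ∞
    (Subtype.val : unitTangentBundle g → TangentBundle (𝓡 n) Z))
  {Y : Type*} [TopologicalSpace Y] [ChartedSpace (EuclideanSpace ℝ (Fin d)) Y]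

namespace IsZoll

variable (hZ : IsZoll g) [T2Space Z]

-- Represent ζ by a curve and flow the curve back: its velocity is a preimage of ζ.
include hemb in
lemma mfderiv_flow_neg (t : ℝ) (u : unitTangentBundle g)
    (ζ : TangentSpace (𝓡 d) (hZ.flow t u)) :
    ∃ ξ : TangentSpace (𝓡 d) u, mfderiv (𝓡 d) (𝓡 d) (hZ.flow t) u ξ = ζ := by
  obtain ⟨w, hw, hwζ⟩ := exists_velocity_eq
    (⟨hZ.flow t u, ζ⟩ : TangentBundle (𝓡 d) (unitTangentBundle g))
  have hf : ∀ t, ∀ v, MDifferentiableAt (𝓡 d) (𝓡 d) (hZ.flow t) v := fun t v =>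
    (hZ.contMDiff_flow_right hemb t).mdifferentiable (by simp) v
  have hwd : MDifferentiableAt 𝓘(ℝ, ℝ) (𝓡 d) w 0 := hw.mdifferentiableAt (by simp)
  have hwd' : MDifferentiableAt 𝓘(ℝ, ℝ) (𝓡 d) (fun s => hZ.flow (-t) (w s)) 0 :=
    MDifferentiableAt.comp (g := hZ.flow (-t)) 0 (hf _ _) hwd
  have h0 : (velocity (𝓡 d) (fun s => hZ.flow (-t) (w s)) 0).1 = u := by
    have h1 : w 0 = hZ.flow t u := congrArg (fun v => v.1) hwζ
    change hZ.flow (-t) (w 0) = u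
    rw [h1, ← flow_add, neg_add_cancel, flow_zero]
  have h2 := velocity_comp_eq_tangentMap (f := hZ.flow t) (hf _ _) hwd'
  have h3 : (fun s => hZ.flow t (hZ.flow (-t) (w s))) = w := by
    funext s
    rw [← flow_add, add_neg_cancel, flow_zero]
  rw [h3, hwζ] at h2
  generalize velocity (𝓡 d) (fun s => hZ.flow (-t) (w s)) 0 = v at h0 h2
  subst h0
  exact ⟨v.2, (eq_of_heq (TotalSpace.mk.inj h2).2).symm⟩

-- Invariance of the contact form gives one inclusion, and with surjectivity of the differential of
-- the flow also the other.
include hemb in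
lemma map_canonicalContact_flow (t : ℝ) (u : unitTangentBundle g) :
    (canonicalContact g (d := d) u).map (mfderiv (𝓡 d) (𝓡 d) (hZ.flow t) u).toLinearMap
      = canonicalContact g (hZ.flow t u) := by
  have h1 : ∀ ξ : TangentSpace (𝓡 d) u, contactForm g ⟨hZ.flow t u,
      mfderiv (𝓡 d) (𝓡 d) (hZ.flow t) u ξ⟩ = contactForm g ⟨u, ξ⟩ := fun ξ =>
    hZ.contactForm_tangentMap_flow hemb t ⟨u, ξ⟩
  ext ζ
  constructor
  · rintro ⟨ξ, hξ, rfl⟩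
    exact (mem_canonicalContact g).2 ((h1 ξ).trans hξ)
  · intro hζ
    obtain ⟨ξ, rfl⟩ := hZ.mfderiv_flow_neg hemb t u ζ
    exact ⟨ξ, (mem_canonicalContact g).2 ((h1 ξ).symm.trans hζ), rfl⟩

-- The chain rule for r ∘ flow_t = r, with the invariance of χ, shows that the image of χ does not
-- depend on the chosen preimage. Both sides are read in the model space because their base points
-- are equal only through `ht`.
include hemb in
lemma map_canonicalContact_eq {r : unitTangentBundle g → Y} (hr : ContMDiff (𝓡 d) (𝓡 d) ∞ r)
    {t : ℝ} (ht : ∀ v, r (hZ.flow t v) = r v) (u : unitTangentBundle g) :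
    ((canonicalContact g (d := d) (hZ.flow t u)).map
        (mfderiv (𝓡 d) (𝓡 d) r (hZ.flow t u)).toLinearMap :
          Submodule ℝ (EuclideanSpace ℝ (Fin d)))
      = (canonicalContact g u).map (mfderiv (𝓡 d) (𝓡 d) r u).toLinearMap := by
  have h1 : mfderiv (𝓡 d) (𝓡 d) (fun v => r (hZ.flow t v)) u
      = (mfderiv (𝓡 d) (𝓡 d) r (hZ.flow t u)).comp (mfderiv (𝓡 d) (𝓡 d) (hZ.flow t) u) :=
    mfderiv_comp (g := r) u (hr.mdifferentiable (by simp) _)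
      ((hZ.contMDiff_flow_right hemb t).mdifferentiable (by simp) u)
  rw [show (fun v => r (hZ.flow t v)) = r from funext ht] at h1
  have h2 : (mfderiv (𝓡 d) (𝓡 d) r u).toLinearMap
      = (mfderiv (𝓡 d) (𝓡 d) r (hZ.flow t u)).toLinearMap ∘ₗ
        (mfderiv (𝓡 d) (𝓡 d) (hZ.flow t) u).toLinearMap :=
    congrArg (fun L : EuclideanSpace ℝ (Fin d) →L[ℝ] EuclideanSpace ℝ (Fin d) => L.toLinearMap) h1
  rw [← hZ.map_canonicalContact_flow hemb t u]
  refine (Submodule.map_comp _ _ _).symm.trans ?_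
  exact congrArg (fun L : EuclideanSpace ℝ (Fin d) →ₗ[ℝ] EuclideanSpace ℝ (Fin d) =>
    (canonicalContact g u).map L) h2.symm

include hemb in
/-- The contact structure descends to quotients by time translations of the geodesic flow. -/
theorem exists_isPushforward {r : unitTangentBundle g → Y} (hr : ContMDiff (𝓡 d) (𝓡 d) ∞ r)
    (hs : Function.Surjective r)
    (hinv : ∀ u u', r u = r u' → ∃ t, u = hZ.flow t u' ∧ ∀ v, r (hZ.flow t v) = r v) :
    ∃ η : ∀ y : Y, Submodule ℝ (TangentSpace (𝓡 d) y),
      IsPushforward (𝓡 d) (𝓡 d) r (canonicalContact g) η := by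
  choose ρ hρ using hs
  let η : Y → Submodule ℝ (EuclideanSpace ℝ (Fin d)) := fun y =>
    (canonicalContact g (d := d) (ρ y)).map (mfderiv (𝓡 d) (𝓡 d) r (ρ y)).toLinearMap
  refine ⟨η, fun u => ?_⟩
  obtain ⟨t, ht, ht'⟩ := hinv (ρ (r u)) u (hρ (r u))
  have h1 := hZ.map_canonicalContact_eq hemb hr ht' u
  rw [← ht] at h1
  exact h1

end IsZoll

lemma IsPushforward.of_comp {Y' : Type*} [TopologicalSpace Y']
    [ChartedSpace (EuclideanSpace ℝ (Fin d)) Y'] {X : Type*} [TopologicalSpace X]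
    [ChartedSpace (EuclideanSpace ℝ (Fin d)) X] {r : X → Y} {f : Y → Y'}
    {χ : ∀ x : X, Submodule ℝ (TangentSpace (𝓡 d) x)}
    {η : ∀ y : Y, Submodule ℝ (TangentSpace (𝓡 d) y)}
    {η' : ∀ y : Y', Submodule ℝ (TangentSpace (𝓡 d) y)} (hr : MDifferentiable (𝓡 d) (𝓡 d) r)
    (hs : Function.Surjective r) (hf : MDifferentiable (𝓡 d) (𝓡 d) f)
    (h : IsPushforward (𝓡 d) (𝓡 d) r χ η)
    (h' : IsPushforward (𝓡 d) (𝓡 d) (fun x => f (r x)) χ η') :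
    IsPushforward (𝓡 d) (𝓡 d) f η η' := by
  intro y
  obtain ⟨x, rfl⟩ := hs y
  rw [h x]
  refine (h' x).trans ?_
  have h1 : mfderiv (𝓡 d) (𝓡 d) (fun x => f (r x)) x
      = (mfderiv (𝓡 d) (𝓡 d) f (r x)).comp (mfderiv (𝓡 d) (𝓡 d) r x) :=
    mfderiv_comp (g := f) x (hf _) (hr x)
  rw [h1]
  exact Submodule.map_comp _ _ _

end Pushforward

/-! ### Tangent spaces of skies and the canonical contact structure. -/

section Skies

variable {n : ℕ} {Z : Type*} [TopologicalSpace Z] [ChartedSpace (EuclideanSpace ℝ (Fin n)) Z]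
  [IsManifold (𝓡 n) ∞ Z] {g : RiemannianMetric n Z} {c : ℕ}
  {d : ℕ} [ChartedSpace (EuclideanSpace ℝ (Fin d)) (unitTangentBundle g)]
  [IsManifold (𝓡 d) ∞ (unitTangentBundle g)]
  (hemb : IsSmoothEmbedding (𝓡 d) (𝓡 n).tangent ∞
    (Subtype.val : unitTangentBundle g → TangentBundle (𝓡 n) Z))
  [TopologicalSpace (NullGeodesic (lorentzMetric g c) dt)]
  [ChartedSpace (EuclideanSpace ℝ (Fin d)) (NullGeodesic (lorentzMetric g c) dt)]
  (hZ : IsZoll g) [T2Space Z] (hc : 0 < c)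
  (hr : IsLocalDiffeomorph (𝓡 d) (𝓡 d) ∞ (hZ.toNullGeodesic hc))

local notation "𝔼" => EuclideanSpace ℝ (Fin d)

namespace IsZoll

include hemb hr in
/-- A vector tangent to a sky comes from a variation of unit vectors that fixes one of the points
where the geodesic meets the event. -/
lemma exists_of_velocity_mem_sky {u : unitTangentBundle g} {z : Z} {s : ℝ}
    {σ : ℝ → NullGeodesic (lorentzMetric g c) dt} (hσ : ContMDiff 𝓘(ℝ, ℝ) (𝓡 d) ∞ σ)
    (hsky : ∀ t, σ t ∈ sky (lorentzMetric g c) dt (z, Circle.exp (c * s))) {ξ : 𝔼}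
    (hv : velocity (𝓡 d) σ 0 = ⟨hZ.toNullGeodesic hc u, ξ⟩) :
    ∃ (i : Fin c) (ζ : 𝔼), mfderiv (𝓡 d) (𝓡 d) (hZ.toNullGeodesic hc) u ζ = ξ ∧
      hZ.line u (s + i * (2 * Real.pi / c)) = z ∧
      tangentMap (𝓡 d) (𝓡 n)
        (fun v => basePoint g (hZ.flow (s + i * (2 * Real.pi / c)) v)) ⟨u, ζ⟩
          = ⟨z, (0 : EuclideanSpace ℝ (Fin n))⟩ := by
  have hσ0 : σ 0 = hZ.toNullGeodesic hc u := congrArg (fun v => v.1) hv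
  -- Only the germ of σ at 0 matters, and it lifts to STZ through the point `u`.
  obtain ⟨w, hw, hw0, hrw⟩ := exists_lift_of_isLocalDiffeomorph hr (hσ 0) hσ0
  have hwd : MDifferentiableAt 𝓘(ℝ, ℝ) (𝓡 d) w 0 := hw.mdifferentiableAt (by simp)
  obtain ⟨ζ, hζ⟩ : ∃ ζ : 𝔼, velocity (𝓡 d) w 0 = ⟨u, ζ⟩ := by
    have h0 : (velocity (𝓡 d) w 0).1 = u := hw0
    generalize velocity (𝓡 d) w 0 = x at h0
    subst h0
    exact ⟨x.2, rfl⟩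
  have h1 := velocity_congr (I := 𝓡 d) hrw
  rw [velocity_comp_eq_tangentMap (hr.mdifferentiable (by simp) _) hwd, hζ, hv] at h1
  let τ : Fin c → ℝ := fun i => s + i * (2 * Real.pi / c)
  have hfd : ∀ i v, MDifferentiableAt (𝓡 d) (𝓡 n) (fun v => basePoint g (hZ.flow (τ i) v)) v :=
    fun i v => ((contMDiff_basePoint hemb).comp
      (hZ.contMDiff_flow_right hemb (τ i))).mdifferentiable (by simp) v
  -- The lift stays in the union of the c branches but may switch between them; the limiting
  -- velocity is nevertheless tangent to one branch.
  have h2 : ∀ᶠ t in 𝓝 (0 : ℝ), ∃ i, basePoint g (hZ.flow (τ i) (w t)) = z := by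
    filter_upwards [hrw] with t ht
    have h3 := hsky t
    rw [← ht] at h3
    exact (hZ.toNullGeodesic_mem_sky hc).1 h3
  obtain ⟨i, hi⟩ := exists_velocity_eq_zero (I := 𝓡 n)
    (fun i => MDifferentiableAt.comp (g := fun v => basePoint g (hZ.flow (τ i) v)) 0
      (hfd i _) hwd) h2
  have h4 := velocity_comp_eq_tangentMap (hfd i (w 0)) hwd
  rw [hζ] at h4
  refine ⟨i, ζ, eq_of_heq (TotalSpace.mk.inj h1).2, ?_, h4.symm.trans hi⟩
  have h5 := congrArg (fun v => v.1) hi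
  change basePoint g (hZ.flow (τ i) (w 0)) = z at h5
  rw [hw0] at h5
  exact h5

omit [T2Space Z] [TopologicalSpace (NullGeodesic (lorentzMetric g c) dt)] in
lemma exists_eq_of_mem_toNullGeodesic {u : unitTangentBundle g} {x : Z × Circle}
    (hx : x ∈ (hZ.toNullGeodesic hc u).1) : ∃ s : ℝ, x = (hZ.line u s, Circle.exp (c * s)) := by
  obtain ⟨s, hs⟩ := hx
  exact ⟨s, by rw [← hs, nullCurve_one_zero]⟩

-- The lifted variation becomes vertical when flowed to the time at which its geodesic meets the
-- event. There the contact form vanishes on it, and the form is invariant under the flow.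
include hemb hr in
lemma skyTangent_le {u : unitTangentBundle g} {x : Z × Circle}
    (hx : x ∈ (hZ.toNullGeodesic hc u).1) :
    skyTangent (𝓡 d) x (hZ.toNullGeodesic hc u) ≤
      (canonicalContact g u).map (mfderiv (𝓡 d) (𝓡 d) (hZ.toNullGeodesic hc) u).toLinearMap := by
  obtain ⟨s, rfl⟩ := hZ.exists_eq_of_mem_toNullGeodesic hc hx
  refine Submodule.span_le.2 ?_
  rintro ξ ⟨σ, hσ, hsky, hv⟩
  obtain ⟨i, ζ, h1, -, h2⟩ := hZ.exists_of_velocity_mem_sky hemb hc hr hσ hsky hv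
  refine ⟨ζ, (mem_canonicalContact g).2 ?_, h1⟩
  set t := s + i * (2 * Real.pi / c)
  rw [← hZ.contactForm_tangentMap_flow hemb t]
  have h3 : tangentMap (𝓡 d) (𝓡 n) (basePoint g)
      (tangentMap (𝓡 d) (𝓡 d) (hZ.flow t) ⟨u, ζ⟩) = ⟨hZ.line u s, (0 : EuclideanSpace ℝ (Fin n))⟩ := by
    rw [← h2]
    exact (tangentMap_comp_at (g := basePoint g) (f := hZ.flow t)
      (⟨u, ζ⟩ : TangentBundle (𝓡 d) (unitTangentBundle g))
      ((contMDiff_basePoint hemb).mdifferentiable (by simp) _)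
      ((hZ.contMDiff_flow_right hemb t).mdifferentiable (by simp) _)).symm
  generalize tangentMap (𝓡 d) (𝓡 d) (hZ.flow t) ⟨u, ζ⟩ = v at h3
  have h4 : mfderiv (𝓡 d) (𝓡 n) (basePoint g) v.1 v.2 = (0 : EuclideanSpace ℝ (Fin n)) :=
    eq_of_heq (TotalSpace.mk.inj h3).2
  let B : EuclideanSpace ℝ (Fin n) →L[ℝ] ℝ := g.inner v.1.1.1 v.1.1.2
  exact (congrArg B h4).trans (map_zero B)

-- Unit vectors at the point of `Z` below the event, flowed back by `s`, form the branch i = 0 of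
-- the sky. The flow and `toNullGeodesic` have injective differentials, so the dimension n - 1 of
-- the vertical space survives.
include hemb hr in
lemma le_finrank_skyTangent {u : unitTangentBundle g} {x : Z × Circle}
    (hx : x ∈ (hZ.toNullGeodesic hc u).1) :
    n ≤ Module.finrank ℝ (skyTangent (𝓡 d) x (hZ.toNullGeodesic hc u)) + 1 := by
  obtain ⟨s, rfl⟩ := hZ.exists_eq_of_mem_toNullGeodesic hc hx
  let r := hZ.toNullGeodesic hc
  let u' := hZ.flow s u
  let f : unitTangentBundle g → NullGeodesic (lorentzMetric g c) dt := fun v => r (hZ.flow (-s) v)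
  have hf : ContMDiff (𝓡 d) (𝓡 d) ∞ f := hr.contMDiff.comp (hZ.contMDiff_flow_right hemb (-s))
  have hu' : hZ.flow (-s) u' = u := by rw [← flow_add, neg_add_cancel, flow_zero]
  let A : 𝔼 →L[ℝ] 𝔼 := mfderiv (𝓡 d) (𝓡 d) f u'
  have hA : Function.Injective A := by
    have h1 : A = (mfderiv (𝓡 d) (𝓡 d) r (hZ.flow (-s) u')).comp
        (mfderiv (𝓡 d) (𝓡 d) (hZ.flow (-s)) u') :=
      mfderiv_comp (g := r) u' (hr.mdifferentiable (by simp) _)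
        ((hZ.contMDiff_flow_right hemb (-s)).mdifferentiable (by simp) u')
    let A₁ : 𝔼 →L[ℝ] 𝔼 := mfderiv (𝓡 d) (𝓡 d) r (hZ.flow (-s) u')
    let A₂ : 𝔼 →L[ℝ] 𝔼 := mfderiv (𝓡 d) (𝓡 d) (hZ.flow (-s)) u'
    have h2 : Function.Injective A₁ := (IsLocalDiffeomorph.mfderiv_bijective hr _).1
    have h3 : Function.Surjective A₂ := fun ζ => hZ.mfderiv_flow_neg hemb (-s) u' ζ
    have h4 : Function.Injective A₂ := LinearMap.injective_iff_surjective.2 h3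
    have h5 : ∀ v, A v = A₁ (A₂ v) := fun v => congrArg (fun L : 𝔼 →L[ℝ] 𝔼 => L v) h1
    intro a b hab
    rw [h5, h5] at hab
    exact h4 (h2 hab)
  let V : Submodule ℝ 𝔼 := Submodule.span ℝ (verticalVelocities g (d := d) u')
  let S : Submodule ℝ 𝔼 := skyTangent (𝓡 d) (hZ.line u s, Circle.exp (c * s)) (r u)
  have hle : V.map A.toLinearMap ≤ S := by
    refine Submodule.map_le_iff_le_comap.2 (Submodule.span_le.2 ?_)
    rintro ζ ⟨κ, hκ, hκz, hκv⟩
    refine Submodule.subset_span ⟨fun t => f (κ t), hf.comp hκ, fun t => ?_, ?_⟩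
    · refine (hZ.toNullGeodesic_mem_sky hc).2 ⟨⟨0, hc⟩, ?_⟩
      have h1 : hZ.line (hZ.flow (-s) (κ t)) (s + (0 : ℕ) * (2 * Real.pi / c))
          = basePoint g (κ t) := by
        rw [line_flow, Nat.cast_zero, zero_mul, add_zero, add_neg_cancel, ← flow_fst, flow_zero]
        rfl
      exact h1.trans (hκz t)
    · rw [velocity_comp_eq_tangentMap (f := f) (hf.mdifferentiable (by simp) _)
        (hκ.mdifferentiable (by simp) 0), hκv]
      change (⟨r (hZ.flow (-s) u'), A ζ⟩ :
        TangentBundle (𝓡 d) (NullGeodesic (lorentzMetric g c) dt)) = ⟨r u, A ζ⟩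
      rw [hu']
  have h1 := Submodule.finrank_mono hle
  have h2 : Module.finrank ℝ (V.map A.toLinearMap) = Module.finrank ℝ V :=
    (Submodule.equivMapOfInjective A.toLinearMap hA V).finrank_eq.symm
  have h3 : n ≤ Module.finrank ℝ V + 1 := le_finrank_span_verticalVelocities hemb u'
  change n ≤ Module.finrank ℝ S + 1
  omega

include hemb hr in
/-- On every null geodesic there are nonconjugate points. -/
theorem exists_notConjugate (u : unitTangentBundle g) :
    ∃ x ∈ (hZ.toNullGeodesic hc u).1, ∃ y ∈ (hZ.toNullGeodesic hc u).1,
      NotConjugate (𝓡 d) x y (hZ.toNullGeodesic hc u) := by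
  have hcr : (0 : ℝ) < c := by exact_mod_cast hc
  let τ : Fin c → ℝ := fun i => i * (2 * Real.pi / c)
  -- the times at which the geodesic does not meet itself after part of a turn
  let G : Set ℝ := {s | ∀ i : Fin c, (i : ℕ) ≠ 0 → hZ.line u (s + τ i) ≠ hZ.line u s}
  have hline : Continuous (hZ.line u) := (hZ.isGeodesicOn_line u).contMDiff.continuous
  have hG : IsOpen G := by
    have h1 : G = ⋂ i : Fin c, {s | (i : ℕ) ≠ 0 → hZ.line u (s + τ i) ≠ hZ.line u s} := by
      ext s
      simp [G]
    rw [h1]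
    refine isOpen_iInter_of_finite fun i => ?_
    by_cases hi : (i : ℕ) = 0
    · simp [hi]
    · simp only [hi, ne_eq, not_false_eq_true, true_implies]
      exact (isClosed_eq (hline.comp (continuous_id.add continuous_const)) hline).isOpen_compl
  -- Otherwise the geodesic always meets one of its shifts by i/c of a turn with 0 < i < c. By
  -- `exists_eq_flow` one such shift would be a period, against minimality of 2π.
  obtain ⟨s, hs⟩ : G.Nonempty := by
    by_contra hne
    rw [not_nonempty_iff_eq_empty] at hne
    have h1 : ∀ s, ∃ i : {i : Fin c // (i : ℕ) ≠ 0}, hZ.line u s = hZ.line u (s + τ i) := by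
      intro s
      have h2 : s ∉ G := by rw [hne]; exact notMem_empty s
      simp only [G, mem_ofPred_eq, not_forall, not_not] at h2
      obtain ⟨i, hi, h3⟩ := h2
      exact ⟨⟨i, hi⟩, h3.symm⟩
    obtain ⟨i, hi⟩ := hZ.exists_eq_flow (fun i : {i : Fin c // (i : ℕ) ≠ 0} => τ i) h1
    obtain ⟨k, hk⟩ := (hZ.flow_eq_self_iff (τ i) u).1 hi.symm
    simp only [τ] at hk
    have h4 : ((i : Fin c) : ℝ) = k * c := by
      field_simp at hk
      have := Real.pi_pos
      nlinarith [hk]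
    have h5 : (((i : Fin c) : ℕ) : ℤ) = k * c := by exact_mod_cast h4
    have h6 := (i : Fin c).2
    have h7 : (c : ℤ) ∣ (((i : Fin c) : ℕ) : ℤ) := ⟨k, by rw [h5, mul_comm]⟩
    exact i.2 (Nat.eq_zero_of_dvd_of_lt (Int.natCast_dvd_natCast.1 h7) h6)
  obtain ⟨ε, hε, hεc⟩ := hZ.exists_pos_forall_tangentMap_flow hemb (hZ.flow s u)
  obtain ⟨δ, hδ, hδG⟩ := Metric.isOpen_iff.1 hG s hs
  -- Small enough for the two points not to be conjugate (ε) and for the second time to stay in `G`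
  -- (δ).
  let t : ℝ := min ε δ / 2
  have ht0 : 0 < t := half_pos (lt_min hε hδ)
  have htε : t < ε := (half_lt_self (lt_min hε hδ)).trans_le (min_le_left _ _)
  have htδ : t < δ := (half_lt_self (lt_min hε hδ)).trans_le (min_le_right _ _)
  have hst : s + t ∈ G := hδG (by
    rw [Metric.mem_ball, Real.dist_eq, add_sub_cancel_left, abs_of_pos ht0]
    exact htδ)
  let P : ℝ → 𝔼 →L[ℝ] EuclideanSpace ℝ (Fin n) := fun s =>
    mfderiv (𝓡 d) (𝓡 n) (fun v => basePoint g (hZ.flow s v)) u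
  let R : 𝔼 →L[ℝ] 𝔼 := mfderiv (𝓡 d) (𝓡 d) (hZ.toNullGeodesic hc) u
  have hR : Function.Injective R := (IsLocalDiffeomorph.mfderiv_bijective hr u).1
  -- At a time in `G` only the branch i = 0 passes through the given null geodesic, so the tangent
  -- space of the sky is controlled by the kernel of a single projection.
  have hsky : ∀ s ∈ G, (skyTangent (𝓡 d) (hZ.line u s, Circle.exp (c * s))
      (hZ.toNullGeodesic hc u) : Submodule ℝ 𝔼) ≤ (LinearMap.ker (P s).toLinearMap).map
        R.toLinearMap := by
    intro s hs
    refine Submodule.span_le.2 ?_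
    rintro ξ ⟨σ, hσ, hσs, hv⟩
    obtain ⟨i, ζ, h1, h2, h3⟩ := hZ.exists_of_velocity_mem_sky hemb hc hr hσ hσs hv
    have hi : (i : ℕ) = 0 := by
      by_contra hi
      exact hs i hi h2
    have hs0 : s + i * (2 * Real.pi / c) = s := by rw [hi]; simp
    rw [hs0] at h3
    refine ⟨ζ, ?_, h1⟩
    have h4 : HEq (P s ζ) (0 : EuclideanSpace ℝ (Fin n)) := (TotalSpace.mk.inj h3).2
    exact eq_of_heq h4
  refine ⟨_, ⟨s, hZ.nullCurve_one_zero u s⟩, _, ⟨s + t, hZ.nullCurve_one_zero u (s + t)⟩, ?_⟩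
  suffices hdisj : Disjoint ((LinearMap.ker (P s).toLinearMap).map R.toLinearMap)
      ((LinearMap.ker (P (s + t)).toLinearMap).map R.toLinearMap) from
    Disjoint.mono (hsky s hs) (hsky (s + t) hst) hdisj
  rw [Submodule.disjoint_def]
  rintro _ ⟨ζ, hζ, rfl⟩ ⟨ζ', hζ', hζζ'⟩
  obtain rfl : ζ' = ζ := hR hζζ'
  let F : 𝔼 →L[ℝ] 𝔼 := mfderiv (𝓡 d) (𝓡 d) (hZ.flow s) u
  have hfl : ∀ s v, MDifferentiableAt (𝓡 d) (𝓡 d) (hZ.flow s) v := fun s v =>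
    (hZ.contMDiff_flow_right hemb s).mdifferentiable (by simp) v
  have hbp : ∀ v, MDifferentiableAt (𝓡 d) (𝓡 n) (basePoint g) v := fun v =>
    (contMDiff_basePoint hemb).mdifferentiable (by simp) v
  have hF' : Function.Surjective F := fun ζ => hZ.mfderiv_flow_neg hemb s u ζ
  have hF : Function.Injective F := LinearMap.injective_iff_surjective.2 hF'
  have h1 : ∀ ζ, P s ζ = mfderiv (𝓡 d) (𝓡 n) (basePoint g) (hZ.flow s u) (F ζ) := fun ζ =>
    congrArg (fun L : 𝔼 →L[ℝ] EuclideanSpace ℝ (Fin n) => L ζ)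
      (mfderiv_comp (g := basePoint g) (f := hZ.flow s) u (hbp _) (hfl s u))
  have h2 : ∀ ζ, P (s + t) ζ
      = mfderiv (𝓡 d) (𝓡 n) (fun v => basePoint g (hZ.flow t v)) (hZ.flow s u) (F ζ) := fun ζ => by
    have h3 : (fun v => basePoint g (hZ.flow (s + t) v))
        = fun v => basePoint g (hZ.flow t (hZ.flow s v)) := by
      funext v
      rw [add_comm, flow_add]
    have h4 : P (s + t) = mfderiv (𝓡 d) (𝓡 n)
        (fun v => basePoint g (hZ.flow t (hZ.flow s v))) u := by
      simp only [P]
      rw [h3]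
    rw [h4]
    exact congrArg (fun L : 𝔼 →L[ℝ] EuclideanSpace ℝ (Fin n) => L ζ)
      (mfderiv_comp (g := fun v => basePoint g (hZ.flow t v)) (f := hZ.flow s) u
        (MDifferentiableAt.comp (g := basePoint g) _ (hbp _) (hfl t _)) (hfl s u))
  have h5 : F ζ' = 0 := hεc t ht0.ne' (by rwa [abs_of_pos ht0]) (F ζ')
    ((h1 ζ').symm.trans hζ) ((h2 ζ').symm.trans hζ')
  have h6 : ζ' = 0 := hF (h5.trans (map_zero F).symm)
  rw [h6]
  exact map_zero R

-- Dimension count: two independent subspaces of dimension at least n - 1 inside a space of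
-- dimension d - 1 = 2n - 2 span it.
include hemb hr in
theorem isCanonicalContactStructure (hd : d + 1 = 2 * n)
    {ℋ : ∀ γ : NullGeodesic (lorentzMetric g c) dt, Submodule ℝ (TangentSpace (𝓡 d) γ)}
    (hℋ : IsPushforward (𝓡 d) (𝓡 d) (hZ.toNullGeodesic hc) (canonicalContact g) ℋ) :
    IsCanonicalContactStructure (𝓡 d) ℋ := by
  have hdim : ∀ u, Module.finrank ℝ (ℋ (hZ.toNullGeodesic hc u)) + 1 = d := fun u => by
    have h1 : Module.finrank ℝ (ℋ (hZ.toNullGeodesic hc u))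
        = Module.finrank ℝ (canonicalContact g (d := d) u) := by
      rw [hℋ u]
      exact (Submodule.equivMapOfInjective
        (mfderiv (𝓡 d) (𝓡 d) (hZ.toNullGeodesic hc) u).toLinearMap
        (IsLocalDiffeomorph.mfderiv_bijective hr u).1 (canonicalContact g u)).finrank_eq.symm
    rw [h1]
    exact hZ.finrank_canonicalContact hemb u
  refine ⟨fun γ => ?_, fun γ => ?_, fun γ x hx y hy hxy => ?_⟩ <;>
    obtain ⟨u, rfl⟩ := hZ.toNullGeodesic_surjective hc γ
  · rw [hdim u]
    exact (finrank_euclideanSpace_fin (𝕜 := ℝ) (n := d)).symm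
  · exact hZ.exists_notConjugate hemb hc hr u
  · let S : Submodule ℝ 𝔼 := skyTangent (𝓡 d) x (hZ.toNullGeodesic hc u)
    let T : Submodule ℝ 𝔼 := skyTangent (𝓡 d) y (hZ.toNullGeodesic hc u)
    let K : Submodule ℝ 𝔼 := ℋ (hZ.toNullGeodesic hc u)
    have hST : Disjoint S T := hxy
    have hS : n ≤ Module.finrank ℝ S + 1 := hZ.le_finrank_skyTangent hemb hc hr hx
    have hT : n ≤ Module.finrank ℝ T + 1 := hZ.le_finrank_skyTangent hemb hc hr hy
    have hK : Module.finrank ℝ K + 1 = d := hdim u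
    have hSK : S ≤ K := (hZ.skyTangent_le hemb hc hr hx).trans (hℋ u).ge
    have hTK : T ≤ K := (hZ.skyTangent_le hemb hc hr hy).trans (hℋ u).ge
    have h1 := Submodule.finrank_sup_add_finrank_inf_eq S T
    rw [hST.eq_bot, finrank_bot] at h1
    have h2 : S ⊔ T = K := Submodule.eq_of_le_of_finrank_le (sup_le hSK hTK) (by omega)
    exact h2.symm

end IsZoll

end Skies

/-! ### The action of ℤ_c by fractions of a turn. -/

section TurnAction

variable {n : ℕ} {Z : Type*} [TopologicalSpace Z] [ChartedSpace (EuclideanSpace ℝ (Fin n)) Z]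
  [IsManifold (𝓡 n) ∞ Z] {g : RiemannianMetric n Z} {c : ℕ}

namespace IsZoll

variable (hZ : IsZoll g)

/-- The flow through a multiple of a `c`-th of a turn depends on the multiple modulo `c` only. -/
lemma flow_turns_congr [T2Space Z] (hc : 0 < c) {k m : ℤ} (h : (k : ZMod c) = m)
    (u : unitTangentBundle g) :
    hZ.flow (k * (2 * Real.pi / c)) u = hZ.flow (m * (2 * Real.pi / c)) u := by
  obtain ⟨j, hj⟩ := (ZMod.intCast_eq_intCast_iff_dvd_sub _ _ _).1 h
  have hm : (m : ℝ) = k + c * j := by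
    have : m = k + c * j := by linarith
    exact_mod_cast this
  have h1 : (m : ℝ) * (2 * Real.pi / c) = k * (2 * Real.pi / c) + j * (2 * Real.pi) := by
    have : (c : ℝ) ≠ 0 := by positivity
    rw [hm]
    field_simp
  rw [h1, flow_add_int_mul_two_pi]

/-- Residues act through their representatives, which add only modulo `c`; the discrepancy is a
number of full periods, absorbed by `flow_turns_congr`. -/
lemma exists_turnAction [T2Space Z] (hc : 0 < c) :
    ∃ _ : AddAction (ZMod c) (unitTangentBundle g), ∀ (k : ℤ) (u : unitTangentBundle g),
      (k : ZMod c) +ᵥ u = hZ.flow (k * (2 * Real.pi / c)) u := by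
  have : NeZero c := ⟨hc.ne'⟩
  have hval : ∀ k : ZMod c, (((k.val : ℕ) : ℤ) : ZMod c) = k := fun k => by simp
  let A : AddAction (ZMod c) (unitTangentBundle g) :=
    { vadd := fun k u => hZ.flow (((k.val : ℕ) : ℤ) * (2 * Real.pi / c)) u
      zero_vadd := fun u => by
        change hZ.flow ((((0 : ZMod c).val : ℕ) : ℤ) * (2 * Real.pi / c)) u = u
        simp
      add_vadd := fun a b u => by
        change hZ.flow ((((a + b).val : ℕ) : ℤ) * (2 * Real.pi / c)) u
          = hZ.flow (((a.val : ℕ) : ℤ) * (2 * Real.pi / c))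
            (hZ.flow (((b.val : ℕ) : ℤ) * (2 * Real.pi / c)) u)
        rw [← flow_add, ← add_mul, ← Int.cast_add]
        refine hZ.flow_turns_congr hc ?_ u
        rw [Int.cast_add, hval, hval, hval] }
  exact ⟨A, fun k u => hZ.flow_turns_congr hc (hval _) u⟩

variable [AddAction (ZMod c) (unitTangentBundle g)]
  (hact : ∀ (k : ℤ) (u : unitTangentBundle g),
    (k : ZMod c) +ᵥ u = hZ.flow (k * (2 * Real.pi / c)) u)

include hact

lemma actsByTurns : ActsByTurns g c := fun u =>
  ⟨hZ.line u, hZ.isGeodesicOn_line u, hZ.velocity_line_zero u, by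
    have h := hact 1 u
    rw [Int.cast_one, Int.cast_one, one_mul] at h
    rw [h, coe_flow]⟩

/-- Freeness of the action, from the minimal period: a shift by k/c of a turn that fixes a vector
has k divisible by c. -/
lemma isCancelVAdd [T2Space Z] (hc : 0 < c) : IsCancelVAdd (ZMod c) (unitTangentBundle g) where
  left_cancel' a u v h := vadd_left_cancel a h
  right_cancel' a b u h := by
    obtain ⟨k, rfl⟩ := ZMod.intCast_surjective a
    obtain ⟨m, rfl⟩ := ZMod.intCast_surjective b
    have hab : ((k - m : ℤ) : ZMod c) +ᵥ u = u := by
      rw [Int.cast_sub, sub_eq_neg_add, add_vadd, h, neg_vadd_vadd]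
    rw [hact, flow_eq_self_iff] at hab
    obtain ⟨j, hj⟩ := hab
    have hcr : (c : ℝ) ≠ 0 := by positivity
    have hpi := Real.pi_pos
    have h1 : ((k - m : ℤ) : ℝ) = j * c := by
      field_simp at hj
      nlinarith [hj]
    have h2 : k - m = j * c := by exact_mod_cast h1
    rw [← sub_eq_zero, ← Int.cast_sub, h2]
    simp

/-- Orbits are the fibres of `toNullGeodesic`, so the orbit space and the set of null geodesics are
in bijection. -/
lemma mk_eq_mk_iff [T2Space Z] (hc : 0 < c) {u u' : unitTangentBundle g} :
    (Quotient.mk _ u : AddAction.orbitRel.Quotient (ZMod c) (unitTangentBundle g))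
      = Quotient.mk _ u' ↔ hZ.toNullGeodesic hc u = hZ.toNullGeodesic hc u' := by
  rw [Quotient.eq, AddAction.orbitRel_apply, AddAction.mem_orbit_iff]
  constructor
  · rintro ⟨k, rfl⟩
    obtain ⟨k, rfl⟩ := ZMod.intCast_surjective k
    rw [hact, toNullGeodesic_flow]
  · intro h
    obtain ⟨i, hi⟩ := hZ.exists_eq_flow_of_toNullGeodesic_eq hc h
    exact ⟨((i : ℕ) : ℤ), by rw [hact, hi]; simp⟩

lemma mk_flow (k : ℤ) (u : unitTangentBundle g) :
    (Quotient.mk _ (hZ.flow (k * (2 * Real.pi / c)) u) :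
      AddAction.orbitRel.Quotient (ZMod c) (unitTangentBundle g)) = Quotient.mk _ u :=
  Quotient.sound ⟨(k : ZMod c), hact k u⟩

end IsZoll

end TurnAction

/-! ### Smooth structures on STZ/ℤ_c and on 𝒩_c. -/

section QuotientManifold

variable {n : ℕ} {Z : Type*} [TopologicalSpace Z] [ChartedSpace (EuclideanSpace ℝ (Fin n)) Z]
  [IsManifold (𝓡 n) ∞ Z] {g : RiemannianMetric n Z} {c : ℕ}
  {d : ℕ} [ChartedSpace (EuclideanSpace ℝ (Fin d)) (unitTangentBundle g)]
  [IsManifold (𝓡 d) ∞ (unitTangentBundle g)]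
  (hemb : IsSmoothEmbedding (𝓡 d) (𝓡 n).tangent ∞
    (Subtype.val : unitTangentBundle g → TangentBundle (𝓡 n) Z))
  (hZ : IsZoll g) [T2Space Z] (hc : 0 < c)

namespace IsZoll

include hemb in
theorem exists_quotient_manifold_of_flow {Y : Type*} [TopologicalSpace Y]
    {r : unitTangentBundle g → Y} (hr : IsLocalHomeomorph r) (hs : Function.Surjective r)
    (hinv : ∀ u u', r u = r u' → ∃ t, u = hZ.flow t u' ∧ ∀ v, r (hZ.flow t v) = r v) :
    ∃ _ : ChartedSpace (EuclideanSpace ℝ (Fin d)) Y, IsManifold (𝓡 d) ∞ Y ∧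
      IsLocalDiffeomorph (𝓡 d) (𝓡 d) ∞ r :=
  exists_quotient_manifold hr hs fun x x' h => by
    obtain ⟨t, h1, h2⟩ := hinv x' x h.symm
    exact ⟨hZ.flow t, hZ.contMDiff_flow_right hemb t x, h1.symm, h2⟩

variable [AddAction (ZMod c) (unitTangentBundle g)]
  (hact : ∀ (k : ℤ) (u : unitTangentBundle g),
    (k : ZMod c) +ᵥ u = hZ.flow (k * (2 * Real.pi / c)) u)

-- Two vectors in a fibre differ by a flow map that is a deck transformation for both quotient maps
-- at once, as needed for the smooth structures and for the descent of χ.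
include hact in
lemma exists_flow_of_toNullGeodesic_eq {u u' : unitTangentBundle g}
    (h : hZ.toNullGeodesic hc u = hZ.toNullGeodesic hc u') :
    ∃ t, u = hZ.flow t u' ∧ ∀ v, hZ.toNullGeodesic hc (hZ.flow t v) = hZ.toNullGeodesic hc v ∧
      (Quotient.mk _ (hZ.flow t v) : AddAction.orbitRel.Quotient (ZMod c) (unitTangentBundle g))
        = Quotient.mk _ v := by
  obtain ⟨i, hi⟩ := hZ.exists_eq_flow_of_toNullGeodesic_eq hc h
  refine ⟨((i : ℕ) : ℤ) * (2 * Real.pi / c), by rw [hi]; simp, fun v =>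
    ⟨hZ.toNullGeodesic_flow hc v _, hZ.mk_flow hact _ v⟩⟩

-- A finite group acting freely by homeomorphisms on a locally compact Hausdorff space: the quotient
-- map is a covering and the quotient is Hausdorff.
include hemb hact hc in
lemma quotient_topology :
    IsLocalHomeomorph (Quotient.mk _ : unitTangentBundle g →
      AddAction.orbitRel.Quotient (ZMod c) (unitTangentBundle g)) ∧
    T2Space (AddAction.orbitRel.Quotient (ZMod c) (unitTangentBundle g)) := by
  have : NeZero c := ⟨hc.ne'⟩
  have := hZ.isCancelVAdd hact hc
  have : IsManifold (𝓡 n) 1 Z := IsManifold.of_le (n := ∞) (by simp)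
  have : T2Space (TangentBundle (𝓡 n) Z) := t2Space_tangentBundle
  have : LocallyCompactSpace (unitTangentBundle g) :=
    ChartedSpace.locallyCompactSpace (EuclideanSpace ℝ (Fin d)) _
  have : ContinuousConstVAdd (ZMod c) (unitTangentBundle g) := ⟨fun a => by
    obtain ⟨k, rfl⟩ := ZMod.intCast_surjective a
    simp only [hact]
    exact (hZ.contMDiff_flow_right hemb _).continuous⟩
  exact ⟨isAddQuotientCoveringMap_quotientMk_of_properlyDiscontinuousVAdd.isCoveringMap.isLocalHomeomorph,
    t2Space_of_properlyDiscontinuousVAdd_of_t2Space⟩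

include hemb hact hc in
theorem exists_orbitQuotient_manifold :
    ∃ _ : ChartedSpace (EuclideanSpace ℝ (Fin d))
      (AddAction.orbitRel.Quotient (ZMod c) (unitTangentBundle g)),
      IsManifold (𝓡 d) ∞ (AddAction.orbitRel.Quotient (ZMod c) (unitTangentBundle g)) ∧
      IsLocalDiffeomorph (𝓡 d) (𝓡 d) ∞
        (Quotient.mk _ : unitTangentBundle g →
          AddAction.orbitRel.Quotient (ZMod c) (unitTangentBundle g)) :=
  hZ.exists_quotient_manifold_of_flow hemb (hZ.quotient_topology hemb hc hact).1
    Quotient.mk_surjective fun u u' h => by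
      obtain ⟨t, h1, h2⟩ := hZ.exists_flow_of_toNullGeodesic_eq hc hact
        ((hZ.mk_eq_mk_iff hact hc).1 h)
      exact ⟨t, h1, fun v => (h2 v).2⟩

-- The topology is transported from the orbit space along the bijection of `mk_eq_mk_iff`. The
-- smooth structure is then the quotient structure for `toNullGeodesic`, which has become a local
-- homeomorphism.
include hemb hact in
theorem exists_nullGeodesic_manifold [SecondCountableTopology Z] :
    ∃ (_ : TopologicalSpace (NullGeodesic (lorentzMetric g c) dt))
      (_ : ChartedSpace (EuclideanSpace ℝ (Fin d)) (NullGeodesic (lorentzMetric g c) dt)),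
      IsManifold (𝓡 d) ∞ (NullGeodesic (lorentzMetric g c) dt) ∧
      T2Space (NullGeodesic (lorentzMetric g c) dt) ∧
      SecondCountableTopology (NullGeodesic (lorentzMetric g c) dt) ∧
      IsLocalDiffeomorph (𝓡 d) (𝓡 d) ∞ (hZ.toNullGeodesic hc) := by
  let Q := AddAction.orbitRel.Quotient (ZMod c) (unitTangentBundle g)
  let f : Q → NullGeodesic (lorentzMetric g c) dt :=
    Quotient.lift (hZ.toNullGeodesic hc) fun u u' h =>
      (hZ.mk_eq_mk_iff hact hc).1 (Quotient.sound h)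
  have hf : Function.Bijective f := by
    constructor
    · rintro ⟨u⟩ ⟨u'⟩ h
      exact (hZ.mk_eq_mk_iff hact hc).2 h
    · intro γ
      obtain ⟨u, rfl⟩ := hZ.toNullGeodesic_surjective hc γ
      exact ⟨Quotient.mk _ u, rfl⟩
  let e := Equiv.ofBijective f hf
  let T : TopologicalSpace (NullGeodesic (lorentzMetric g c) dt) :=
    TopologicalSpace.induced e.symm inferInstance
  let h : NullGeodesic (lorentzMetric g c) dt ≃ₜ Q := e.symm.toHomeomorphOfIsInducing ⟨rfl⟩
  obtain ⟨h1, h2⟩ := hZ.quotient_topology hemb hc hact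
  have hr : hZ.toNullGeodesic hc = h.symm ∘ (Quotient.mk _ : unitTangentBundle g → Q) := rfl
  have hloc : IsLocalHomeomorph (hZ.toNullGeodesic hc) := by
    rw [hr]
    exact h.symm.isLocalHomeomorph.comp h1
  obtain ⟨C, hC, hC'⟩ := hZ.exists_quotient_manifold_of_flow hemb hloc
    (hZ.toNullGeodesic_surjective hc) fun u u' h => by
      obtain ⟨t, h1, h2⟩ := hZ.exists_flow_of_toNullGeodesic_eq hc hact h
      exact ⟨t, h1, fun v => (h2 v).1⟩
  have : IsManifold (𝓡 n) 1 Z := IsManifold.of_le (n := ∞) (by simp)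
  have : SecondCountableTopology (TangentBundle (𝓡 n) Z) := secondCountableTopology_tangentBundle
  have : SecondCountableTopology (unitTangentBundle g) := inferInstance
  refine ⟨T, C, hC, h.symm.t2Space, ?_, hC'⟩
  have hQ : SecondCountableTopology Q :=
    TopologicalSpace.Quotient.secondCountableTopology h1.isOpenMap
  exact h.secondCountableTopology

omit [IsManifold (𝓡 d) ∞ (unitTangentBundle g)] in
/-- The diffeomorphism between the space of null geodesics and the orbit space. -/
theorem exists_diffeomorph
    [TopologicalSpace (NullGeodesic (lorentzMetric g c) dt)]
    [ChartedSpace (EuclideanSpace ℝ (Fin d)) (NullGeodesic (lorentzMetric g c) dt)]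
    (hr : IsLocalDiffeomorph (𝓡 d) (𝓡 d) ∞ (hZ.toNullGeodesic hc))
    [ChartedSpace (EuclideanSpace ℝ (Fin d))
      (AddAction.orbitRel.Quotient (ZMod c) (unitTangentBundle g))]
    (hr' : IsLocalDiffeomorph (𝓡 d) (𝓡 d) ∞
        (Quotient.mk _ : unitTangentBundle g →
          AddAction.orbitRel.Quotient (ZMod c) (unitTangentBundle g)))
    (hact : ∀ (k : ℤ) (u : unitTangentBundle g),
      (k : ZMod c) +ᵥ u = hZ.flow (k * (2 * Real.pi / c)) u) :
    ∃ Ψ : NullGeodesic (lorentzMetric g c) dt ≃ₘ^∞⟮𝓡 d, 𝓡 d⟯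
        AddAction.orbitRel.Quotient (ZMod c) (unitTangentBundle g),
      ∀ u, Ψ (hZ.toNullGeodesic hc u) = Quotient.mk _ u := by
  let Q := AddAction.orbitRel.Quotient (ZMod c) (unitTangentBundle g)
  let f : Q → NullGeodesic (lorentzMetric g c) dt :=
    Quotient.lift (hZ.toNullGeodesic hc) fun u u' h =>
      (hZ.mk_eq_mk_iff hact hc).1 (Quotient.sound h)
  have hf : Function.Bijective f := by
    constructor
    · rintro ⟨u⟩ ⟨u'⟩ h
      exact (hZ.mk_eq_mk_iff hact hc).2 h
    · intro γ
      obtain ⟨u, rfl⟩ := hZ.toNullGeodesic_surjective hc γ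
      exact ⟨Quotient.mk _ u, rfl⟩
  let e := Equiv.ofBijective f hf
  have he : ∀ u, e.symm (hZ.toNullGeodesic hc u) = Quotient.mk _ u := fun u =>
    e.symm_apply_apply (Quotient.mk _ u)
  refine ⟨⟨e.symm, ?_, ?_⟩, he⟩
  · refine contMDiff_of_comp_isLocalDiffeomorph hr (hZ.toNullGeodesic_surjective hc) ?_
    exact hr'.contMDiff.congr he
  · refine contMDiff_of_comp_isLocalDiffeomorph hr' Quotient.mk_surjective ?_
    exact hr.contMDiff

end IsZoll

end QuotientManifold

/-- Local smooth angles on the circle. -/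
lemma exists_local_angle (z₀ : Circle) :
    ∃ θ : Circle → ℝ, ContMDiffAt (𝓡 1) 𝓘(ℝ, ℝ) ∞ θ z₀ ∧ ∀ z, Circle.exp (θ z) = z := by
  let w : Circle → ℂ := fun z => (z : ℂ) * star (z₀ : ℂ)
  have hw : ∀ z, w z = ((z * z₀⁻¹ : Circle) : ℂ) := fun z => by
    rw [Circle.coe_mul, Circle.coe_inv_eq_conj]
    rfl
  -- Dividing by z₀ moves the branch cut of the logarithm away from the point considered; the
  -- exponential identity itself holds everywhere.
  refine ⟨fun z => Complex.arg z₀ + (Complex.log (w z)).im, ?_, fun z => ?_⟩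
  · have h1 : w z₀ = 1 := by rw [hw, mul_inv_cancel, Circle.coe_one]
    have h2 : ContDiffAt ℝ ∞ (fun x : ℂ => Complex.arg z₀ + (Complex.log (x * star (z₀ : ℂ))).im)
        (z₀ : ℂ) := by
      refine contDiffAt_const.add
        (ContDiffAt.comp (g := Complex.imCLM) (f := fun x => Complex.log (x * star (z₀ : ℂ))) _
          Complex.imCLM.contDiff.contDiffAt ?_)
      refine ContDiffAt.comp (g := Complex.log) _ ?_ (contDiffAt_id.mul contDiffAt_const)
      refine (Complex.contDiffAt_log ?_).restrict_scalars ℝ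
      change w z₀ ∈ _
      rw [h1]
      exact Complex.one_mem_slitPlane
    exact ContMDiffAt.comp (g := fun x : ℂ => Complex.arg z₀ + (Complex.log (x * star (z₀ : ℂ))).im)
      z₀ h2.contMDiffAt (contMDiff_circle_coe z₀)
  · change Circle.exp (Complex.arg z₀ + (Complex.log (w z)).im) = z
    rw [Circle.exp_add, Circle.exp_arg, Complex.log_im, hw, Circle.exp_arg, mul_comm,
      inv_mul_cancel_right]

/-! ### The projection q and its submersivity. -/

section Projection

variable {n : ℕ} {Z : Type*} [TopologicalSpace Z] [ChartedSpace (EuclideanSpace ℝ (Fin n)) Z]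
  [IsManifold (𝓡 n) ∞ Z] {g : RiemannianMetric n Z} {c : ℕ} (hZ : IsZoll g) [T2Space Z]
  (hc : 0 < c)

namespace IsZoll

lemma toNullGeodesic_eq_of_velocity_eq {u u' : unitTangentBundle g} {a a' b b' : ℝ} (ha : a ≠ 0)
    (ha' : a' ≠ 0)
    (h : velocity ((𝓡 n).prod (𝓡 1)) (hZ.nullCurve c u a b) 0 = velocity ((𝓡 n).prod (𝓡 1)) (hZ.nullCurve c u' a' b') 0) :
    hZ.toNullGeodesic hc u = hZ.toNullGeodesic hc u' := by
  have h1 : hZ.nullCurve c u a b = hZ.nullCurve c u' a' b' := funext fun s =>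
    hZ.eqOn_nullCurve hc (hZ.isGeodesicOn_nullCurve hc u a b) (mem_univ 0) h (mem_univ s)
  refine Subtype.ext ?_
  change range _ = range _
  rw [← hZ.range_nullCurve u ha b, ← hZ.range_nullCurve u' ha' b', h1]

/-- The null geodesic with a given initial velocity. -/
def nullProjection (v : futureCone (lorentzMetric g c) dt) : NullGeodesic (lorentzMetric g c) dt :=
  hZ.toNullGeodesic hc (hZ.flow (-(Complex.arg v.1.1.2 / c)) (futureConeUnit hc v))

omit [T2Space Z] in
lemma circleDt_div_ne_zero (hc : 0 < c) (v : futureCone (lorentzMetric g c) dt) :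
    circleDt (timePart v.1) / c ≠ 0 := by
  have := (mem_futureCone_iff.1 v.2).1
  positivity

/-- The definition uses the discontinuous argument. Every other choice of angle gives the same null
geodesic, so near any point a smooth angle can replace it. -/
lemma nullProjection_eq (v : futureCone (lorentzMetric g c) dt) {θ : ℝ}
    (hθ : Circle.exp θ = v.1.1.2) :
    hZ.nullProjection hc v = hZ.toNullGeodesic hc (hZ.flow (-(θ / c)) (futureConeUnit hc v)) :=
  hZ.toNullGeodesic_eq_of_velocity_eq hc (circleDt_div_ne_zero hc v) (circleDt_div_ne_zero hc v)
    ((hZ.velocity_nullCurve_futureConeUnit hc v (Circle.exp_arg _)).trans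
      (hZ.velocity_nullCurve_futureConeUnit hc v hθ).symm)

lemma isGeodesicProjection_nullProjection : IsGeodesicProjection (hZ.nullProjection (c := c) hc) :=
  fun v => ⟨_, univ, hZ.isMaximalGeodesic_nullCurve hc _ _ _, mem_univ 0,
    hZ.velocity_nullCurve_futureConeUnit hc v (Circle.exp_arg _), by
      rw [image_univ, hZ.range_nullCurve _ (circleDt_div_ne_zero hc v)]
      rfl⟩

variable (c) in
/-- The initial velocities of the null geodesics with fixed parametrization. -/
def nullVelocity (u : unitTangentBundle g) {a : ℝ} (ha : 0 < a) (b : ℝ) :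
    futureCone (lorentzMetric g c) dt :=
  ⟨velocity ((𝓡 n).prod (𝓡 1)) (hZ.nullCurve c u a b) 0, hZ.velocity_nullCurve_mem hc u ha b 0⟩

lemma nullProjection_nullVelocity (u : unitTangentBundle g) {a : ℝ} (ha : 0 < a) (b : ℝ) :
    hZ.nullProjection hc (hZ.nullVelocity c hc u ha b) = hZ.toNullGeodesic hc u :=
  hZ.toNullGeodesic_eq_of_velocity_eq hc (circleDt_div_ne_zero hc _) ha.ne'
    (hZ.velocity_nullCurve_futureConeUnit hc (hZ.nullVelocity c hc u ha b) (Circle.exp_arg _))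

lemma nullProjection_surjective : Function.Surjective (hZ.nullProjection (c := c) hc) := fun γ => by
  obtain ⟨u, rfl⟩ := hZ.toNullGeodesic_surjective hc γ
  exact ⟨_, hZ.nullProjection_nullVelocity hc u one_pos 0⟩

variable {d : ℕ} [ChartedSpace (EuclideanSpace ℝ (Fin d)) (unitTangentBundle g)]
  [IsManifold (𝓡 d) ∞ (unitTangentBundle g)]
  (hemb : IsSmoothEmbedding (𝓡 d) (𝓡 n).tangent ∞
    (Subtype.val : unitTangentBundle g → TangentBundle (𝓡 n) Z))
  {m : ℕ} [ChartedSpace (EuclideanSpace ℝ (Fin m)) (futureCone (lorentzMetric g c) dt)]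
  [IsManifold (𝓡 m) ∞ (futureCone (lorentzMetric g c) dt)]
  (hembC : IsSmoothEmbedding (𝓡 m) ((𝓡 n).prod (𝓡 1)).tangent ∞
    (Subtype.val : futureCone (lorentzMetric g c) dt → TangentBundle ((𝓡 n).prod (𝓡 1)) (Z × Circle)))

include hemb hembC in
omit [IsManifold (𝓡 m) ∞ (futureCone (lorentzMetric g c) dt)] [T2Space Z] in
lemma contMDiff_futureConeUnit : ContMDiff (𝓡 m) (𝓡 d) ∞ (futureConeUnit (g := g) (c := c) hc) := by
  intro v
  refine IsSmoothEmbedding.contMDiffAt_of_comp hemb ?_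
  have hval := hembC.contMDiff
  have h1 : ContMDiff (𝓡 m) (𝓡 n).tangent ∞
      fun v : futureCone (lorentzMetric g c) dt => spacePart v.1 := contMDiff_spacePart.comp hval
  have h2 : ContMDiff (𝓡 m) 𝓘(ℝ, ℝ) ∞
      fun v : futureCone (lorentzMetric g c) dt => circleDt (timePart v.1) :=
    (contMDiff_circleDt.comp contMDiff_timePart).comp hval
  have h3 : ContMDiffAt (𝓡 m) 𝓘(ℝ, ℝ) ∞
      (fun v : futureCone (lorentzMetric g c) dt => c / circleDt (timePart v.1)) v :=
    contMDiffAt_const.div₀ (h2 v) (mem_futureCone_iff.1 v.2).1.ne'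
  exact ContMDiffAt.tangent_smul (h1 v) h3

include hembC in
lemma contMDiff_nullVelocity (hemb : IsSmoothEmbedding (𝓡 d) (𝓡 n).tangent ∞
    (Subtype.val : unitTangentBundle g → TangentBundle (𝓡 n) Z)) {a : ℝ} (ha : 0 < a) (b : ℝ) :
    ContMDiff (𝓡 d) (𝓡 m) ∞ fun u => hZ.nullVelocity c hc u ha b := by
  intro u
  refine IsSmoothEmbedding.contMDiffAt_of_comp hembC ?_
  -- The circle component of the velocity is the same for all `u`, so only the component in TZ has
  -- to be examined.
  let κ : TangentBundle (𝓡 1) Circle :=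
    velocity (𝓡 1) (fun s : ℝ => Circle.exp (c * a * s + c * b)) 0
  let F : unitTangentBundle g → TangentBundle (𝓡 n) Z := fun u =>
    ⟨(hZ.flow b u).1.1, a • (hZ.flow b u).1.2⟩
  have hF : ContMDiff (𝓡 d) (𝓡 n).tangent ∞ F := fun u =>
    ContMDiffAt.tangent_smul ((hemb.contMDiff.comp (hZ.contMDiff_flow_right hemb b)) u)
      contMDiffAt_const
  have h1 : (fun u => (hZ.nullVelocity c hc u ha b).1)
      = fun u => (equivTangentBundleProd (𝓡 n) Z (𝓡 1) Circle).symm (F u, κ) := by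
    funext u
    have hd := (hZ.contMDiff_nullCurve (c := c) u a b).mdifferentiable (by simp) 0
    rw [Equiv.eq_symm_apply]
    have h2 := spacePart_velocity hd
    have h3 := timePart_velocity hd
    rw [spacePart, tangentMap_prodFst] at h2
    rw [timePart, tangentMap_prodSnd] at h3
    refine Prod.ext (h2.trans ?_) h3
    refine (hZ.velocity_line_affine u a b 0).trans ?_
    have h4 : a * 0 + b = b := by ring
    rw [h4]
    rfl
  rw [h1]
  exact (contMDiff_equivTangentBundleProd_symm (n := ∞)).contMDiffAt.comp u
    ((hF u).prodMk contMDiffAt_const)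

variable [TopologicalSpace (NullGeodesic (lorentzMetric g c) dt)]
  [ChartedSpace (EuclideanSpace ℝ (Fin d)) (NullGeodesic (lorentzMetric g c) dt)]
  (hr : IsLocalDiffeomorph (𝓡 d) (𝓡 d) ∞ (hZ.toNullGeodesic hc))

include hemb hembC hr in
omit [IsManifold (𝓡 m) ∞ (futureCone (lorentzMetric g c) dt)] in
lemma contMDiff_nullProjection : ContMDiff (𝓡 m) (𝓡 d) ∞ (hZ.nullProjection (c := c) hc) := by
  intro v
  obtain ⟨θ, hθ, hθe⟩ := exists_local_angle v.1.1.2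
  have h1 : hZ.nullProjection (c := c) hc = fun v =>
      hZ.toNullGeodesic hc (hZ.flow (-(θ v.1.1.2 / c)) (futureConeUnit hc v)) :=
    funext fun v => hZ.nullProjection_eq hc v (hθe _)
  have hπ : ContMDiff (𝓡 m) (𝓡 1) ∞
      fun v : futureCone (lorentzMetric g c) dt => v.1.1.2 :=
    contMDiff_snd.comp ((contMDiff_proj (TangentSpace ((𝓡 n).prod (𝓡 1)))).comp hembC.contMDiff)
  have h2 : ContMDiffAt (𝓡 m) 𝓘(ℝ, ℝ) ∞
      (fun v : futureCone (lorentzMetric g c) dt => -(θ v.1.1.2 / c)) v :=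
    ((ContMDiffAt.comp (g := θ) v hθ (hπ v)).div_const _).neg
  rw [h1]
  exact ContMDiffAt.comp (g := hZ.toNullGeodesic hc) v (hr.contMDiff _)
    (ContMDiffAt.comp (g := fun p : ℝ × unitTangentBundle g => hZ.flow p.1 p.2) v
      (hZ.contMDiff_flow hemb _) (h2.prodMk (contMDiff_futureConeUnit hc hemb hembC v)))

-- Fixing the speed and offset of `v` gives a smooth map `S` from STZ to C⁺ through `v` whose
-- composition with the projection is the local diffeomorphism `toNullGeodesic`. Hence the
-- differential of the projection is onto; the two remaining dimensions are scaling and translation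
-- of the parameter.
include hemb hembC hr in
theorem isSubmersion_nullProjection
    [IsManifold (𝓡 d) ∞ (NullGeodesic (lorentzMetric g c) dt)] (hm : m = d + 2) :
    IsSubmersion (𝓡 m) (𝓡 d) ∞ (hZ.nullProjection (c := c) hc) := by
  have hq := hZ.contMDiff_nullProjection hc hemb hembC hr
  refine isSubmersion_of_surjective_mfderiv (k := 2) (by simp [hm]) hq fun v => ?_
  obtain ⟨hpos, -⟩ := mem_futureCone_iff.1 v.2
  have ha : 0 < circleDt (timePart v.1) / c := by positivity
  obtain ⟨θ, hθ⟩ := Circle.exp_surjective v.1.1.2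
  let u := hZ.flow (-(θ / c)) (futureConeUnit hc v)
  let S : unitTangentBundle g → futureCone (lorentzMetric g c) dt := fun w =>
    hZ.nullVelocity c hc w ha (θ / c)
  have hS : ContMDiff (𝓡 d) (𝓡 m) ∞ S := hZ.contMDiff_nullVelocity hc hembC hemb ha _
  have hSu : S u = v := Subtype.ext (hZ.velocity_nullCurve_futureConeUnit hc v hθ)
  have h1 : (fun w => hZ.nullProjection hc (S w)) = hZ.toNullGeodesic hc :=
    funext fun w => hZ.nullProjection_nullVelocity hc w ha _
  have h2 : mfderiv (𝓡 d) (𝓡 d) (fun w => hZ.nullProjection hc (S w)) u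
      = (mfderiv (𝓡 m) (𝓡 d) (hZ.nullProjection (c := c) hc) (S u)).comp
        (mfderiv (𝓡 d) (𝓡 m) S u) :=
    mfderiv_comp (g := hZ.nullProjection (c := c) hc) u (hq.mdifferentiable (by simp) _)
      (hS.mdifferentiable (by simp) u)
  let A : EuclideanSpace ℝ (Fin d) →L[ℝ] EuclideanSpace ℝ (Fin d) :=
    mfderiv (𝓡 d) (𝓡 d) (fun w => hZ.nullProjection hc (S w)) u
  have hA : Function.Surjective A := by
    have h3 : A = mfderiv (𝓡 d) (𝓡 d) (hZ.toNullGeodesic hc) u := by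
      simp only [A]
      rw [h1]
    rw [h3]
    exact (IsLocalDiffeomorph.mfderiv_bijective hr u).2
  rw [← hSu]
  intro ζ
  obtain ⟨ξ, hξ⟩ := hA ζ
  exact ⟨mfderiv (𝓡 d) (𝓡 m) S u ξ, (congrArg (fun L : EuclideanSpace ℝ (Fin d) →L[ℝ]
    EuclideanSpace ℝ (Fin d) => L ξ) h2).symm.trans hξ⟩

end IsZoll

end Projection

end NullGeodesics

end

/-! ### The theorem. -/

open NullGeodesics in
theorem proposition3p13 {n : ℕ} (hn : 2 ≤ n) {Z : Type*} [TopologicalSpace Z]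
    [ChartedSpace (EuclideanSpace ℝ (Fin n)) Z] [IsManifold (𝓡 n) ∞ Z]
    [T2Space Z] [SecondCountableTopology Z] [ConnectedSpace Z]
    (g : RiemannianMetric n Z) (hZ : IsZoll g) (c : ℕ) (hc : 0 < c) :
    -- the manifold `STZ`, an embedded submanifold of `TZ`
    ∃ (_ : ChartedSpace (EuclideanSpace ℝ (Fin (2 * n - 1))) (unitTangentBundle g)),
      IsManifold (𝓡 (2 * n - 1)) ∞ (unitTangentBundle g) ∧
      IsSmoothEmbedding (𝓡 (2 * n - 1)) (𝓡 n).tangent ∞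
        (Subtype.val : unitTangentBundle g → TangentBundle (𝓡 n) Z) ∧
    -- the manifold `STZ/ℤ_c`, with the quotient topology and locally diffeomorphic to `STZ`
    ∃ (_ : AddAction (ZMod c) (unitTangentBundle g)),
      ActsByTurns g c ∧
    ∃ (_ : ChartedSpace (EuclideanSpace ℝ (Fin (2 * n - 1)))
        (AddAction.orbitRel.Quotient (ZMod c) (unitTangentBundle g))),
      IsManifold (𝓡 (2 * n - 1)) ∞
        (AddAction.orbitRel.Quotient (ZMod c) (unitTangentBundle g)) ∧
      IsLocalDiffeomorph (𝓡 (2 * n - 1)) (𝓡 (2 * n - 1)) ∞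
        (Quotient.mk _ : unitTangentBundle g →
          AddAction.orbitRel.Quotient (ZMod c) (unitTangentBundle g)) ∧
    -- the manifold `C⁺`, an embedded submanifold of `T(Z × S¹)`
    ∃ (_ : ChartedSpace (EuclideanSpace ℝ (Fin (2 * n + 1)))
        (futureCone (lorentzMetric g c) dt)),
      IsManifold (𝓡 (2 * n + 1)) ∞ (futureCone (lorentzMetric g c) dt) ∧
      IsSmoothEmbedding (𝓡 (2 * n + 1)) ((𝓡 n).prod (𝓡 1)).tangent ∞
        (Subtype.val : futureCone (lorentzMetric g c) dt →
          TangentBundle ((𝓡 n).prod (𝓡 1)) (Z × Circle)) ∧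
    -- the manifold `𝒩_c`, with the smooth structure for which `q : C⁺ → 𝒩_c` is a submersion
    ∃ (_ : TopologicalSpace (NullGeodesic (lorentzMetric g c) dt))
      (_ : ChartedSpace (EuclideanSpace ℝ (Fin (2 * n - 1)))
        (NullGeodesic (lorentzMetric g c) dt)),
      IsManifold (𝓡 (2 * n - 1)) ∞ (NullGeodesic (lorentzMetric g c) dt) ∧
      T2Space (NullGeodesic (lorentzMetric g c) dt) ∧
      SecondCountableTopology (NullGeodesic (lorentzMetric g c) dt) ∧
    ∃ q : futureCone (lorentzMetric g c) dt → NullGeodesic (lorentzMetric g c) dt,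
      IsGeodesicProjection q ∧ Function.Surjective q ∧
      IsSubmersion (𝓡 (2 * n + 1)) (𝓡 (2 * n - 1)) ∞ q ∧
    -- the canonical contact structure of `𝒩_c` is `r_* χ`, up to a diffeomorphism
    ∃ (ℋ : ∀ γ : NullGeodesic (lorentzMetric g c) dt,
        Submodule ℝ (TangentSpace (𝓡 (2 * n - 1)) γ))
      (η : ∀ p : AddAction.orbitRel.Quotient (ZMod c) (unitTangentBundle g),
        Submodule ℝ (TangentSpace (𝓡 (2 * n - 1)) p))
      (Ψ : NullGeodesic (lorentzMetric g c) dt ≃ₘ^∞⟮𝓡 (2 * n - 1), 𝓡 (2 * n - 1)⟯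
        AddAction.orbitRel.Quotient (ZMod c) (unitTangentBundle g)),
      IsCanonicalContactStructure (𝓡 (2 * n - 1)) ℋ ∧
      IsPushforward (𝓡 (2 * n - 1)) (𝓡 (2 * n - 1))
        (Quotient.mk _ : unitTangentBundle g →
          AddAction.orbitRel.Quotient (ZMod c) (unitTangentBundle g))
        (canonicalContact g) η ∧
      IsPushforward (𝓡 (2 * n - 1)) (𝓡 (2 * n - 1)) Ψ ℋ η := by
  obtain ⟨C₁, hM₁, hemb⟩ := exists_unitTangentBundle_manifold g (by omega)
  obtain ⟨A, hact⟩ := hZ.exists_turnAction hc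
  obtain ⟨C₂, hM₂, hr'⟩ := hZ.exists_orbitQuotient_manifold hemb hc hact
  obtain ⟨C₃, hM₃, hembC⟩ := exists_futureCone_manifold g hc
  obtain ⟨T, C₄, hM₄, hT2, hSC, hr⟩ := hZ.exists_nullGeodesic_manifold hemb hc hact
  obtain ⟨η, hη⟩ := hZ.exists_isPushforward hemb hr'.contMDiff Quotient.mk_surjective
    fun u u' h => by
      obtain ⟨t, h1, h2⟩ := hZ.exists_flow_of_toNullGeodesic_eq hc hact
        ((hZ.mk_eq_mk_iff hact hc).1 h)
      exact ⟨t, h1, fun v => (h2 v).2⟩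
  obtain ⟨ℋ, hℋ⟩ := hZ.exists_isPushforward hemb hr.contMDiff (hZ.toNullGeodesic_surjective hc)
    fun u u' h => by
      obtain ⟨t, h1, h2⟩ := hZ.exists_flow_of_toNullGeodesic_eq hc hact h
      exact ⟨t, h1, fun v => (h2 v).1⟩
  obtain ⟨Ψ, hΨ⟩ := hZ.exists_diffeomorph hc hr hr' hact
  -- Both distributions are pushed forward from χ on STZ, and Ψ intertwines the two quotient maps.
  have hΨη : IsPushforward (𝓡 (2 * n - 1)) (𝓡 (2 * n - 1)) Ψ ℋ η :=
    IsPushforward.of_comp (hr.mdifferentiable (by simp)) (hZ.toNullGeodesic_surjective hc)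
      (Ψ.contMDiff.mdifferentiable (by simp)) hℋ (by
        have h : (fun u => Ψ (hZ.toNullGeodesic hc u)) = Quotient.mk _ := funext hΨ
        rw [h]
        exact hη)
  exact ⟨C₁, hM₁, hemb, A, hZ.actsByTurns hact, C₂, hM₂, hr', C₃, hM₃, hembC, T, C₄, hM₄, hT2, hSC,
    hZ.nullProjection hc, hZ.isGeodesicProjection_nullProjection hc,
    hZ.nullProjection_surjective hc,
    hZ.isSubmersion_nullProjection hc hemb hembC hr (by omega), ℋ, η, Ψ,
    hZ.isCanonicalContactStructure hemb hc hr (by omega) hℋ, hη, hΨη⟩
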